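/- **Setting.** Let $V\in L^3(\mathbb R^2)$ be compactly supported, spherically symmetric, non-negative almost everywhere and not almost everywhere zero, with $\widehat V(k)=\int_{\mathbb R^2} V(x)e^{-ik\cdot x}\,dx$. Let $\Lambda=[-1/2,1/2]^2$ with periodic boundary conditions, $\Lambda^*=2\pi\mathbb Z^2$, $\Lambda^*_+=\Lambda^*\setminus\{0\}$. For $N\in\mathbb N$ let $\mathcal F_+^{\le N}=\bigoplus_{n=0}^N L^2_\perp(\Lambda)^{\otimes_s n}$, where $L^2_\perp(\Lambda)$ is the orthogonal complement of the constants in $L^2(\Lambda)$. Let $a_p^*,a_p$ ($p\in\Lambda_+^*$) be the creation and annihilation operators of the plane waves $e^{ip\cdot x}$, and $$\mathcal N_+=\sum_{p\in\Lambda^*_+}a_p^*a_p,\qquad b_p=\sqrt{\tfrac{N-\mathcal N_+}{N}}\,a_p,\qquad b_p^*=a_p^*\sqrt{\tfrac{N-\mathcal N_+}{N}},$$ $$\mathcal K=\sum_{p\in\Lambda^*_+}p^2a_p^*a_p,\qquad \mathcal V_N=\frac12\sum_{\substack{p,q\in\Lambda^*_+,\ r\in\Lambda^*\\ r\ne -p,-q}}\widehat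 V(r/e^N)\,a^*_{p+r}a^*_qa_{q+r}a_p,\qquad \mathcal H_N=\mathcal K+\mathcal V_N .$$ For $\alpha>0$ put $\ell=N^{-\alpha}$, let $\lambda_\ell$ be the lowest eigenvalue of $-\Delta+\frac12V$ on the disk of radius $e^N\ell$ centred at the origin with Neumann boundary conditions, and set $$\widehat\omega_N(p)=g_N\,\widehat\chi(p/N^\alpha),\qquad g_N=2N^{1-2\alpha}e^{2N}\lambda_\ell ,\qquad \widehat\chi(k)=\int_{|x|\le1}e^{-ik\cdot x}\,dx .$$ The effective operator is $$\begin{aligned}\mathcal R^{\mathrm{eff}}_{N,\alpha}=\;&\tfrac12(N-1)\,\widehat\omega_N(0)\big(1-\tfrac{\mathcal N_+}{N}\big)+\tfrac12\widehat\omega_N(0)\,\mathcal N_+\big(1-\tfrac{\mathcal N_+}{N}\big)+\widehat\omega_N(0)\sum_{p\in\Lambda^*_+}a_p^*a_p\big(1-\tfrac{\mathcal N_+}{N}\big)\\&+\tfrac12\sum_{p\in\Lambda^*_+}\widehat\omega_N(p)\big[b_p^*b_{-p}^*+b_pb_{-p}\big]+\tfrac1{\sqrt N}\sum_{\substack{r,v\in\Lambda^*_+\\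 r\ne-v}}\widehat\omega_N(r)\big[b^*_{r+v}a^*_{-r}a_v+\mathrm{h.c.}\big]+\mathcal H_N .\end{aligned}$$ All operators are understood as quadratic forms on the form domain $\{\xi\in\mathcal F_+^{\le N}:\langle\xi,\mathcal K\xi\rangle<\infty\}$, and (in)equalities between them hold in the sense of forms there. **Proposition.** For every $\alpha>2$ and $N\ge1$, all the series defining the form of $\mathcal R^{\mathrm{eff}}_{N,\alpha}$ converge absolutely on the form domain. Moreover: 1. For every $\alpha>2$ and every $c>0$ there is a constant $C>0$ such that, for all $N\in\mathbb N$ large enough, $$\mathcal R^{\mathrm{eff}}_{N,\alpha}\ \ge\ 2\pi N+\frac{\widehat\omega_N(0)}2\,\mathcal N_++\frac c{\log N}\,\mathcal H_N-C(\log N)^2\,\frac{\mathcal N_+^2}{N}-C .$$ 2. There is a constant $C>0$ such that for every $\alpha>2$ and all $N\in\mathbb N$ large enough (depending on $\alpha$) the following holds for all $M\in\mathbb N$, $M\ge1$, and all smooth $f,g:\mathbb R\to[0,1]$ with $f^2+g^2=1$. With $f_M=f(\mathcal N_+/M)$ and $g_M=g(\mathcal N_+/M)$, $$\mathcal R^{\mathrm{eff}}_{N,\alpha}=f_M\,\mathcal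 R^{\mathrm{eff}}_{N,\alpha}\,f_M+g_M\,\mathcal R^{\mathrm{eff}}_{N,\alpha}\,g_M+\Theta_M ,$$ where, if $f'$ and $g'$ are bounded, $$\pm\Theta_M\le\frac{C\log N}{M^2}\big(\|f'\|_\infty^2+\|g'\|_\infty^2\big)(\mathcal H_N+1).$$ -/

import Mathlib

open scoped ContDiff

noncomputable section

namespace BoseGas

open MeasureTheory

/-! ### Momenta -/

/-- The plane `ℝ²` with its Euclidean norm. -/
abbrev Plane : Type := EuclideanSpace ℝ (Fin 2)

/-- The integer lattice `ℤ²`; the point `k` stands for the momentum `p = 2π k ∈ Λ* = 2π ℤ²`. -/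
abbrev Lat : Type := Fin 2 → ℤ

/-- Nonzero momenta `Λ*₊ = 2π ℤ² \ {0}`. -/
abbrev Mode : Type := {k : Lat // k ≠ 0}

/-- The momentum `p = 2π k`. -/
def mom (k : Lat) : Plane := (2 * Real.pi) • WithLp.toLp 2 (fun i => (k i : ℝ))

/-- The mode `-p`. -/
def Mode.neg (p : Mode) : Mode := ⟨-p.1, neg_ne_zero.mpr p.2⟩

/-! ### The bosonic Fock space over the nonzero modes

The plane waves `x ↦ exp (i p · x)`, `p ∈ Λ*₊`, are an orthonormal basis of `L²_⊥(Λ)`, the orthogonal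
complement of the constants in `L²(Λ)`. Hence the normalised symmetric products of plane waves,
indexed by the occupation numbers `m : Mode →₀ ℕ`, are an orthonormal basis of the bosonic Fock
space over `L²_⊥(Λ)`; the `n`-particle sector is spanned by the `m` with `∑ₚ m p = n`. -/

/-- Occupation numbers. -/
abbrev Occ : Type := Mode →₀ ℕ

/-- Fock space vectors, in the occupation number basis. -/
abbrev FockSpace : Type := lp (fun _ : Occ => ℂ) 2

/-- Fock space vectors with a bounded number of particles: the common domain on which all the
operators below are defined. It is an inner product space as a subspace of `FockSpace`. -/
def finiteParticle : Submodule ℂ FockSpace where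
  carrier := {ξ | ∃ n : ℕ, ∀ m : Occ, n < m.degree → ξ m = 0}
  zero_mem' := ⟨0, fun _ _ => rfl⟩
  add_mem' := by
    rintro ξ ζ ⟨n, hn⟩ ⟨k, hk⟩
    refine ⟨max n k, fun m hm => ?_⟩
    have h1 := hn m (lt_of_le_of_lt (le_max_left _ _) hm)
    have h2 := hk m (lt_of_le_of_lt (le_max_right _ _) hm)
    simp [h1, h2]
  smul_mem' := by
    rintro c ξ ⟨n, hn⟩
    exact ⟨n, fun m hm => by simp [hn m hm]⟩

/-- Vectors with a bounded number of particles. -/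
abbrev Fock : Type := finiteParticle

/-- The truncated Fock space `F₊^{≤N}`: at most `N` particles. -/
def truncFock (N : ℕ) : Submodule ℂ Fock where
  carrier := {ξ | ∀ m : Occ, N < m.degree → (ξ : FockSpace) m = 0}
  zero_mem' := fun _ _ => rfl
  add_mem' := by
    intro ξ ζ hξ hζ m hm
    simp [hξ m hm, hζ m hm]
  smul_mem' := by
    intro c ξ hξ m hm
    simp [hξ m hm]

theorem sq_summable (ξ : FockSpace) : Summable fun m : Occ => ‖ξ m‖ ^ 2 := by
  have h := (lp.memℓp ξ).summable (by norm_num)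
  simpa using h

theorem memℓp_of_sq {u : Occ → ℂ} (h : Summable fun m => ‖u m‖ ^ 2) :
    Memℓp u 2 := by
  apply memℓp_gen
  simpa using h

theorem numFn_memℓp (φ : ℕ → ℝ) (ξ : Fock) :
    Memℓp (fun m : Occ => (φ m.degree : ℂ) * (ξ : FockSpace) m) 2 := by
  obtain ⟨n, hn⟩ := ξ.2
  apply memℓp_of_sq
  refine Summable.of_nonneg_of_le (fun m => by positivity) (fun m => ?_)
    ((sq_summable ξ.1).mul_left (∑ j ∈ Finset.range (n + 1), (φ j) ^ 2))
  by_cases hm : n < m.degree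
  · simp [hn m hm]
  · rw [norm_mul, mul_pow]
    refine mul_le_mul_of_nonneg_right ?_ (by positivity)
    have : m.degree ∈ Finset.range (n + 1) := by simp; omega
    have h := Finset.single_le_sum (f := fun j => (φ j) ^ 2) (fun j _ => sq_nonneg _) this
    simpa using h

/-- The operator `φ(𝒩₊)`, where `𝒩₊` is the number of particles operator. -/
def numFn (φ : ℕ → ℝ) : Module.End ℂ Fock where
  toFun ξ := ⟨⟨fun m => (φ m.degree : ℂ) * (ξ : FockSpace) m, numFn_memℓp φ ξ⟩, by
    obtain ⟨n, hn⟩ := ξ.2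
    exact ⟨n, fun m hm => by
      change (φ m.degree : ℂ) * (ξ : FockSpace) m = 0
      rw [hn m hm, mul_zero]⟩⟩
  map_add' ξ ζ := by
    apply Subtype.ext; apply lp.ext; funext m
    exact mul_add _ _ _
  map_smul' c ξ := by
    apply Subtype.ext; apply lp.ext; funext m
    exact mul_left_comm _ _ _

theorem annih_memℓp (p : Mode) (ξ : Fock) :
    Memℓp (fun m : Occ =>
      (Real.sqrt ((m p : ℝ) + 1) : ℂ) * (ξ : FockSpace) (m + Finsupp.single p 1)) 2 := by
  obtain ⟨n, hn⟩ := ξ.2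
  apply memℓp_of_sq
  have hinj : Function.Injective fun m : Occ => m + Finsupp.single p 1 := add_left_injective _
  refine Summable.of_nonneg_of_le (fun m => by positivity) (fun m => ?_)
    (((sq_summable ξ.1).comp_injective hinj).mul_left (n : ℝ))
  by_cases hm : n < (m + Finsupp.single p 1).degree
  · simp [hn _ hm]
  · rw [norm_mul, mul_pow]
    refine mul_le_mul_of_nonneg_right ?_ (by positivity)
    have h1 : (m + Finsupp.single p 1 : Occ) p ≤ (m + Finsupp.single p 1 : Occ).degree :=
      Finsupp.le_degree _ _
    have h2 : m p + 1 ≤ n := by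
      rw [Finsupp.add_apply, Finsupp.single_eq_same] at h1
      omega
    rw [Complex.norm_real, Real.norm_eq_abs, sq_abs, Real.sq_sqrt (by positivity)]
    exact_mod_cast h2

/-- The annihilation operator `aₚ`:  `aₚ |m⟩ = √(m p) |m - δₚ⟩`. -/
def annih (p : Mode) : Module.End ℂ Fock where
  toFun ξ := ⟨⟨fun m => (Real.sqrt ((m p : ℝ) + 1) : ℂ) *
      (ξ : FockSpace) (m + Finsupp.single p 1), annih_memℓp p ξ⟩, by
    obtain ⟨n, hn⟩ := ξ.2
    refine ⟨n, fun m hm => ?_⟩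
    change (Real.sqrt ((m p : ℝ) + 1) : ℂ) * (ξ : FockSpace) (m + Finsupp.single p 1) = 0
    rw [hn _ (by rw [map_add]; omega), mul_zero]⟩
  map_add' ξ ζ := by
    apply Subtype.ext; apply lp.ext; funext m
    exact mul_add _ _ _
  map_smul' c ξ := by
    apply Subtype.ext; apply lp.ext; funext m
    exact mul_left_comm _ _ _

theorem create_memℓp (p : Mode) (ξ : Fock) :
    Memℓp (fun m : Occ =>
      (Real.sqrt (m p : ℝ) : ℂ) * (ξ : FockSpace) (m - Finsupp.single p 1)) 2 := by
  obtain ⟨n, hn⟩ := ξ.2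
  apply memℓp_of_sq
  have hinj : Function.Injective fun m : Occ => m + Finsupp.single p 1 := add_left_injective _
  rw [← hinj.summable_iff]
  · refine Summable.of_nonneg_of_le (fun m => by exact sq_nonneg _) (fun m => ?_)
      ((sq_summable ξ.1).mul_left ((n : ℝ) + 1))
    simp only [Function.comp_apply, add_tsub_cancel_right]
    by_cases hm : n < m.degree
    · simp [hn _ hm]
    · rw [norm_mul, mul_pow]
      refine mul_le_mul_of_nonneg_right ?_ (by positivity)
      have h1 : m p ≤ m.degree := Finsupp.le_degree _ _
      rw [Complex.norm_real, Real.norm_eq_abs, sq_abs, Real.sq_sqrt (by positivity)]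
      simp only [Finsupp.add_apply, Finsupp.single_eq_same]
      have h2 : m p + 1 ≤ n + 1 := by omega
      exact_mod_cast h2
  · intro m hm
    have h0 : m p = 0 := by
      by_contra h
      apply hm
      refine ⟨m - Finsupp.single p 1, ?_⟩
      apply tsub_add_cancel_of_le
      rw [Finsupp.single_le_iff]
      omega
    simp [h0]

/-- The creation operator `aₚ*`:  `aₚ* |m⟩ = √(m p + 1) |m + δₚ⟩`. -/
def create (p : Mode) : Module.End ℂ Fock where
  toFun ξ := ⟨⟨fun m => (Real.sqrt (m p : ℝ) : ℂ) *
      (ξ : FockSpace) (m - Finsupp.single p 1), create_memℓp p ξ⟩, by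
    obtain ⟨n, hn⟩ := ξ.2
    refine ⟨n + 1, fun m hm => ?_⟩
    change (Real.sqrt (m p : ℝ) : ℂ) * (ξ : FockSpace) (m - Finsupp.single p 1) = 0
    have h1 : m.degree ≤ (m - Finsupp.single p 1).degree + 1 := by
      have h2 : m ≤ (m - Finsupp.single p 1) + Finsupp.single p 1 := le_tsub_add
      have h3 := Finsupp.degree_mono h2
      rw [map_add, Finsupp.degree_single] at h3
      exact h3
    rw [hn _ (by omega), mul_zero]⟩
  map_add' ξ ζ := by
    apply Subtype.ext; apply lp.ext; funext m
    exact mul_add _ _ _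
  map_smul' c ξ := by
    apply Subtype.ext; apply lp.ext; funext m
    exact mul_left_comm _ _ _

/-- The number of particles operator `𝒩₊`. -/
def numOp : Module.End ℂ Fock := numFn fun n => (n : ℝ)

/-- The operator `1 - 𝒩₊ / N`. -/
def depletion (N : ℕ) : Module.End ℂ Fock := numFn fun n => 1 - (n : ℝ) / N

/-- The operator `√((N - 𝒩₊) / N)`. -/
def sqrtDepletion (N : ℕ) : Module.End ℂ Fock := numFn fun n => Real.sqrt (((N : ℝ) - n) / N)

/-- The generalised annihilation operator `bₚ = √((N - 𝒩₊) / N) aₚ`. -/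
def bAnnih (N : ℕ) (p : Mode) : Module.End ℂ Fock := sqrtDepletion N * annih p

/-- The generalised creation operator `bₚ* = aₚ* √((N - 𝒩₊) / N)`. -/
def bCreate (N : ℕ) (p : Mode) : Module.End ℂ Fock := create p * sqrtDepletion N

/-- The expectation `⟨ξ, T ξ⟩`; the real part is taken only to have a real number, as all the
quadratic forms below are symmetric. -/
def expect (T : Module.End ℂ Fock) (ξ : Fock) : ℝ := (inner ℂ ξ (T ξ)).re

/-! ### The interaction and the renormalised potential -/

/-- The Fourier transform `F̂(k) = ∫ F(x) exp (-i k · x) dx`. It is used for even functions only, for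
which it is real. -/
def fourier (F : Plane → ℝ) (k : Plane) : ℝ :=
  (∫ x : Plane, (F x : ℂ) * Complex.exp (-(Complex.I * ((inner ℝ k x : ℝ) : ℂ)))).re

/-- The energy form of the operator `-Δ + V/2` on the disk of radius `R`, with Neumann boundary
conditions. -/
def neumannEnergy (V : Plane → ℝ) (R : ℝ) (φ : Plane → ℝ) : ℝ :=
  ∫ x in Metric.ball (0 : Plane) R, (‖fderiv ℝ φ x‖ ^ 2 + V x / 2 * φ x ^ 2)

/-- The lowest eigenvalue of `-Δ + V/2` on the disk of radius `R`, with Neumann boundary conditions,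
given by the variational principle: the infimum of the energy over the functions which are
continuously differentiable up to the boundary (a dense subspace of `H¹`, with no condition imposed
at the boundary) and normalised in `L²` of the disk. -/
def neumannEigenvalue (V : Plane → ℝ) (R : ℝ) : ℝ :=
  sInf {E : ℝ | ∃ φ : Plane → ℝ, ContDiff ℝ 1 φ ∧
    (∫ x in Metric.ball (0 : Plane) R, φ x ^ 2) = 1 ∧ E = neumannEnergy V R φ}

/-- `g_N = 2 N^{1 - 2α} e^{2N} λ_ℓ`, where `ℓ = N^{-α}` and `λ_ℓ` is the lowest Neumann eigenvalue on
the disk of radius `e^N ℓ`. -/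
def gN (V : Plane → ℝ) (α : ℝ) (N : ℕ) : ℝ :=
  2 * (N : ℝ) ^ (1 - 2 * α) * Real.exp (2 * N) *
    neumannEigenvalue V (Real.exp N * (N : ℝ) ^ (-α))

/-- `ω̂_N(p) = g_N χ̂(p / N^α)`, with `χ` the characteristic function of the unit disk. -/
def omegaHat (V : Plane → ℝ) (α : ℝ) (N : ℕ) (k : Lat) : ℝ :=
  gN V α N * fourier ((Metric.closedBall (0 : Plane) 1).indicator fun _ => 1)
    (((N : ℝ) ^ α)⁻¹ • mom k)

/-! ### The quadratic forms -/

/-- Summands of `𝒦 = ∑ p² aₚ* aₚ`. -/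
def kinTerm (ξ : Fock) (p : Mode) : ℝ := ‖mom p.1‖ ^ 2 * expect (create p * annih p) ξ

/-- The kinetic energy `𝒦`. -/
def kinForm (ξ : Fock) : ℝ := ∑' p : Mode, kinTerm ξ p

/-- Indices `p, q ∈ Λ*₊`, `r ∈ Λ*` with `r ≠ -p, -q`. -/
abbrev QuarticIdx : Type :=
  {x : Mode × Mode × Lat // x.1.1 + x.2.2 ≠ 0 ∧ x.2.1.1 + x.2.2 ≠ 0}

/-- Summands `V̂(r/e^N) a*_{p+r} a*_q a_{q+r} a_p` of `2 𝒱_N`. -/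
def potTerm (V : Plane → ℝ) (N : ℕ) (ξ : Fock) (x : QuarticIdx) : ℝ :=
  let p : Mode := x.1.1
  let q : Mode := x.1.2.1
  let r : Lat := x.1.2.2
  fourier V ((Real.exp N)⁻¹ • mom r) *
    expect (create ⟨p.1 + r, x.2.1⟩ * create q * annih ⟨q.1 + r, x.2.2⟩ * annih p) ξ

/-- The potential energy `𝒱_N`. -/
def potForm (V : Plane → ℝ) (N : ℕ) (ξ : Fock) : ℝ :=
  1 / 2 * ∑' x : QuarticIdx, potTerm V N ξ x

/-- `ℋ_N = 𝒦 + 𝒱_N`. -/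
def energyForm (V : Plane → ℝ) (N : ℕ) (ξ : Fock) : ℝ := kinForm ξ + potForm V N ξ

/-- Summands of `∑ aₚ* aₚ (1 - 𝒩₊/N)`. -/
def diagTerm (N : ℕ) (ξ : Fock) (p : Mode) : ℝ :=
  expect (create p * annih p * depletion N) ξ

/-- Summands of `∑ ω̂_N(p) [bₚ* b₋ₚ* + bₚ b₋ₚ]`. -/
def pairTerm (V : Plane → ℝ) (α : ℝ) (N : ℕ) (ξ : Fock) (p : Mode) : ℝ :=
  omegaHat V α N p.1 *
    expect (bCreate N p * bCreate N p.neg + bAnnih N p * bAnnih N p.neg) ξ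

/-- Indices `r, v ∈ Λ*₊` with `r ≠ -v`. -/
abbrev CubicIdx : Type := {x : Mode × Mode // x.1.1 + x.2.1 ≠ 0}

/-- Summands of `∑ ω̂_N(r) [b*_{r+v} a*_{-r} a_v + h.c.]`. -/
def cubicTerm (V : Plane → ℝ) (α : ℝ) (N : ℕ) (ξ : Fock) (x : CubicIdx) : ℝ :=
  let r : Mode := x.1.1
  let v : Mode := x.1.2
  let s : Mode := ⟨r.1 + v.1, x.2⟩
  omegaHat V α N r.1 *
    expect (bCreate N s * create r.neg * annih v + create v * annih r.neg * bAnnih N s) ξ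

/-- The quadratic form of the effective excitation operator `R^{eff}_{N,α}`. -/
def effForm (V : Plane → ℝ) (α : ℝ) (N : ℕ) (ξ : Fock) : ℝ :=
  1 / 2 * ((N : ℝ) - 1) * omegaHat V α N 0 * expect (depletion N) ξ
    + 1 / 2 * omegaHat V α N 0 * expect (numOp * depletion N) ξ
    + omegaHat V α N 0 * ∑' p : Mode, diagTerm N ξ p
    + 1 / 2 * ∑' p : Mode, pairTerm V α N ξ p
    + 1 / Real.sqrt N * ∑' x : CubicIdx, cubicTerm V α N ξ x
    + energyForm V N ξ

/-- The form domain of `𝒦` in `F₊^{≤N}`: the vectors of finite kinetic energy. -/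
def formDomain (N : ℕ) : Set Fock := {ξ | ξ ∈ truncFock N ∧ Summable (kinTerm ξ)}

/-- All the series which enter `effForm` converge absolutely. -/
def FormConverges (V : Plane → ℝ) (α : ℝ) (N : ℕ) (ξ : Fock) : Prop :=
  Summable (kinTerm ξ) ∧ Summable (potTerm V N ξ) ∧ Summable (diagTerm N ξ) ∧
    Summable (pairTerm V α N ξ) ∧ Summable (cubicTerm V α N ξ)

/-- The localisation operator `f(𝒩₊ / M)`. -/
def localize (f : ℝ → ℝ) (M : ℕ) : Module.End ℂ Fock := numFn fun n => f ((n : ℝ) / M)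

end BoseGas

end

open scoped ContDiff

noncomputable section

namespace BoseGas

open MeasureTheory

/-! ### Operators on Fock space in coordinates -/

/-! Write g for g_N and L for log N, so that ω̂_N(0) = πg. The lower bound rests on an exact
cancellation of two terms of order αL. The scalar part of the form is ½πgN up to O(1). The pairing
term, after completing the square against the kinetic energy, costs at most about ¼ Σ ω̂_N(p)²/p².
Both need a sharp leading constant.

For the scalar part, g = 2N R²λ with R = e^N N^(-α), and `exists_neumannEnergy_ge` gives λ ≥ 2/(R²(B
+ log R)). Hence g ≥ 4N/(N - αL + B), which makes ½πgN at least 2πN + 2παL - O(1). The eigenvalue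
bound is a Hardy inequality along rays with the supersolution B + log r - r²/(2R²). Its boundary
term at small radius is absorbed by V after averaging over angles, which is where radial symmetry
enters. For the pairing cost, `diskHat_sum` bounds ¼ Σ ω̂_N(p)²/p² by (g²/16)(2παL + 30), about 2παL
when g = 4. No matching upper bound on g is needed: scalar part minus pairing cost increases with g
as long as g ≤ 20, which a logarithmic trial function ensures (`leading_energy_ge`).

The pairing term also costs a multiple of 𝒩₊. The scalar and diagonal terms supply πg 𝒩₊ up to
𝒩₊²/N, and since |p| ≥ 2π and g stays below 8π the pairing uses at most half of that. The cubic term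
is controlled by Cauchy-Schwarz (`cubic_bound`) and costs 𝒦/L and a multiple of L²𝒩₊²/N. Keeping
back the fraction (c+1)/L of 𝒦 changes the pairing cost by O(1) only and pays for both 𝒦/L and c𝒦/L.
The potential energy is non-negative because V is (`potForm_nonneg`), so all but c/L of it can be
discarded.

For the localisation, every term that conserves the particle number splits exactly because f² + g² =
1. The pair and cubic terms change the number by two and by one, and leave the coefficient 1 -
f(x)f(y) - g(x)g(y) = ½((f(x)-f(y))² + (g(x)-g(y))²), which is O(M⁻²). The same Cauchy-Schwarz
bounds finish; the error constant is free of α because Σ ω̂_N(p)²/p² = O(αL) is eventually below L².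
-/

theorem numFn_apply (φ : ℕ → ℝ) (ξ : Fock) (m : Occ) :
    (numFn φ ξ : FockSpace) m = (φ m.degree : ℂ) * (ξ : FockSpace) m := rfl

theorem annih_apply (p : Mode) (ξ : Fock) (m : Occ) :
    (annih p ξ : FockSpace) m =
      (Real.sqrt ((m p : ℝ) + 1) : ℂ) * (ξ : FockSpace) (m + Finsupp.single p 1) := rfl

theorem create_apply (p : Mode) (ξ : Fock) (m : Occ) :
    (create p ξ : FockSpace) m =
      (Real.sqrt (m p : ℝ) : ℂ) * (ξ : FockSpace) (m - Finsupp.single p 1) := rfl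

theorem Fock.ext {ξ ζ : Fock} (h : ∀ m, (ξ : FockSpace) m = (ζ : FockSpace) m) : ξ = ζ :=
  Subtype.ext (lp.ext (funext h))

theorem hasSum_inner (ξ ζ : Fock) :
    HasSum (fun m => inner ℂ ((ξ : FockSpace) m) ((ζ : FockSpace) m)) (inner ℂ ξ ζ) :=
  lp.hasSum_inner (𝕜 := ℂ) ξ.1 ζ.1

theorem hasSum_norm_sq (ξ : Fock) :
    HasSum (fun m => ‖(ξ : FockSpace) m‖ ^ 2) (‖ξ‖ ^ 2) := by
  have h := Complex.hasSum_re (hasSum_inner ξ ξ)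
  have h2 : (inner ℂ ξ ξ : ℂ).re = ‖ξ‖ ^ 2 := inner_self_eq_norm_sq (𝕜 := ℂ) ξ
  rw [h2] at h
  refine h.congr_fun ?_
  intro m
  exact (inner_self_eq_norm_sq (𝕜 := ℂ) ((ξ : FockSpace) m)).symm

theorem add_single_injective (p : Mode) :
    Function.Injective fun m : Occ => m + Finsupp.single p 1 := add_left_injective _

theorem eq_zero_of_notMem_range_add_single {p : Mode} {m : Occ}
    (hm : m ∉ Set.range fun m : Occ => m + Finsupp.single p 1) : m p = 0 := by
  by_contra h
  apply hm
  refine ⟨m - Finsupp.single p 1, ?_⟩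
  apply tsub_add_cancel_of_le
  rw [Finsupp.single_le_iff]
  omega

/-- Summation over occupation numbers with at least one particle in the mode `p`. -/
theorem hasSum_add_single_iff {β : Type*} [AddCommMonoid β] [TopologicalSpace β] (p : Mode)
    {f : Occ → β} (hf : ∀ m : Occ, m p = 0 → f m = 0) {a : β} :
    HasSum (fun m : Occ => f (m + Finsupp.single p 1)) a ↔ HasSum f a :=
  (add_single_injective p).hasSum_iff
    (fun m hm => hf m (eq_zero_of_notMem_range_add_single hm))

theorem inner_create (p : Mode) (ξ ζ : Fock) :
    inner ℂ ξ (create p ζ) = inner ℂ (annih p ξ) ζ := by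
  have h := hasSum_inner ξ (create p ζ)
  rw [← hasSum_add_single_iff p] at h
  · refine h.unique ?_
    refine (hasSum_inner (annih p ξ) ζ).congr_fun ?_
    intro m
    simp only [create_apply, annih_apply, add_tsub_cancel_right, Finsupp.add_apply,
      Finsupp.single_eq_same, RCLike.inner_apply, map_mul, Complex.conj_ofReal]
    push_cast
    ring
  · intro m hm
    simp [create_apply, hm]

theorem inner_numFn (φ : ℕ → ℝ) (ξ ζ : Fock) :
    inner ℂ ξ (numFn φ ζ) = inner ℂ (numFn φ ξ) ζ := by
  refine (hasSum_inner ξ (numFn φ ζ)).unique ?_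
  refine (hasSum_inner (numFn φ ξ) ζ).congr_fun ?_
  intro m
  simp only [numFn_apply, RCLike.inner_apply, map_mul, Complex.conj_ofReal]
  ring

/-- The pull-through rule: a function of 𝒩₊ to the right of an annihilator is evaluated one particle
higher. All index shifts below come from it. -/
theorem annih_numFn (p : Mode) (φ : ℕ → ℝ) (ξ : Fock) :
    annih p (numFn φ ξ) = numFn (fun n => φ (n + 1)) (annih p ξ) := by
  refine Fock.ext fun m => ?_
  simp only [numFn_apply, annih_apply, map_add, Finsupp.degree_single]
  ring

theorem numFn_numFn (φ ψ : ℕ → ℝ) (ξ : Fock) :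
    numFn φ (numFn ψ ξ) = numFn (fun n => φ n * ψ n) ξ := by
  refine Fock.ext fun m => ?_
  simp only [numFn_apply]
  push_cast
  ring

theorem numFn_one (ξ : Fock) : numFn (fun _ => 1) ξ = ξ := by
  refine Fock.ext fun m => ?_
  simp [numFn_apply]

theorem annih_comm (p q : Mode) (ξ : Fock) : annih p (annih q ξ) = annih q (annih p ξ) := by
  rcases eq_or_ne p q with rfl | h
  · rfl
  refine Fock.ext fun m => ?_
  simp only [annih_apply, Finsupp.add_apply, Finsupp.single_eq_of_ne h,
    Finsupp.single_eq_of_ne h.symm, add_zero]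
  rw [add_right_comm]
  ring

/-- The numFn operators only see the occupied sectors. -/
theorem numFn_mem_truncFock {N : ℕ} {ξ : Fock} (φ : ℕ → ℝ) (hξ : ξ ∈ truncFock N) :
    numFn φ ξ ∈ truncFock N := by
  intro m hm
  rw [numFn_apply, hξ m hm, mul_zero]

theorem hasSum_expect_numFn (φ : ℕ → ℝ) (ξ : Fock) :
    HasSum (fun m : Occ => φ m.degree * ‖(ξ : FockSpace) m‖ ^ 2) (expect (numFn φ) ξ) := by
  have h := Complex.hasSum_re (hasSum_inner ξ (numFn φ ξ))
  refine h.congr_fun ?_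
  intro m
  simp only [numFn_apply, RCLike.inner_apply, mul_assoc]
  rw [Complex.re_ofReal_mul, Complex.mul_conj, Complex.ofReal_re, Complex.normSq_eq_norm_sq]

theorem norm_numFn_sq (φ : ℕ → ℝ) (ξ : Fock) :
    ‖numFn φ ξ‖ ^ 2 = expect (numFn fun n => φ n ^ 2) ξ := by
  refine (hasSum_norm_sq _).unique ?_
  refine (hasSum_expect_numFn (fun n => φ n ^ 2) ξ).congr_fun ?_
  intro m
  rw [numFn_apply, norm_mul, mul_pow, Complex.norm_real, Real.norm_eq_abs, sq_abs]

theorem expect_numFn_le {N : ℕ} {φ ψ : ℕ → ℝ} {ξ : Fock} (hξ : ξ ∈ truncFock N)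
    (h : ∀ n ≤ N, φ n ≤ ψ n) : expect (numFn φ) ξ ≤ expect (numFn ψ) ξ := by
  refine hasSum_le (fun m => ?_) (hasSum_expect_numFn φ ξ) (hasSum_expect_numFn ψ ξ)
  rcases le_or_gt m.degree N with hm | hm
  · gcongr
    exact h _ hm
  · simp [hξ m hm]

theorem exists_mem_truncFock (ξ : Fock) : ∃ N, ξ ∈ truncFock N := ξ.2

theorem expect_numFn_mono {φ ψ : ℕ → ℝ} (ξ : Fock)
    (h : ∀ n, φ n ≤ ψ n) : expect (numFn φ) ξ ≤ expect (numFn ψ) ξ := by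
  obtain ⟨N, hN⟩ := exists_mem_truncFock ξ
  exact expect_numFn_le hN fun n _ => h n

theorem expect_numFn_add (φ ψ : ℕ → ℝ) (ξ : Fock) :
    expect (numFn fun n => φ n + ψ n) ξ = expect (numFn φ) ξ + expect (numFn ψ) ξ := by
  refine (hasSum_expect_numFn _ ξ).unique ?_
  refine ((hasSum_expect_numFn φ ξ).add (hasSum_expect_numFn ψ ξ)).congr_fun ?_
  intro m
  ring

theorem expect_numFn_const_mul (c : ℝ) (φ : ℕ → ℝ) (ξ : Fock) :
    expect (numFn fun n => c * φ n) ξ = c * expect (numFn φ) ξ := by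
  refine (hasSum_expect_numFn _ ξ).unique ?_
  refine ((hasSum_expect_numFn φ ξ).mul_left c).congr_fun ?_
  intro m
  ring

theorem expect_numFn_one (ξ : Fock) : expect (numFn fun _ => 1) ξ = ‖ξ‖ ^ 2 := by
  have h := norm_numFn_sq (fun _ => 1) ξ
  simp only [numFn_one, one_pow] at h
  exact h.symm

theorem expect_numFn_nonneg {φ : ℕ → ℝ} (ξ : Fock) (h : ∀ n, 0 ≤ φ n) :
    0 ≤ expect (numFn φ) ξ :=
  (hasSum_expect_numFn φ ξ).nonneg fun m => mul_nonneg (h _) (by positivity)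

theorem norm_annih_sq_hasSum (p : Mode) (ξ : Fock) :
    HasSum (fun m : Occ => (m p : ℝ) * ‖(ξ : FockSpace) m‖ ^ 2) (‖annih p ξ‖ ^ 2) := by
  rw [← hasSum_add_single_iff p]
  · refine (hasSum_norm_sq _).congr_fun ?_
    intro m
    rw [annih_apply, norm_mul, mul_pow, Complex.norm_real, Real.norm_eq_abs, sq_abs,
      Real.sq_sqrt (by positivity)]
    simp
  · intro m hm
    simp [hm]

theorem norm_create_sq (p : Mode) (ξ : Fock) :
    ‖create p ξ‖ ^ 2 = ‖annih p ξ‖ ^ 2 + ‖ξ‖ ^ 2 := by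
  have h := hasSum_norm_sq (create p ξ)
  rw [← hasSum_add_single_iff p] at h
  · refine h.unique ?_
    refine ((norm_annih_sq_hasSum p ξ).add (hasSum_norm_sq ξ)).congr_fun ?_
    intro m
    rw [create_apply, norm_mul, mul_pow, Complex.norm_real, Real.norm_eq_abs, sq_abs,
      Real.sq_sqrt (by positivity)]
    simp
    ring
  · intro m hm
    simp [create_apply, hm]

/-- Summation over all modes of an annihilation-creation pair with a function of `𝒩₊` inside. -/
theorem hasSum_expect_annih (φ : ℕ → ℝ) (ξ : Fock) :
    HasSum (fun p => expect (numFn φ) (annih p ξ)) (expect (numFn fun n => n * φ (n - 1)) ξ) := by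
  -- The truncated subtraction is harmless: at degree 0 the factor `m p` vanishes.
  have key : ∀ p, HasSum (fun m : Occ => (m p : ℝ) * (φ (m.degree - 1) * ‖(ξ : FockSpace) m‖ ^ 2))
      (expect (numFn φ) (annih p ξ)) := by
    intro p
    rw [← hasSum_add_single_iff p]
    · refine (hasSum_expect_numFn φ _).congr_fun ?_
      intro m
      rw [annih_apply, norm_mul, mul_pow, Complex.norm_real, Real.norm_eq_abs, sq_abs,
        Real.sq_sqrt (by positivity)]
      simp
      ring
    · intro m hm
      simp [hm]
  have hdeg : ∀ m : Occ, HasSum (fun p => (m p : ℝ)) (m.degree : ℝ) := by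
    intro m
    have : (m.degree : ℝ) = ∑ p ∈ m.support, (m p : ℝ) := by
      rw [Finsupp.degree_apply]; push_cast; rfl
    rw [this]
    refine hasSum_sum_of_ne_finset_zero fun p hp => ?_
    rw [Finsupp.notMem_support_iff.mp hp]; simp
  have hsum : ∀ m : Occ, HasSum (fun p => (m p : ℝ) * (φ (m.degree - 1) *
      ‖(ξ : FockSpace) m‖ ^ 2)) ((m.degree : ℝ) * φ (m.degree - 1) * ‖(ξ : FockSpace) m‖ ^ 2) := by
    intro m
    have := (hdeg m).mul_right (φ (m.degree - 1) * ‖(ξ : FockSpace) m‖ ^ 2)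
    rwa [← mul_assoc] at this
  -- The sums over modes and occupation numbers are to be exchanged, and φ has no sign, so absolute
  -- summability on the product is needed. It follows from Σₚ m p = degree m.
  have hS : Summable fun x : Occ × Mode => (x.1 x.2 : ℝ) * (φ (x.1.degree - 1) *
      ‖(ξ : FockSpace) x.1‖ ^ 2) := by
    rw [← summable_norm_iff, summable_prod_of_nonneg (fun _ => norm_nonneg _)]
    refine ⟨fun m => (hsum m).summable.norm, ?_⟩
    have h2 : ∀ m : Occ, ∑' p, ‖(m p : ℝ) * (φ (m.degree - 1) * ‖(ξ : FockSpace) m‖ ^ 2)‖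
        = ‖(m.degree : ℝ) * φ (m.degree - 1) * ‖(ξ : FockSpace) m‖ ^ 2‖ := by
      intro m
      simp only [norm_mul, norm_pow, norm_norm]
      have := (hdeg m).mul_right (‖φ (m.degree - 1)‖ * ‖(ξ : FockSpace) m‖ ^ 2)
      simp only [RCLike.norm_natCast]
      rw [this.tsum_eq]
      ring
    simp only [h2]
    exact (hasSum_expect_numFn (fun n => n * φ (n - 1)) ξ).summable.norm
  have h1 := hS.hasSum.prod_fiberwise (fun m => hsum m)
  have h2 := h1.unique (hasSum_expect_numFn (fun n => n * φ (n - 1)) ξ)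
  rw [← h2]
  have hS' := (Equiv.prodComm Mode Occ).summable_iff.mpr hS
  have e := (Equiv.prodComm Mode Occ).tsum_eq (fun x : Occ × Mode => (x.1 x.2 : ℝ) *
    (φ (x.1.degree - 1) * ‖(ξ : FockSpace) x.1‖ ^ 2))
  rw [← e]
  exact hS'.hasSum.prod_fiberwise (fun p => key p)

theorem hasSum_norm_numFn_annih (φ : ℕ → ℝ) (ξ : Fock) :
    HasSum (fun p => ‖numFn φ (annih p ξ)‖ ^ 2)
      (expect (numFn fun n => n * φ (n - 1) ^ 2) ξ) := by
  simp only [norm_numFn_sq]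
  exact hasSum_expect_annih _ ξ

theorem expect_create_annih (p : Mode) (ξ : Fock) :
    expect (create p * annih p) ξ = ‖annih p ξ‖ ^ 2 := by
  rw [expect, Module.End.mul_apply, inner_create]
  exact inner_self_eq_norm_sq (𝕜 := ℂ) (annih p ξ)

theorem annih_mem_truncFock {N : ℕ} (p : Mode) {ξ : Fock} (hξ : ξ ∈ truncFock N) :
    annih p ξ ∈ truncFock N := by
  intro m hm
  rw [annih_apply, hξ _ (by rw [map_add]; omega), mul_zero]

/-! ### Momenta and the kinetic energy -/

theorem norm_mom_sq (k : Lat) :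
    ‖mom k‖ ^ 2 = 4 * Real.pi ^ 2 * ((k 0 : ℝ) ^ 2 + (k 1 : ℝ) ^ 2) := by
  rw [mom, norm_smul, mul_pow, EuclideanSpace.norm_sq_eq]
  simp only [Fin.sum_univ_two, Real.norm_eq_abs, sq_abs]
  ring

theorem norm_mom_neg (k : Lat) : ‖mom (-k)‖ = ‖mom k‖ := by
  have h := norm_mom_sq (-k)
  rw [← sq_eq_sq₀ (norm_nonneg _) (norm_nonneg _), norm_mom_sq, norm_mom_sq]
  simp

theorem four_pi_sq_le_norm_mom_sq (p : Mode) : 4 * Real.pi ^ 2 ≤ ‖mom p.1‖ ^ 2 := by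
  rw [norm_mom_sq]
  have h : (1 : ℤ) ≤ (p.1 0) ^ 2 + (p.1 1) ^ 2 := by
    by_contra hlt
    have h0 : p.1 0 ^ 2 = 0 := by nlinarith [sq_nonneg (p.1 0), sq_nonneg (p.1 1)]
    have h1 : p.1 1 ^ 2 = 0 := by nlinarith [sq_nonneg (p.1 0), sq_nonneg (p.1 1)]
    apply p.2
    funext i
    fin_cases i
    · simpa using h0
    · simpa using h1
  have h' : (1 : ℝ) ≤ (p.1 0 : ℝ) ^ 2 + (p.1 1 : ℝ) ^ 2 := by exact_mod_cast h
  nlinarith [Real.pi_pos, sq_nonneg Real.pi]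

theorem norm_mom_pos (p : Mode) : 0 < ‖mom p.1‖ := by
  have h := four_pi_sq_le_norm_mom_sq p
  have : 0 < ‖mom p.1‖ ^ 2 := lt_of_lt_of_le (by positivity) h
  exact lt_of_le_of_ne (norm_nonneg _) fun h0 => by simp [← h0] at this

theorem Mode.neg_neg (p : Mode) : p.neg.neg = p := Subtype.ext (_root_.neg_neg p.1)

/-- The involution `p ↦ -p`. -/
def Mode.negEquiv : Mode ≃ Mode := ⟨Mode.neg, Mode.neg, Mode.neg_neg, Mode.neg_neg⟩

theorem kinTerm_eq (ξ : Fock) (p : Mode) :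
    kinTerm ξ p = ‖mom p.1‖ ^ 2 * ‖annih p ξ‖ ^ 2 := by
  rw [kinTerm, expect_create_annih]

theorem kinTerm_nonneg (ξ : Fock) (p : Mode) : 0 ≤ kinTerm ξ p := by
  rw [kinTerm_eq]; positivity

theorem kinForm_nonneg (ξ : Fock) : 0 ≤ kinForm ξ := tsum_nonneg (kinTerm_nonneg ξ)

theorem hasSum_norm_annih (ξ : Fock) :
    HasSum (fun p => ‖annih p ξ‖ ^ 2) (expect numOp ξ) := by
  have h := hasSum_norm_numFn_annih (fun _ => 1) ξ
  simp only [numFn_one, one_pow, mul_one] at h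
  exact h

theorem four_pi_sq_mul_expect_numOp_le {ξ : Fock} (hξ : Summable (kinTerm ξ)) :
    4 * Real.pi ^ 2 * expect numOp ξ ≤ kinForm ξ := by
  refine hasSum_le (fun p => ?_) ((hasSum_norm_annih ξ).mul_left (4 * Real.pi ^ 2)) hξ.hasSum
  rw [kinTerm_eq]
  exact mul_le_mul_of_nonneg_right (four_pi_sq_le_norm_mom_sq p) (by positivity)

theorem expect_numOp_nonneg (ξ : Fock) : 0 ≤ expect numOp ξ :=
  expect_numFn_nonneg ξ fun n => Nat.cast_nonneg n

/-! ### Cauchy-Schwarz for series -/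

theorem summable_and_abs_tsum_le_sqrt {ι : Type*} {x f g : ι → ℝ} {F G : ℝ}
    (hx : ∀ i, |x i| ≤ f i * g i)
    (hf : Summable fun i => f i ^ 2) (hg : Summable fun i => g i ^ 2)
    (hF : ∑' i, f i ^ 2 ≤ F) (hG : ∑' i, g i ^ 2 ≤ G) :
    Summable x ∧ |∑' i, x i| ≤ Real.sqrt (F * G) := by
  have hs : Summable fun i => |x i| := by
    refine Summable.of_nonneg_of_le (fun i => abs_nonneg _) (fun i => ?_) (hf.add hg)
    nlinarith [hx i, sq_nonneg (f i - g i), sq_nonneg (f i), sq_nonneg (g i)]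
  refine ⟨hs.of_abs, ?_⟩
  have h1 : |∑' i, x i| ≤ ∑' i, |x i| := by
    have := norm_tsum_le_tsum_norm (f := x) (by simpa using hs)
    simpa using this
  refine h1.trans ?_
  refine hs.tsum_le_of_sum_le fun s => ?_
  refine Real.le_sqrt_of_sq_le ?_
  calc (∑ i ∈ s, |x i|) ^ 2 ≤ (∑ i ∈ s, f i * g i) ^ 2 := by
        gcongr with i _
        exact hx i
    _ ≤ (∑ i ∈ s, f i ^ 2) * ∑ i ∈ s, g i ^ 2 := Finset.sum_mul_sq_le_sq_mul_sq s f g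
    _ ≤ F * G := by
        have hf' := (hf.sum_le_tsum s fun i _ => sq_nonneg _).trans hF
        have hg' := (hg.sum_le_tsum s fun i _ => sq_nonneg _).trans hG
        have : 0 ≤ ∑ i ∈ s, f i ^ 2 := Finset.sum_nonneg fun i _ => sq_nonneg _
        have : 0 ≤ ∑ i ∈ s, g i ^ 2 := Finset.sum_nonneg fun i _ => sq_nonneg _
        gcongr
        linarith

/-! ### The pair form -/

/-- The form `Re ⟨ξ, φ(𝒩₊) aₚ a₋ₚ ξ⟩`. -/
def pairFn (φ : ℕ → ℝ) (ξ : Fock) (p : Mode) : ℝ :=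
  (inner ℂ ξ (numFn φ (annih p (annih p.neg ξ)))).re

/-- The left vector is seen with n particles and the right one with n + 2. The product f(n) f(n+2)
becomes the off-diagonal part of the localisation error. -/
theorem pairFn_numFn (φ f : ℕ → ℝ) (ξ : Fock) (p : Mode) :
    pairFn φ (numFn f ξ) p = pairFn (fun n => φ n * (f n * f (n + 2))) ξ p := by
  simp only [pairFn, annih_numFn, numFn_numFn]
  rw [← inner_numFn, numFn_numFn]
  congr 4
  funext n
  ring

theorem inner_numFn_add (φ ψ : ℕ → ℝ) (ξ ζ : Fock) :
    inner ℂ ξ (numFn (fun n => φ n + ψ n) ζ) = inner ℂ ξ (numFn φ ζ) + inner ℂ ξ (numFn ψ ζ) := by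
  refine Eq.trans (congrArg _ ?_) (inner_add_right (𝕜 := ℂ) ξ (numFn φ ζ) (numFn ψ ζ))
  refine Fock.ext fun m => ?_
  have : ((numFn φ ζ + numFn ψ ζ : Fock) : FockSpace) m =
    (numFn φ ζ : FockSpace) m + (numFn ψ ζ : FockSpace) m := rfl
  rw [this]
  simp only [numFn_apply]
  push_cast
  ring

theorem pairFn_add (φ ψ : ℕ → ℝ) (ξ : Fock) (p : Mode) :
    pairFn (fun n => φ n + ψ n) ξ p = pairFn φ ξ p + pairFn ψ ξ p := by
  simp only [pairFn, inner_numFn_add, Complex.add_re]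

theorem abs_re_inner_le (ξ ζ : Fock) : |(inner ℂ ξ ζ).re| ≤ ‖ξ‖ * ‖ζ‖ :=
  (Complex.abs_re_le_norm _).trans (norm_inner_le_norm ξ ζ)

theorem re_inner_comm (ξ ζ : Fock) : (inner ℂ ξ ζ).re = (inner ℂ ζ ξ).re :=
  inner_re_symm (𝕜 := ℂ) ξ ζ

theorem pairFn_eq_create (φ : ℕ → ℝ) (ξ : Fock) (p : Mode) :
    pairFn φ ξ p = (inner ℂ (create p (numFn φ ξ)) (annih p.neg ξ)).re := by
  rw [pairFn, inner_numFn, re_inner_comm, ← inner_create, re_inner_comm]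

theorem norm_annih_sq_le (p : Mode) (ξ : Fock) : ‖annih p ξ‖ ^ 2 ≤ expect numOp ξ :=
  (hasSum_norm_annih ξ).summable.le_tsum p (fun _ _ => sq_nonneg _) |>.trans
    (hasSum_norm_annih ξ).tsum_eq.le

theorem expect_numOp_numFn_le {B : ℝ} {φ : ℕ → ℝ} (hφ : ∀ n, |φ n| ≤ B) (ξ : Fock) :
    expect numOp (numFn φ ξ) ≤ B ^ 2 * expect numOp ξ := by
  have e : expect numOp (numFn φ ξ) = expect (numFn fun n => (n : ℝ) * φ n ^ 2) ξ := by
    rw [expect, numOp, ← inner_numFn, numFn_numFn, numFn_numFn]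
    rw [expect]
    congr 4
    funext n
    ring
  rw [e, numOp, ← expect_numFn_const_mul]
  refine expect_numFn_mono ξ fun n => ?_
  have h : φ n ^ 2 ≤ B ^ 2 := sq_le_sq' (abs_le.mp (hφ n)).1 (abs_le.mp (hφ n)).2
  have : (0 : ℝ) ≤ n := Nat.cast_nonneg n
  nlinarith

theorem norm_numFn_sq_le {B : ℝ} {φ : ℕ → ℝ} (hφ : ∀ n, |φ n| ≤ B) (ξ : Fock) :
    ‖numFn φ ξ‖ ^ 2 ≤ B ^ 2 * ‖ξ‖ ^ 2 := by
  rw [norm_numFn_sq, ← expect_numFn_one, ← expect_numFn_const_mul]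
  refine expect_numFn_mono ξ fun n => ?_
  have h : φ n ^ 2 ≤ B ^ 2 := sq_le_sq' (abs_le.mp (hφ n)).1 (abs_le.mp (hφ n)).2
  linarith

/-- Moving one annihilator to the left as a creator, |⟨aₚ* φ ξ, a₋ₚ ξ⟩| ≤ √D ‖a₋ₚ ξ‖ with D
independent of p. Cauchy-Schwarz with weights 1/|p| and |p| then produces Σ u²/p² and the kinetic
energy. -/
theorem pair_bound {u : Mode → ℝ} {U B : ℝ} (hu : Summable fun p => u p ^ 2 / ‖mom p.1‖ ^ 2)
    (hU : ∑' p, u p ^ 2 / ‖mom p.1‖ ^ 2 ≤ U) {φ : ℕ → ℝ} (hφ : ∀ n, |φ n| ≤ B) {ξ : Fock}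
    (hξ : Summable (kinTerm ξ)) :
    Summable (fun p => u p * pairFn φ ξ p) ∧
      |∑' p, u p * pairFn φ ξ p| ≤
        Real.sqrt ((B ^ 2 * (expect numOp ξ + ‖ξ‖ ^ 2) * U) * kinForm ξ) := by
  set D := B ^ 2 * (expect numOp ξ + ‖ξ‖ ^ 2) with hD
  have hD0 : 0 ≤ D := by
    have := expect_numOp_nonneg ξ
    positivity
  have hk : (fun p : Mode => (‖mom p.1‖ * ‖annih p.neg ξ‖) ^ 2)
      = fun p => kinTerm ξ (Mode.negEquiv p) := by
    funext p
    rw [kinTerm_eq, mul_pow]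
    have : ‖mom (Mode.negEquiv p).1‖ = ‖mom p.1‖ := norm_mom_neg p.1
    rw [this]
    rfl
  refine summable_and_abs_tsum_le_sqrt (f := fun p => Real.sqrt D * (|u p| / ‖mom p.1‖))
    (g := fun p => ‖mom p.1‖ * ‖annih p.neg ξ‖) (fun p => ?_) ?_ ?_ ?_ ?_
  · have h1 : |pairFn φ ξ p| ≤ Real.sqrt D * ‖annih p.neg ξ‖ := by
      rw [pairFn_eq_create]
      refine (abs_re_inner_le _ _).trans ?_
      gcongr
      refine Real.le_sqrt_of_sq_le ?_
      rw [norm_create_sq, hD, mul_add]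
      exact add_le_add ((norm_annih_sq_le p _).trans (expect_numOp_numFn_le hφ ξ))
        (norm_numFn_sq_le hφ ξ)
    rw [abs_mul]
    have h2 := norm_mom_pos p
    calc |u p| * |pairFn φ ξ p| ≤ |u p| * (Real.sqrt D * ‖annih p.neg ξ‖) := by gcongr
      _ = _ := by field_simp
  · simp only [mul_pow, div_pow, sq_abs]
    exact hu.mul_left _
  · rw [hk]
    exact Mode.negEquiv.summable_iff.mpr hξ
  · simp only [mul_pow, div_pow, sq_abs, Real.sq_sqrt hD0, tsum_mul_left]
    gcongr
  · rw [hk, Mode.negEquiv.tsum_eq (kinTerm ξ), kinForm]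

/-! ### The cubic form -/

/-- The form `Re ⟨φ(𝒩₊) a₋ᵣ aᵣ₊ᵥ ξ, aᵥ ξ⟩`. -/
def cubicFn (φ : ℕ → ℝ) (ξ : Fock) (x : CubicIdx) : ℝ :=
  (inner ℂ (numFn φ (annih x.1.1.neg (annih ⟨x.1.1.1 + x.1.2.1, x.2⟩ ξ))) (annih x.1.2 ξ)).re

theorem cubicFn_numFn (φ f : ℕ → ℝ) (ξ : Fock) (x : CubicIdx) :
    cubicFn φ (numFn f ξ) x = cubicFn (fun n => φ n * (f (n + 1) * f (n + 2))) ξ x := by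
  simp only [cubicFn, annih_numFn, numFn_numFn]
  rw [inner_numFn, numFn_numFn]
  congr 4
  funext n
  ring

theorem cubicFn_add (φ ψ : ℕ → ℝ) (ξ : Fock) (x : CubicIdx) :
    cubicFn (fun n => φ n + ψ n) ξ x = cubicFn φ ξ x + cubicFn ψ ξ x := by
  simp only [cubicFn, re_inner_comm _ (annih x.1.2 ξ), inner_numFn_add, Complex.add_re]

/-- Cauchy-Schwarz with |r| on the side of two annihilators and 1/|r| on the side of one. The factor
|r|² must fall on a single particle without an extra 𝒩₊, so a power of 𝒩₊ is moved to the other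
side. -/
theorem cubic_bound {u : Mode → ℝ} {U B : ℝ} (hu : Summable fun p => u p ^ 2 / ‖mom p.1‖ ^ 2)
    (hU : ∑' p, u p ^ 2 / ‖mom p.1‖ ^ 2 ≤ U) {φ : ℕ → ℝ} (hφ : ∀ n, |φ n| ≤ B) {ξ : Fock}
    (hξ : Summable (kinTerm ξ)) :
    Summable (fun x : CubicIdx => u x.1.1 * cubicFn φ ξ x) ∧
      |∑' x : CubicIdx, u x.1.1 * cubicFn φ ξ x| ≤
        Real.sqrt ((B ^ 2 * kinForm ξ) * (U * expect (numOp ^ 2) ξ)) := by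
  -- Insert (𝒩₊+1)^(-1/2) (𝒩₊+1)^(1/2). The first factor cancels the 𝒩₊ from summing ‖a_s a_r ξ‖²
  -- over s; the second turns Σᵥ ‖aᵥ ξ‖² from ⟨𝒩₊⟩ into ⟨𝒩₊²⟩.
  set φ₁ : ℕ → ℝ := fun n => φ n * (Real.sqrt (n + 1))⁻¹ with h₁
  set φ₂ : ℕ → ℝ := fun n => Real.sqrt (n + 1) with h₂
  -- The pair (-r, r+v) determines (r, v), so the two sides can be summed over independent pairs of
  -- modes.
  set j : CubicIdx → Mode × Mode := fun x => (x.1.1.neg, ⟨x.1.1.1 + x.1.2.1, x.2⟩) with hj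
  have hjinj : Function.Injective j := by
    rintro ⟨⟨r, v⟩, hx⟩ ⟨⟨r', v'⟩, hx'⟩ h
    simp only [hj, Prod.mk.injEq, Subtype.mk.injEq] at h
    obtain ⟨h1, h2⟩ := h
    have h3 : r = r' := by rw [← r.neg_neg, h1, r'.neg_neg]
    subst h3
    have h4 : v = v' := Subtype.ext (add_left_cancel h2)
    subst h4
    rfl
  set P : Mode × Mode → ℝ := fun y => (‖mom y.1.1‖ * ‖numFn φ₁ (annih y.1 (annih y.2 ξ))‖) ^ 2
    with hP
  set Q : Mode × Mode → ℝ := fun y => (|u y.1| / ‖mom y.1.1‖ * ‖numFn φ₂ (annih y.2 ξ)‖) ^ 2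
    with hQ
  have hin : ∀ r, HasSum (fun s => P (r, s))
      (‖mom r.1‖ ^ 2 * expect (numFn fun n => n * (φ₁ (n - 1)) ^ 2) (annih r ξ)) := by
    intro r
    have := (hasSum_norm_numFn_annih φ₁ (annih r ξ)).mul_left (‖mom r.1‖ ^ 2)
    refine this.congr_fun ?_
    intro s
    simp only [hP, mul_pow, annih_comm r s]
  have hle : ∀ r, ‖mom r.1‖ ^ 2 * expect (numFn fun n => n * (φ₁ (n - 1)) ^ 2) (annih r ξ)
      ≤ B ^ 2 * kinTerm ξ r := by
    intro r
    rw [kinTerm_eq, mul_left_comm]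
    gcongr
    rw [← expect_numFn_one, ← expect_numFn_const_mul]
    refine expect_numFn_mono _ fun n => ?_
    rcases n with _ | n
    · simp; positivity
    · have h : φ n ^ 2 ≤ B ^ 2 := sq_le_sq' (abs_le.mp (hφ n)).1 (abs_le.mp (hφ n)).2
      simp only [h₁, Nat.add_sub_cancel, mul_pow, inv_pow, mul_one]
      rw [Real.sq_sqrt (by positivity)]
      push_cast
      field_simp
      exact h
  have hPs : Summable P := by
    rw [summable_prod_of_nonneg (fun _ => sq_nonneg _)]
    refine ⟨fun r => (hin r).summable, ?_⟩
    refine Summable.of_nonneg_of_le (fun r => tsum_nonneg fun s => sq_nonneg _) (fun r => ?_)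
      (hξ.mul_left (B ^ 2))
    rw [(hin r).tsum_eq]
    exact hle r
  have hPle : ∑' y, P y ≤ B ^ 2 * kinForm ξ := by
    rw [hPs.tsum_prod, kinForm, ← tsum_mul_left]
    refine hPs.prod.tsum_le_tsum (fun r => ?_) (hξ.mul_left _)
    rw [(hin r).tsum_eq]
    exact hle r
  have hNN : expect (numFn fun n => n * (φ₂ (n - 1)) ^ 2) ξ = expect (numOp ^ 2) ξ := by
    rw [expect, expect, numOp, sq, Module.End.mul_apply, numFn_numFn]
    congr 4
    funext n
    rcases n with _ | n
    · simp
    · simp only [h₂, Nat.add_sub_cancel]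
      rw [Real.sq_sqrt (by positivity)]
      push_cast
      ring
  have hQ2 := hasSum_norm_numFn_annih φ₂ ξ
  rw [hNN] at hQ2
  have hQeq : Q = fun y => (u y.1 ^ 2 / ‖mom y.1.1‖ ^ 2) * ‖numFn φ₂ (annih y.2 ξ)‖ ^ 2 := by
    funext y
    simp only [hQ, mul_pow, div_pow, sq_abs]
  have hQs : Summable Q := by
    rw [hQeq]
    exact hu.mul_of_nonneg hQ2.summable (fun _ => by positivity) (fun _ => by positivity)
  have hQle : ∑' y, Q y ≤ U * expect (numOp ^ 2) ξ := by
    have e : ∑' y, Q y = (∑' p, u p ^ 2 / ‖mom p.1‖ ^ 2) * expect (numOp ^ 2) ξ := by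
      rw [← hQ2.tsum_eq, hQeq]
      exact (hu.tsum_mul_tsum hQ2.summable (by rw [← hQeq]; exact hQs)).symm
    rw [e]
    exact mul_le_mul_of_nonneg_right hU (hQ2.nonneg fun _ => sq_nonneg _)
  refine summable_and_abs_tsum_le_sqrt
    (f := fun x => ‖mom (j x).1.1‖ * ‖numFn φ₁ (annih (j x).1 (annih (j x).2 ξ))‖)
    (g := fun x => |u x.1.1| / ‖mom x.1.1.1‖ * ‖numFn φ₂ (annih x.1.2 ξ)‖) (fun x => ?_)
    (hPs.comp_injective hjinj) (hQs.comp_injective Subtype.val_injective) ?_ ?_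
  · have h1 : cubicFn φ ξ x = (inner ℂ (numFn φ₁ (annih (j x).1 (annih (j x).2 ξ)))
        (numFn φ₂ (annih x.1.2 ξ))).re := by
      rw [inner_numFn, numFn_numFn, cubicFn]
      congr 4
      funext n
      have : Real.sqrt ((n : ℝ) + 1) ≠ 0 := by positivity
      simp only [h₁, h₂]
      field_simp
    have hm : ‖mom (j x).1.1‖ = ‖mom x.1.1.1‖ := norm_mom_neg _
    have h2 := norm_mom_pos x.1.1
    rw [hm, abs_mul, h1]
    calc _ ≤ |u x.1.1| * (‖numFn φ₁ (annih (j x).1 (annih (j x).2 ξ))‖ *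
          ‖numFn φ₂ (annih x.1.2 ξ)‖) := by
          gcongr
          exact abs_re_inner_le _ _
      _ = _ := by field_simp
  · exact (tsum_comp_le_tsum_of_inj hPs (fun _ => sq_nonneg _) hjinj).trans hPle
  · exact (tsum_comp_le_tsum_of_inj hQs (fun _ => sq_nonneg _) Subtype.val_injective).trans hQle

/-! ### The summands of the effective form -/

/-- The function `√((N - n)/N) √((N - n - 1)/N)`. -/
def pairCoeff (N n : ℕ) : ℝ :=
  Real.sqrt (((N : ℝ) - n) / N) * Real.sqrt (((N : ℝ) - (n + 1 : ℕ)) / N)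

/-- The function `√((N - n - 1)/N)`. -/
def cubicCoeff (N n : ℕ) : ℝ := Real.sqrt (((N : ℝ) - (n + 1 : ℕ)) / N)

theorem abs_sqrt_depletion_le (N n : ℕ) : |Real.sqrt (((N : ℝ) - n) / N)| ≤ 1 := by
  rw [abs_of_nonneg (Real.sqrt_nonneg _), Real.sqrt_le_one]
  rcases Nat.eq_zero_or_pos N with rfl | hN
  · simp
  · have : (0 : ℝ) < N := by exact_mod_cast hN
    rw [div_le_one this]
    have : (0 : ℝ) ≤ n := Nat.cast_nonneg n
    linarith

theorem abs_cubicCoeff_le (N n : ℕ) : |cubicCoeff N n| ≤ 1 := abs_sqrt_depletion_le N (n + 1)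

theorem abs_pairCoeff_le (N n : ℕ) : |pairCoeff N n| ≤ 1 := by
  rw [pairCoeff, abs_mul]
  exact mul_le_one₀ (abs_sqrt_depletion_le N n) (abs_nonneg _) (abs_sqrt_depletion_le N (n + 1))

theorem expect_add (S T : Module.End ℂ Fock) (ξ : Fock) :
    expect (S + T) ξ = expect S ξ + expect T ξ := by
  simp only [expect, LinearMap.add_apply, inner_add_right, Complex.add_re]

theorem pairTerm_eq (V : Plane → ℝ) (α : ℝ) (N : ℕ) (ξ : Fock) (p : Mode) :
    pairTerm V α N ξ p = 2 * (omegaHat V α N p.1 * pairFn (pairCoeff N) ξ p) := by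
  rw [pairTerm, expect_add]
  have h1 : expect (bAnnih N p * bAnnih N p.neg) ξ = pairFn (pairCoeff N) ξ p := by
    simp only [expect, bAnnih, Module.End.mul_apply, sqrtDepletion, annih_numFn, numFn_numFn]
    rfl
  have h2 : expect (bCreate N p * bCreate N p.neg) ξ = pairFn (pairCoeff N) ξ p := by
    simp only [expect, bCreate, Module.End.mul_apply, sqrtDepletion, inner_create, inner_numFn,
      annih_numFn, numFn_numFn]
    rw [re_inner_comm, annih_comm]
    rfl
  rw [h1, h2]
  ring

theorem cubicTerm_eq (V : Plane → ℝ) (α : ℝ) (N : ℕ) (ξ : Fock) (x : CubicIdx) :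
    cubicTerm V α N ξ x = 2 * (omegaHat V α N x.1.1.1 * cubicFn (cubicCoeff N) ξ x) := by
  simp only [cubicTerm]
  rw [expect_add]
  have h1 : expect (bCreate N ⟨x.1.1.1 + x.1.2.1, x.2⟩ * create x.1.1.neg * annih x.1.2) ξ
      = cubicFn (cubicCoeff N) ξ x := by
    simp only [expect, bCreate, Module.End.mul_apply, sqrtDepletion, inner_create, inner_numFn,
      annih_numFn]
    rfl
  have h2 : expect (create x.1.2 * annih x.1.1.neg * bAnnih N ⟨x.1.1.1 + x.1.2.1, x.2⟩) ξ
      = cubicFn (cubicCoeff N) ξ x := by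
    simp only [expect, bAnnih, Module.End.mul_apply, sqrtDepletion, inner_create, annih_numFn]
    rw [re_inner_comm]
    rfl
  rw [h1, h2]
  ring

theorem hasSum_diagTerm (N : ℕ) (ξ : Fock) :
    HasSum (diagTerm N ξ) (expect (numFn fun n => (n : ℝ) * (1 - n / N)) ξ) := by
  have h := hasSum_expect_annih (fun n => 1 - ((n + 1 : ℕ) : ℝ) / N) ξ
  have e : (fun n : ℕ => (n : ℝ) * (1 - ((n - 1 + 1 : ℕ) : ℝ) / N))
      = fun n : ℕ => (n : ℝ) * (1 - n / N) := by
    funext n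
    rcases n with _ | n
    · simp
    · simp
  rw [e] at h
  refine h.congr_fun ?_
  intro p
  simp only [diagTerm, expect, Module.End.mul_apply, inner_create, depletion, annih_numFn]

theorem expect_numOp_depletion (N : ℕ) (ξ : Fock) :
    expect (numOp * depletion N) ξ = expect (numFn fun n => (n : ℝ) * (1 - n / N)) ξ := by
  simp only [expect, numOp, depletion, Module.End.mul_apply, numFn_numFn]

theorem expect_numOp_sq (ξ : Fock) :
    expect (numOp ^ 2) ξ = expect (numFn fun n => (n : ℝ) ^ 2) ξ := by
  simp only [expect, numOp, sq, Module.End.mul_apply, numFn_numFn]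

/-- Completing the square in one pair of modes. -/
theorem bogoliubov_mode {A u : ℝ} (hA : 0 < A) {φ : ℕ → ℝ} (hφ : ∀ n, |φ n| ≤ 1)
    (ξ : Fock) (p : Mode) :
    -(u ^ 2 / (4 * A) * (‖annih p.neg ξ‖ ^ 2 + ‖ξ‖ ^ 2)) ≤
      A * ‖annih p ξ‖ ^ 2 + u * pairFn φ ξ p := by
  have h1 : pairFn φ ξ p = (inner ℂ (annih p ξ) (create p.neg (numFn φ ξ))).re := by
    rw [inner_create, pairFn, inner_numFn, annih_comm, re_inner_comm]
  -- From a a* = a* a + 1. The summand 1 becomes the energy shift of the pairing term, the other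
  -- summand its cost in 𝒩₊.
  have h2 : ‖create p.neg (numFn φ ξ)‖ ^ 2 ≤ ‖annih p.neg ξ‖ ^ 2 + ‖ξ‖ ^ 2 := by
    rw [norm_create_sq, annih_numFn]
    have a := norm_numFn_sq_le (fun n => hφ (n + 1)) (annih p.neg ξ)
    have b := norm_numFn_sq_le hφ ξ
    simp only [one_pow, one_mul] at a b
    exact add_le_add a b
  have h3 := abs_re_inner_le (annih p ξ) (create p.neg (numFn φ ξ))
  rw [← h1] at h3
  set x := ‖annih p ξ‖
  set y := ‖create p.neg (numFn φ ξ)‖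
  have h4 : -(|u| * (x * y)) ≤ u * pairFn φ ξ p := by
    have : |u * pairFn φ ξ p| ≤ |u| * (x * y) := by
      rw [abs_mul]; gcongr
    exact (abs_le.mp this).1
  have h5 : u ^ 2 / (4 * A) * y ^ 2 ≤ u ^ 2 / (4 * A) * (‖annih p.neg ξ‖ ^ 2 + ‖ξ‖ ^ 2) := by
    gcongr
  have h6 : 0 ≤ A * (x - |u| / (2 * A) * y) ^ 2 := by positivity
  have h7 : A * (x - |u| / (2 * A) * y) ^ 2 = A * x ^ 2 - |u| * (x * y) + u ^ 2 / (4 * A) * y ^ 2 := by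
    rw [← sq_abs u]
    field_simp
    ring
  linarith

/-! ### The potential energy -/

theorem integrable_mul_cos {V : Plane → ℝ} (hV : Integrable V) (k : Plane) :
    Integrable fun x => V x * Real.cos (inner ℝ k x) := by
  refine hV.mul_bdd (c := 1) ?_ ?_
  · exact (by fun_prop : Continuous fun x : Plane => Real.cos (inner ℝ k x)).aestronglyMeasurable
  · exact Filter.Eventually.of_forall fun x => Real.abs_cos_le_one _

theorem fourier_eq_integral_cos {V : Plane → ℝ} (hV : Integrable V) (k : Plane) :
    fourier V k = ∫ x, V x * Real.cos (inner ℝ k x) := by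
  have h : Integrable fun x : Plane =>
      (V x : ℂ) * Complex.exp (-(Complex.I * ((inner ℝ k x : ℝ) : ℂ))) := by
    refine hV.ofReal.mul_bdd (c := 1) ?_ ?_
    · exact (by fun_prop : Continuous fun x : Plane =>
        Complex.exp (-(Complex.I * ((inner ℝ k x : ℝ) : ℂ)))).aestronglyMeasurable
    · refine Filter.Eventually.of_forall fun x => ?_
      rw [Complex.norm_exp]
      simp
  rw [fourier, ← RCLike.re_eq_complex_re, ← integral_re h]
  congr 1
  funext x
  rw [RCLike.re_eq_complex_re, Complex.re_ofReal_mul]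
  congr 1
  rw [← mul_neg, mul_comm, ← Complex.ofReal_neg, Complex.exp_ofReal_mul_I_re, Real.cos_neg]

theorem potTerm_eq (V : Plane → ℝ) (N : ℕ) (ξ : Fock) (x : QuarticIdx) :
    potTerm V N ξ x = fourier V ((Real.exp N)⁻¹ • mom x.1.2.2) *
      (inner ℂ (annih x.1.2.1 (annih ⟨x.1.1.1 + x.1.2.2, x.2.1⟩ ξ))
        (annih ⟨x.1.2.1.1 + x.1.2.2, x.2.2⟩ (annih x.1.1 ξ))).re := by
  simp only [potTerm, expect, Module.End.mul_apply, inner_create]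

theorem mom_sub (k l : Lat) : mom (k - l) = mom k - mom l := by
  rw [mom, mom, mom, ← smul_sub]
  congr 1
  ext i
  simp

/-- A quadratic form which couples only vectors with equal labels is non-negative. -/
theorem sum_inner_of_label_eq_nonneg {ι κ : Type*} [DecidableEq κ] (Y : Finset ι) (h : ι → κ)
    (B : ι → Fock) :
    0 ≤ ∑ y ∈ Y, ∑ z ∈ Y, if h y = h z then (inner ℂ (B y) (B z)).re else 0 := by
  have e : ∑ y ∈ Y, ∑ z ∈ Y, (if h y = h z then (inner ℂ (B y) (B z)).re else 0)
      = ∑ P ∈ Y.image h, ‖∑ y ∈ Y with h y = P, B y‖ ^ 2 := by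
    have e1 : ∀ P, ‖∑ y ∈ Y with h y = P, B y‖ ^ 2
        = ∑ y ∈ Y with h y = P, ∑ z ∈ Y, if h y = h z then (inner ℂ (B y) (B z)).re else 0 := by
      intro P
      have e2 : ‖∑ y ∈ Y with h y = P, B y‖ ^ 2
        = (inner ℂ (∑ y ∈ Y with h y = P, B y) (∑ y ∈ Y with h y = P, B y)).re :=
        (inner_self_eq_norm_sq (𝕜 := ℂ) _).symm
      rw [e2, sum_inner, Complex.re_sum]
      refine Finset.sum_congr rfl fun y hy => ?_
      rw [inner_sum, Complex.re_sum, Finset.sum_filter]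
      refine Finset.sum_congr rfl fun z _ => ?_
      have : h y = P := (Finset.mem_filter.mp hy).2
      rw [this]
      simp only [eq_comm]
    simp only [e1]
    exact (Finset.sum_fiberwise_of_maps_to (fun y hy => Finset.mem_image_of_mem h hy) _).symm
  rw [e]
  exact Finset.sum_nonneg fun _ _ => sq_nonneg _

theorem re_inner_real_smul (a b : ℝ) (ξ ζ : Fock) :
    (inner ℂ ((a : ℂ) • ξ) ((b : ℂ) • ζ)).re = a * b * (inner ℂ ξ ζ).re := by
  have h1 : inner ℂ ((a : ℂ) • ξ) ((b : ℂ) • ζ) = (starRingEnd ℂ (a : ℂ)) * inner ℂ ξ ((b : ℂ) • ζ) :=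
    inner_smul_left (𝕜 := ℂ) (E := Fock) ξ _ (a : ℂ)
  have h2 : inner ℂ ξ ((b : ℂ) • ζ) = (b : ℂ) * inner ℂ ξ ζ :=
    inner_smul_right (𝕜 := ℂ) (E := Fock) ξ ζ (b : ℂ)
  rw [h1, h2, Complex.conj_ofReal, Complex.re_ofReal_mul, Complex.re_ofReal_mul]
  ring

/-- The addition formula writes cos(θ_y - θ_z) as a sum of two rank-one kernels; each can be
absorbed into the vectors as a real factor. -/
theorem sum_cos_inner_nonneg {ι κ : Type*} [DecidableEq κ] (Y : Finset ι) (h : ι → κ)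
    (A : ι → Fock) (θ : ι → ℝ) :
    0 ≤ ∑ y ∈ Y, ∑ z ∈ Y, if h y = h z then
      Real.cos (θ y - θ z) * (inner ℂ (A y) (A z)).re else 0 := by
  have h1 := sum_inner_of_label_eq_nonneg Y h fun y => ((Real.cos (θ y) : ℝ) : ℂ) • A y
  have h2 := sum_inner_of_label_eq_nonneg Y h fun y => ((Real.sin (θ y) : ℝ) : ℂ) • A y
  refine (add_nonneg h1 h2).trans_eq ?_
  rw [← Finset.sum_add_distrib]
  refine Finset.sum_congr rfl fun y _ => ?_
  rw [← Finset.sum_add_distrib]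
  refine Finset.sum_congr rfl fun z _ => ?_
  split_ifs
  · rw [re_inner_real_smul, re_inner_real_smul, Real.cos_sub]
    ring
  · simp

/-- Writing V̂ as a cosine integral against V ≥ 0, each x contributes a form Σ cos(θ_y - θ_z)
Re⟨A_y, A_z⟩ over pairs of modes of equal total momentum, which is non-negative. -/
theorem potForm_nonneg {V : Plane → ℝ} (hV : Integrable V) (h0 : ∀ᵐ x, 0 ≤ V x) (N : ℕ) {ξ : Fock}
    (hs : Summable (potTerm V N ξ)) : 0 ≤ potForm V N ξ := by
  classical
  set A : Mode × Mode → Fock := fun y => annih y.2 (annih y.1 ξ) with hA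
  set h : Mode × Mode → Lat := fun y => y.1.1 + y.2.1 with hh
  set g : (Mode × Mode) × (Mode × Mode) → ℝ := fun w => if h w.1 = h w.2 then
    fourier V ((Real.exp N)⁻¹ • mom (w.1.1.1 - w.2.1.1)) * (inner ℂ (A w.1) (A w.2)).re else 0
    with hg
  -- The index (p, q, r) becomes the two pairs (p+r, q) and (p, q+r). The image is exactly the set
  -- of pairs with equal total momentum, and r is the difference of the first entries.
  set j : QuarticIdx → (Mode × Mode) × (Mode × Mode) := fun x =>
    ((⟨x.1.1.1 + x.1.2.2, x.2.1⟩, x.1.2.1), (x.1.1, ⟨x.1.2.1.1 + x.1.2.2, x.2.2⟩)) with hj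
  have hjinj : Function.Injective j := by
    rintro ⟨⟨p, q, r⟩, hx⟩ ⟨⟨p', q', r'⟩, hx'⟩ e
    simp only [hj, Prod.mk.injEq, Subtype.mk.injEq] at e
    obtain ⟨⟨e1, rfl⟩, rfl, e2⟩ := e
    have : r = r' := add_left_cancel e1
    subst this
    rfl
  have hgj : g ∘ j = potTerm V N ξ := by
    funext x
    simp only [Function.comp_apply, hg, hj, hh, hA, potTerm_eq, add_sub_cancel_left]
    rw [if_pos (by abel)]
  have hg0 : ∀ w, w ∉ Set.range j → g w = 0 := by
    intro w hw
    simp only [hg]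
    rw [if_neg]
    intro e
    apply hw
    obtain ⟨⟨y1, y2⟩, ⟨z1, z2⟩⟩ := w
    simp only [hh] at e
    have e3 : y2.1 + (y1.1 - z1.1) = z2.1 := by
      calc y2.1 + (y1.1 - z1.1) = (y1.1 + y2.1) - z1.1 := by abel
        _ = z2.1 := by rw [e]; abel
    refine ⟨⟨(z1, y2, y1.1 - z1.1), ?_, ?_⟩, ?_⟩
    · simpa using y1.2
    · simp only [e3]; exact z2.2
    · simp only [hj, Prod.mk.injEq]
      refine ⟨⟨Subtype.ext (by simp), trivial⟩, trivial, Subtype.ext e3⟩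
  have hsum : HasSum g (∑' x, potTerm V N ξ x) := by
    rw [← hjinj.hasSum_iff hg0, hgj]
    exact hs.hasSum
  -- Positivity is available only for finite index sets of the form Y × Y. These are cofinal, so the
  -- sum is a limit along them.
  have ht : Filter.Tendsto (fun S : Finset Mode => (S ×ˢ S) ×ˢ (S ×ˢ S)) Filter.atTop
      Filter.atTop := by
    refine Filter.tendsto_atTop_atTop_of_monotone (fun S T hST => ?_) fun b => ?_
    · exact Finset.product_subset_product (Finset.product_subset_product hST hST)
        (Finset.product_subset_product hST hST)
    · refine ⟨(b.image fun w => w.1.1) ∪ (b.image fun w => w.1.2) ∪ (b.image fun w => w.2.1) ∪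
        (b.image fun w => w.2.2), fun w hw => ?_⟩
      simp only [Finset.mem_product, Finset.mem_union, Finset.mem_image]
      refine ⟨⟨?_, ?_⟩, ?_, ?_⟩
      · exact Or.inl (Or.inl (Or.inl ⟨w, hw, rfl⟩))
      · exact Or.inl (Or.inl (Or.inr ⟨w, hw, rfl⟩))
      · exact Or.inl (Or.inr ⟨w, hw, rfl⟩)
      · exact Or.inr ⟨w, hw, rfl⟩
  have hfin : ∀ S : Finset Mode, 0 ≤ ∑ w ∈ (S ×ˢ S) ×ˢ (S ×ˢ S), g w := by
    intro S
    have hterm : ∀ w, g w = ∫ x, V x * (if h w.1 = h w.2 then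
        Real.cos (inner ℝ ((Real.exp N)⁻¹ • mom w.1.1.1) x -
          inner ℝ ((Real.exp N)⁻¹ • mom w.2.1.1) x) * (inner ℂ (A w.1) (A w.2)).re else 0) := by
      intro w
      simp only [hg]
      split_ifs
      · rw [fourier_eq_integral_cos hV, ← integral_mul_const]
        congr 1
        funext x
        rw [mom_sub, smul_sub, inner_sub_left, mul_assoc]
      · simp
    have hint : ∀ w : (Mode × Mode) × (Mode × Mode), Integrable fun x => V x * (if h w.1 = h w.2 then
        Real.cos (inner ℝ ((Real.exp N)⁻¹ • mom w.1.1.1) x -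
          inner ℝ ((Real.exp N)⁻¹ • mom w.2.1.1) x) * (inner ℂ (A w.1) (A w.2)).re else 0) := by
      intro w
      split_ifs
      · have := (integrable_mul_cos hV ((Real.exp N)⁻¹ • mom w.1.1.1 -
          (Real.exp N)⁻¹ • mom w.2.1.1)).mul_const (inner ℂ (A w.1) (A w.2)).re
        refine this.congr (Filter.Eventually.of_forall fun x => ?_)
        simp only [inner_sub_left, mul_assoc]
      · simp
    simp only [hterm]
    rw [← integral_finsetSum _ fun w _ => hint w]
    refine integral_nonneg_of_ae ?_
    filter_upwards [h0] with x hx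
    simp only [← Finset.mul_sum, Pi.zero_apply]
    refine mul_nonneg hx ?_
    rw [Finset.sum_product]
    exact sum_cos_inner_nonneg (S ×ˢ S) h A fun y => inner ℝ ((Real.exp N)⁻¹ • mom y.1.1) x
  have := ge_of_tendsto (hsum.comp ht) (Filter.Eventually.of_forall fun S => hfin S)
  rw [potForm]
  positivity

/-! ### Absolute convergence of the potential energy -/

theorem summable_inv_norm_mom_pow_four :
    Summable fun t : Mode => (‖mom t.1‖ ^ 4)⁻¹ := by
  have h1 : Summable fun n : ℤ => (1 + (n : ℝ) ^ 2)⁻¹ := by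
    have h2 : Summable fun n : ℤ => ((n : ℝ) ^ 2)⁻¹ := by
      have := (Real.summable_one_div_int_pow (p := 2)).mpr (by norm_num)
      simpa using this
    have h3 : Summable fun n : ℤ => if n = 0 then (1 : ℝ) else 0 :=
      (hasSum_ite_eq 0 1).summable
    refine Summable.of_nonneg_of_le (fun n => by positivity) (fun n => ?_) (h2.add h3)
    split_ifs with hn
    · simp [hn]
    · rw [add_zero]
      have : (0 : ℝ) < (n : ℝ) ^ 2 := by positivity
      gcongr
      linarith
  have h4 := h1.mul_of_nonneg h1 (fun _ => by positivity) (fun _ => by positivity)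
  have h5 : Function.Injective fun t : Mode => ((t.1 0, t.1 1) : ℤ × ℤ) := by
    intro s t hst
    simp only [Prod.mk.injEq] at hst
    refine Subtype.ext (funext fun i => ?_)
    fin_cases i
    · exact hst.1
    · exact hst.2
  refine Summable.of_nonneg_of_le (fun t => by positivity) (fun t => ?_) (h4.comp_injective h5)
  have h6 := four_pi_sq_le_norm_mom_sq t
  have h7 := norm_mom_sq t.1
  have h8 := norm_mom_pos t
  simp only [Function.comp_apply]
  rw [← mul_inv]
  have h9 := Real.pi_gt_three
  refine inv_anti₀ (by positivity) ?_
  have e : ‖mom t.1‖ ^ 4 = (‖mom t.1‖ ^ 2) ^ 2 := by ring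
  rw [e]
  rw [h7] at h6 ⊢
  set a := (t.1 0 : ℝ) ^ 2 with ha
  set b := (t.1 1 : ℝ) ^ 2 with hb
  have ha0 : 0 ≤ a := sq_nonneg _
  have hb0 : 0 ≤ b := sq_nonneg _
  have hab : 1 ≤ a + b := by
    have : 0 < 4 * Real.pi ^ 2 := by positivity
    nlinarith
  have : 2 * (a + b) ≤ 4 * Real.pi ^ 2 * (a + b) :=
    mul_le_mul_of_nonneg_right (by nlinarith) (by linarith)
  calc (1 + a) * (1 + b) ≤ (2 * (a + b)) ^ 2 := by nlinarith
    _ ≤ _ := by gcongr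

theorem expect_numOp_le {N : ℕ} {ξ : Fock} (hξ : ξ ∈ truncFock N) :
    expect numOp ξ ≤ N * ‖ξ‖ ^ 2 := by
  rw [← expect_numFn_one, ← expect_numFn_const_mul]
  refine expect_numFn_le hξ fun n hn => ?_
  rw [mul_one]
  exact_mod_cast hn

theorem summable_prod_mul_of_tsum_le {ι κ : Type*} {c : ι → κ → ℝ} {Q : ι → ℝ} {D : ℝ}
    (hc : ∀ y t, 0 ≤ c y t) (hQ : ∀ y, 0 ≤ Q y) (hs : ∀ y, Summable (c y))
    (hD : ∀ y, ∑' t, c y t ≤ D) (hQs : Summable Q) :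
    Summable fun w : ι × κ => c w.1 w.2 * Q w.1 := by
  rw [summable_prod_of_nonneg fun w => mul_nonneg (hc _ _) (hQ _)]
  refine ⟨fun y => Summable.mul_right (Q y) (hs y), ?_⟩
  refine Summable.of_nonneg_of_le (fun y => tsum_nonneg fun t => mul_nonneg (hc y t) (hQ y))
    (fun y => ?_) (hQs.mul_left D)
  simp only [tsum_mul_right]
  exact mul_le_mul_of_nonneg_right (hD y) (hQ y)

/-- After weighting by momenta, the sum over one free mode t is Σ |V̂(t-q)|/t², bounded uniformly in
q because both V̂ and t⁻² are square summable. The remaining two-particle sum is at most N𝒦, by the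
cutoff on the particle number. -/
theorem summable_potTerm {V : Plane → ℝ} {N : ℕ}
    (hW : Summable fun r : Lat => fourier V ((Real.exp N)⁻¹ • mom r) ^ 2) {ξ : Fock}
    (hξ : ξ ∈ formDomain N) : Summable (potTerm V N ξ) := by
  set W : Lat → ℝ := fun r => fourier V ((Real.exp N)⁻¹ • mom r) with hWdef
  set Q : Mode × Mode → ℝ := fun y => ‖mom y.1.1‖ ^ 2 * ‖annih y.2 (annih y.1 ξ)‖ ^ 2 with hQ
  have hQs : Summable Q := by
    have hin : ∀ p, HasSum (fun q => Q (p, q)) (‖mom p.1‖ ^ 2 * expect numOp (annih p ξ)) :=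
      fun p => (hasSum_norm_annih _).mul_left _
    rw [summable_prod_of_nonneg (fun _ => by positivity)]
    refine ⟨fun p => (hin p).summable, ?_⟩
    refine Summable.of_nonneg_of_le (fun p => tsum_nonneg fun q => by positivity) (fun p => ?_)
      (hξ.2.mul_left (N : ℝ))
    rw [(hin p).tsum_eq, kinTerm_eq, mul_left_comm]
    gcongr
    exact expect_numOp_le (annih_mem_truncFock p hξ.1)
  set F : (Mode × Mode) × Mode → ℝ := fun w =>
    |W (w.2.1 - w.1.2.1)| / ‖mom w.2.1‖ ^ 2 * Q w.1 with hF
  have hinner : ∀ y : Mode × Mode, Summable (fun t : Mode => |W (t.1 - y.2.1)| / ‖mom t.1‖ ^ 2) ∧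
      ∑' t : Mode, |W (t.1 - y.2.1)| / ‖mom t.1‖ ^ 2 ≤
        (∑' r, W r ^ 2) + ∑' t : Mode, (‖mom t.1‖ ^ 4)⁻¹ := by
    intro y
    have hinj : Function.Injective fun t : Mode => t.1 - y.2.1 := fun s t h =>
      Subtype.ext (sub_left_injective h)
    have hs1 : Summable fun t : Mode => W (t.1 - y.2.1) ^ 2 := hW.comp_injective hinj
    have hle : ∀ t : Mode, |W (t.1 - y.2.1)| / ‖mom t.1‖ ^ 2 ≤
        W (t.1 - y.2.1) ^ 2 + (‖mom t.1‖ ^ 4)⁻¹ := by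
      intro t
      have e : (‖mom t.1‖ ^ 4)⁻¹ = ((‖mom t.1‖ ^ 2)⁻¹) ^ 2 := by
        rw [inv_pow, ← pow_mul]
      rw [e, ← sq_abs (W _), div_eq_mul_inv]
      nlinarith [sq_nonneg (|W (t.1 - y.2.1)| - (‖mom t.1‖ ^ 2)⁻¹),
        sq_nonneg (|W (t.1 - y.2.1)|), sq_nonneg ((‖mom t.1‖ ^ 2)⁻¹)]
    have hs2 := hs1.add summable_inv_norm_mom_pow_four
    have hs := Summable.of_nonneg_of_le (fun t : Mode => by positivity) hle hs2
    refine ⟨hs, (hs.tsum_le_tsum hle hs2).trans ?_⟩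
    rw [hs1.tsum_add summable_inv_norm_mom_pow_four]
    gcongr
    exact tsum_comp_le_tsum_of_inj hW (fun _ => sq_nonneg _) hinj
  have hFs : Summable F :=
    summable_prod_mul_of_tsum_le (c := fun (y : Mode × Mode) (t : Mode) =>
      |W (t.1 - y.2.1)| / ‖mom t.1‖ ^ 2) (Q := Q) (fun _ _ => by positivity) (fun _ => by positivity)
      (fun y => (hinner y).1) (fun y => (hinner y).2) hQs
  set j₁ : QuarticIdx → (Mode × Mode) × Mode := fun x =>
    ((⟨x.1.1.1 + x.1.2.2, x.2.1⟩, x.1.2.1), ⟨x.1.2.1.1 + x.1.2.2, x.2.2⟩) with hj₁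
  set j₂ : QuarticIdx → (Mode × Mode) × Mode := fun x =>
    ((⟨x.1.2.1.1 + x.1.2.2, x.2.2⟩, x.1.1), ⟨x.1.1.1 + x.1.2.2, x.2.1⟩) with hj₂
  have hi₁ : Function.Injective j₁ := by
    rintro ⟨⟨p, q, r⟩, hx⟩ ⟨⟨p', q', r'⟩, hx'⟩ e
    simp only [hj₁, Prod.mk.injEq, Subtype.mk.injEq] at e
    obtain ⟨⟨e1, rfl⟩, e2⟩ := e
    have : r = r' := add_left_cancel e2
    subst this
    have : p = p' := Subtype.ext (add_right_cancel e1)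
    subst this
    rfl
  have hi₂ : Function.Injective j₂ := by
    rintro ⟨⟨p, q, r⟩, hx⟩ ⟨⟨p', q', r'⟩, hx'⟩ e
    simp only [hj₂, Prod.mk.injEq, Subtype.mk.injEq] at e
    obtain ⟨⟨e1, rfl⟩, e2⟩ := e
    have : r = r' := add_left_cancel e2
    subst this
    have : q = q' := Subtype.ext (add_right_cancel e1)
    subst this
    rfl
  refine Summable.of_norm_bounded ((hFs.comp_injective hi₁).add (hFs.comp_injective hi₂)) ?_
  intro x
  rw [potTerm_eq, Real.norm_eq_abs, abs_mul]
  have h1 := abs_re_inner_le (annih x.1.2.1 (annih ⟨x.1.1.1 + x.1.2.2, x.2.1⟩ ξ))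
        (annih ⟨x.1.2.1.1 + x.1.2.2, x.2.2⟩ (annih x.1.1 ξ))
  simp only [Function.comp_apply, hF, hQ, hj₁, hj₂, add_sub_cancel_left]
  rw [annih_comm x.1.1 ⟨x.1.2.1.1 + x.1.2.2, x.2.2⟩]
  set X := ‖annih x.1.2.1 (annih ⟨x.1.1.1 + x.1.2.2, x.2.1⟩ ξ)‖
  set Y := ‖annih ⟨x.1.2.1.1 + x.1.2.2, x.2.2⟩ (annih x.1.1 ξ)‖
  have ha : 0 < ‖mom (x.1.1.1 + x.1.2.2)‖ := norm_mom_pos ⟨_, x.2.1⟩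
  have hb : 0 < ‖mom (x.1.2.1.1 + x.1.2.2)‖ := norm_mom_pos ⟨_, x.2.2⟩
  set a := ‖mom (x.1.1.1 + x.1.2.2)‖
  set b := ‖mom (x.1.2.1.1 + x.1.2.2)‖
  change |W x.1.2.2| * _ ≤ _
  -- Each side receives the momentum of one of its own annihilators as a weight and the inverse
  -- momentum of the mode that is free on that side.
  have hXY : X * Y ≤ (a / b * X) ^ 2 + (b / a * Y) ^ 2 := by
    have e : X * Y = (a / b * X) * (b / a * Y) := by field_simp
    rw [e]
    nlinarith [sq_nonneg (a / b * X - b / a * Y), sq_nonneg (a / b * X), sq_nonneg (b / a * Y)]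
  calc _ ≤ |W x.1.2.2| * ((a / b * X) ^ 2 + (b / a * Y) ^ 2) := by
        gcongr
        exact h1.trans hXY
    _ = _ := by
        simp only [mul_pow, div_pow]
        ring

/-! ### Integration over the plane -/

/-- Cartesian coordinates on the plane. -/
def planeEquiv : ℝ × ℝ ≃ᵐ Plane :=
  MeasurableEquiv.finTwoArrow.symm.trans (MeasurableEquiv.toLp 2 (Fin 2 → ℝ))

theorem measurePreserving_planeEquiv : MeasurePreserving planeEquiv volume volume :=
  (volume_preserving_finTwoArrow ℝ).symm.trans
    (EuclideanSpace.volume_preserving_symm_measurableEquiv_toLp (Fin 2)).symm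

theorem integral_plane {E : Type*} [NormedAddCommGroup E] [NormedSpace ℝ E] (f : Plane → E) :
    ∫ x, f x = ∫ p : ℝ × ℝ, f (!₂[p.1, p.2]) :=
  (measurePreserving_planeEquiv.integral_comp' f).symm

theorem integrable_plane_iff {E : Type*} [NormedAddCommGroup E] (f : Plane → E) :
    Integrable (fun p : ℝ × ℝ => f (!₂[p.1, p.2])) ↔ Integrable f :=
  measurePreserving_planeEquiv.integrable_comp_emb planeEquiv.measurableEmbedding

theorem inner_plane (k : Plane) (a b : ℝ) : inner ℝ k (!₂[a, b] : Plane) = k 0 * a + k 1 * b := by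
  simp [PiLp.inner_apply, Fin.sum_univ_two, mul_comm]

theorem norm_sq_plane (a b : ℝ) : ‖(!₂[a, b] : Plane)‖ ^ 2 = a ^ 2 + b ^ 2 := by
  simp [EuclideanSpace.norm_sq_eq, Fin.sum_univ_two]

theorem mom_apply (k : Lat) (i : Fin 2) : mom k i = 2 * Real.pi * k i := rfl

/-! ### Square summability of Fourier coefficients -/

/-- The half-open square of side `2 L`. -/
def square (L : ℝ) : Set Plane := {x | x 0 ∈ Set.Ioc (-L) L ∧ x 1 ∈ Set.Ioc (-L) L}

theorem measurableSet_square (L : ℝ) : MeasurableSet (square L) := by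
  have h : ∀ i : Fin 2, Measurable fun x : Plane => x i := fun i =>
    (by fun_prop : Continuous fun x : Plane => x i).measurable
  exact (h 0 measurableSet_Ioc).inter (h 1 measurableSet_Ioc)

theorem setIntegral_square_mul {L : ℝ} (f g : ℝ → ℂ) (F : Plane → ℂ)
    (hF : ∀ a b, F (!₂[a, b]) = f a * g b) :
    ∫ x in square L, F x = (∫ a in Set.Ioc (-L) L, f a) * ∫ b in Set.Ioc (-L) L, g b := by
  rw [← integral_indicator (measurableSet_square L), integral_plane,
    ← integral_indicator measurableSet_Ioc, ← integral_indicator measurableSet_Ioc,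
    ← integral_prod_mul]
  congr 1
  funext p
  simp only [Set.indicator, square, Set.mem_ofPred_eq, hF]
  by_cases h0 : p.1 ∈ Set.Ioc (-L) L <;> by_cases h1 : p.2 ∈ Set.Ioc (-L) L <;> simp [h0, h1]

theorem isFiniteMeasure_square (L : ℝ) :
    IsFiniteMeasure ((volume : Measure Plane).restrict (square L)) := by
  refine ⟨?_⟩
  rw [Measure.restrict_apply_univ]
  refine lt_of_le_of_lt (measure_mono fun x hx => ?_)
    (measure_closedBall_lt_top (x := (0 : Plane)) (r := 2 * |L|))
  rw [mem_closedBall_zero_iff]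
  have h0 : |x 0| ≤ |L| := by
    rw [abs_le]
    exact ⟨by linarith [hx.1.1, le_abs_self L], by linarith [hx.1.2, le_abs_self L]⟩
  have h1 : |x 1| ≤ |L| := by
    rw [abs_le]
    exact ⟨by linarith [hx.2.1, le_abs_self L], by linarith [hx.2.2, le_abs_self L]⟩
  rw [← sq_le_sq₀ (norm_nonneg _) (by positivity), EuclideanSpace.norm_sq_eq, Fin.sum_univ_two,
    Real.norm_eq_abs, Real.norm_eq_abs]
  have := abs_nonneg (x 0)
  have := abs_nonneg (x 1)
  nlinarith

theorem integral_exp_period {c : ℝ} (hc : 0 < c) (m : ℕ) (n : ℤ) :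
    ∫ a in Set.Ioc (-(m * c)) (m * c), Complex.exp (2 * Real.pi * Complex.I * n / c * a)
      = if n = 0 then ((2 * (m * c) : ℝ) : ℂ) else 0 := by
  have hle : -(m * c) ≤ m * c := by
    have : 0 ≤ m * c := by positivity
    linarith
  rw [← intervalIntegral.integral_of_le hle]
  split_ifs with h
  · simp [h]
    ring
  · have hn : (n : ℂ) ≠ 0 := by exact_mod_cast h
    have hc' : (c : ℂ) ≠ 0 := by exact_mod_cast hc.ne'
    have hpi : (Real.pi : ℂ) ≠ 0 := by exact_mod_cast Real.pi_ne_zero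
    rw [integral_exp_mul_complex (by simp [hn, hc', hpi])]
    have e1 : 2 * Real.pi * Complex.I * n / c * ((m * c : ℝ) : ℂ)
        = ((n * m : ℤ) : ℂ) * (2 * Real.pi * Complex.I) := by
      push_cast
      field_simp
    have e2 : 2 * Real.pi * Complex.I * n / c * ((-(m * c) : ℝ) : ℂ)
        = ((-(n * m) : ℤ) : ℂ) * (2 * Real.pi * Complex.I) := by
      push_cast
      field_simp
    rw [e1, e2, Complex.exp_int_mul_two_pi_mul_I, Complex.exp_int_mul_two_pi_mul_I]
    simp

/-- Bessel's inequality on a square containing the support. The exponentials with momenta c⁻¹ · 2πℤ²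
are c-periodic, so they are orthogonal on any square whose side is a multiple of c. -/
theorem summable_fourier_sq {V : Plane → ℝ} (hV : MemLp V 2) {R : ℝ}
    (hR : ∀ᵐ x, R < ‖x‖ → V x = 0) {c : ℝ} (hc : 0 < c) :
    Summable fun r : Lat => fourier V (c⁻¹ • mom r) ^ 2 := by
  obtain ⟨m, hm⟩ := exists_nat_gt (|R| / c)
  set L : ℝ := m * c with hL
  have hLR : |R| < L := by rwa [div_lt_iff₀ hc] at hm
  have hL0 : 0 < L := lt_of_le_of_lt (abs_nonneg _) hLR
  set μ : Measure Plane := volume.restrict (square L) with hμ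
  have : IsFiniteMeasure μ := isFiniteMeasure_square L
  set e : Lat → Plane → ℂ := fun r x =>
    ((2 * L : ℝ) : ℂ)⁻¹ * Complex.exp (Complex.I * ((inner ℝ (c⁻¹ • mom r) x : ℝ) : ℂ)) with he
  have hem : ∀ r, MemLp (e r) 2 μ := by
    intro r
    refine MemLp.of_bound (C := (2 * L)⁻¹) ?_ ?_
    · exact (by fun_prop : Continuous (e r)).aestronglyMeasurable
    · refine Filter.Eventually.of_forall fun x => ?_
      simp only [he]
      rw [norm_mul, Complex.norm_exp, norm_inv, Complex.norm_real, Real.norm_eq_abs,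
        abs_of_pos (by positivity)]
      simp
  have hVm : MemLp (fun x => (V x : ℂ)) 2 μ := (hV.restrict _).ofReal
  set v : Lat → Lp ℂ 2 μ := fun r => (hem r).toLp with hv
  have hort : Orthonormal ℂ v := by
    classical
    rw [orthonormal_iff_ite]
    intro r s
    have h1 : inner ℂ (v r) (v s) = ∫ x in square L, (((2 * L : ℝ) : ℂ) ^ 2)⁻¹ *
        Complex.exp (Complex.I * ((inner ℝ (c⁻¹ • mom (s - r)) x : ℝ) : ℂ)) := by
      rw [L2.inner_def]
      refine integral_congr_ae ?_
      filter_upwards [(hem r).coeFn_toLp, (hem s).coeFn_toLp] with x h1 h2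
      simp only [hv]
      rw [h1, h2]
      simp only [he, RCLike.inner_apply, map_mul, ← Complex.exp_conj, Complex.conj_I,
        Complex.conj_ofReal, map_inv₀, mom_sub, smul_sub, inner_sub_left]
      rw [show ∀ a b x y : ℂ, a * x * (b * y) = a * b * (x * y) by intros; ring, ← Complex.exp_add]
      congr 1
      · rw [sq, mul_inv]
      · congr 1
        push_cast
        ring
    rw [h1, integral_const_mul]
    rw [setIntegral_square_mul
      (fun a => Complex.exp (2 * Real.pi * Complex.I * ((s - r) 0 : ℤ) / c * a))
      (fun a => Complex.exp (2 * Real.pi * Complex.I * ((s - r) 1 : ℤ) / c * a))]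
    · rw [integral_exp_period hc, integral_exp_period hc, ← hL]
      have hL' : ((2 * L : ℝ) : ℂ) ≠ 0 := by exact_mod_cast (by positivity : 2 * L ≠ 0)
      by_cases hrs : r = s
      · subst hrs
        simp only [sub_self, Pi.zero_apply, if_true]
        field_simp
      · rw [if_neg hrs]
        have : (s - r) 0 ≠ 0 ∨ (s - r) 1 ≠ 0 := by
          by_contra hcon
          push Not at hcon
          apply hrs
          funext i
          fin_cases i
          · exact (sub_eq_zero.mp hcon.1).symm
          · exact (sub_eq_zero.mp hcon.2).symm
        rcases this with h | h <;> rw [if_neg h] <;> simp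
    · intro a b
      rw [← Complex.exp_add, inner_plane]
      congr 1
      have hc' : (c : ℂ) ≠ 0 := by exact_mod_cast hc.ne'
      simp only [PiLp.smul_apply, mom_apply, smul_eq_mul]
      push_cast
      field_simp
  have hB := (hort.inner_products_summable (x := hVm.toLp)).mul_left ((2 * L) ^ 2)
  refine Summable.of_nonneg_of_le (fun r => sq_nonneg _) (fun r => ?_) hB
  have h2 : ((2 * L : ℝ) : ℂ) * inner ℂ (v r) hVm.toLp =
      ∫ x, (V x : ℂ) * Complex.exp (-(Complex.I * ((inner ℝ (c⁻¹ • mom r) x : ℝ) : ℂ))) := by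
    rw [L2.inner_def, ← integral_const_mul]
    have h3 : ∫ x, (V x : ℂ) * Complex.exp (-(Complex.I * ((inner ℝ (c⁻¹ • mom r) x : ℝ) : ℂ)))
        = ∫ x in square L,
          (V x : ℂ) * Complex.exp (-(Complex.I * ((inner ℝ (c⁻¹ • mom r) x : ℝ) : ℂ))) := by
      refine (setIntegral_eq_integral_of_ae_compl_eq_zero ?_).symm
      filter_upwards [hR] with x hx hxs
      rw [hx, Complex.ofReal_zero, zero_mul]
      by_contra hcon
      apply hxs
      have hx' : ∀ i, |x i| < L := fun i => by
        have := PiLp.norm_apply_le x i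
        rw [Real.norm_eq_abs] at this
        exact lt_of_le_of_lt (this.trans ((not_lt.mp hcon).trans (le_abs_self R))) hLR
      exact ⟨⟨(abs_lt.mp (hx' 0)).1, (abs_lt.mp (hx' 0)).2.le⟩,
        ⟨(abs_lt.mp (hx' 1)).1, (abs_lt.mp (hx' 1)).2.le⟩⟩
    rw [h3]
    refine integral_congr_ae ?_
    filter_upwards [(hem r).coeFn_toLp, hVm.coeFn_toLp] with x h1 h2
    simp only [hv]
    rw [h1, h2]
    have hL' : ((2 * L : ℝ) : ℂ) ≠ 0 := by exact_mod_cast (by positivity : 2 * L ≠ 0)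
    simp only [he, RCLike.inner_apply, map_mul, ← Complex.exp_conj, Complex.conj_I,
        Complex.conj_ofReal, map_inv₀]
    rw [neg_mul]
    field_simp
  have h4 : |fourier V (c⁻¹ • mom r)| ≤ 2 * L * ‖inner ℂ (v r) hVm.toLp‖ := by
    rw [fourier, ← h2]
    refine (Complex.abs_re_le_norm _).trans ?_
    rw [norm_mul, Complex.norm_real, Real.norm_eq_abs, abs_of_pos (by positivity)]
  rw [← sq_abs, ← mul_pow]
  gcongr

/-! ### The Fourier transform of the unit disk -/

/-- The Fourier transform of the characteristic function of the unit disk. -/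
def diskHat (k : Plane) : ℝ := fourier ((Metric.closedBall (0 : Plane) 1).indicator fun _ => 1) k

theorem integrable_disk :
    Integrable ((Metric.closedBall (0 : Plane) 1).indicator fun _ => (1 : ℝ)) :=
  (integrable_indicator_iff measurableSet_closedBall).mpr
    (integrableOn_const measure_closedBall_lt_top.ne)

theorem integral_disk :
    ∫ x, (Metric.closedBall (0 : Plane) 1).indicator (fun _ => (1 : ℝ)) x = Real.pi := by
  rw [integral_indicator measurableSet_closedBall]
  simp [Measure.real, Real.pi_pos.le, InnerProductSpace.volume_closedBall_of_dim_even (k := 1)]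

theorem diskHat_zero : diskHat 0 = Real.pi := by
  rw [diskHat, fourier_eq_integral_cos integrable_disk, ← integral_disk]
  simp

theorem abs_diskHat_le_pi (k : Plane) : |diskHat k| ≤ Real.pi := by
  rw [diskHat, fourier_eq_integral_cos integrable_disk, ← integral_disk, ← Real.norm_eq_abs]
  refine norm_integral_le_of_norm_le integrable_disk (Filter.Eventually.of_forall fun x => ?_)
  rw [norm_mul]
  have h1 : ‖Real.cos (inner ℝ k x)‖ ≤ 1 := Real.abs_cos_le_one _
  have h2 : ‖(Metric.closedBall (0 : Plane) 1).indicator (fun _ => (1 : ℝ)) x‖ =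
      (Metric.closedBall (0 : Plane) 1).indicator (fun _ => (1 : ℝ)) x :=
    abs_of_nonneg (Set.indicator_nonneg (fun _ _ => zero_le_one) _)
  rw [h2]
  have := Set.indicator_nonneg (s := Metric.closedBall (0 : Plane) 1) (f := fun _ => (1 : ℝ))
    (fun _ _ => zero_le_one) x
  nlinarith

/-- Integrating the cosine along a vertical chord gives at most 2/|k₁|, and the chords fill an
interval of length 2. Decay in this one coordinate suffices for the lattice sum. -/
theorem abs_diskHat_le_div {k : Plane} (hk : k 1 ≠ 0) : |diskHat k| ≤ 4 / |k 1| := by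
  rw [diskHat, fourier_eq_integral_cos integrable_disk, integral_plane]
  have hint := (integrable_plane_iff _).mpr (integrable_mul_cos integrable_disk k)
  rw [Measure.volume_eq_prod] at hint ⊢
  rw [integral_prod _ hint, ← Real.norm_eq_abs]
  have hb : ∫ a, (Set.Icc (-1 : ℝ) 1).indicator (fun _ => 2 / |k 1|) a = 4 / |k 1| := by
    rw [integral_indicator measurableSet_Icc]
    simp
    norm_num
    ring
  rw [← hb]
  refine norm_integral_le_of_norm_le ?_ (Filter.Eventually.of_forall fun a => ?_)
  · exact (integrable_indicator_iff measurableSet_Icc).mpr (integrableOn_const (by simp))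
  by_cases ha : a ∈ Set.Icc (-1 : ℝ) 1
  · rw [Set.indicator_of_mem ha]
    have ha2 : 0 ≤ 1 - a ^ 2 := by nlinarith [ha.1, ha.2]
    set s := Real.sqrt (1 - a ^ 2) with hs
    have hs0 : 0 ≤ s := Real.sqrt_nonneg _
    have hmem : ∀ b, (!₂[a, b] : Plane) ∈ Metric.closedBall (0 : Plane) 1 ↔ b ∈ Set.Icc (-s) s := by
      intro b
      rw [mem_closedBall_zero_iff, ← sq_le_sq₀ (norm_nonneg _) zero_le_one, norm_sq_plane,
        Set.mem_Icc, ← abs_le, ← sq_le_sq₀ (abs_nonneg _) hs0, sq_abs, hs, Real.sq_sqrt ha2]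
      constructor <;> intro h <;> linarith
    have e : (fun b => (Metric.closedBall (0 : Plane) 1).indicator (fun _ => (1 : ℝ)) (!₂[a, b]) *
        Real.cos (inner ℝ k (!₂[a, b] : Plane)))
        = (Set.Icc (-s) s).indicator fun b => Real.cos (k 1 * b + k 0 * a) := by
      funext b
      simp only [Set.indicator, hmem, inner_plane]
      split_ifs <;> simp [add_comm]
    rw [e, integral_indicator measurableSet_Icc, integral_Icc_eq_integral_Ioc,
      ← intervalIntegral.integral_of_le (by linarith),
      intervalIntegral.integral_comp_mul_add (fun x => Real.cos x) hk, integral_cos, smul_eq_mul,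
      Real.norm_eq_abs, abs_mul, abs_inv, inv_mul_eq_div]
    gcongr
    refine (abs_sub _ _).trans ?_
    have h1 := Real.abs_sin_le_one (k 1 * s + k 0 * a)
    have h2 := Real.abs_sin_le_one (k 1 * -s + k 0 * a)
    linarith
  · rw [Set.indicator_of_notMem ha]
    have e : ∀ b, (Metric.closedBall (0 : Plane) 1).indicator (fun _ => (1 : ℝ)) (!₂[a, b]) = 0 := by
      intro b
      refine Set.indicator_of_notMem (fun hmem => ha ?_) _
      rw [mem_closedBall_zero_iff, ← sq_le_sq₀ (norm_nonneg _) zero_le_one, norm_sq_plane] at hmem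
      rw [Set.mem_Icc, ← abs_le, ← sq_le_sq₀ (abs_nonneg _) zero_le_one, sq_abs]
      nlinarith
    simp [e]

theorem omegaHat_eq (V : Plane → ℝ) (α : ℝ) (N : ℕ) (k : Lat) :
    omegaHat V α N k = gN V α N * diskHat (((N : ℝ) ^ α)⁻¹ • mom k) := rfl

/-! ### A logarithmically divergent lattice sum -/

theorem summable_and_tsum_int_le_of_even {f : ℤ → ℝ} {B : ℝ} (h0 : ∀ n, 0 ≤ f n)
    (he : ∀ n, f (-n) = f n) (hB : ∀ M : ℕ, ∑ i ∈ Finset.range M, f ((i : ℤ) + 1) ≤ B) :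
    Summable f ∧ ∑' n, f n ≤ f 0 + 2 * B := by
  have h1 : Summable fun i : ℕ => f ((i : ℤ) + 1) := summable_of_sum_range_le (fun _ => h0 _) hB
  have h1' : ∑' i : ℕ, f ((i : ℤ) + 1) ≤ B := h1.tsum_le_of_sum_range_le hB
  have h2 : Summable fun i : ℕ => f (i : ℤ) := by
    rw [← summable_nat_add_iff 1]
    simpa using h1
  have h3 : (fun i : ℕ => f (-((i : ℤ) + 1))) = fun i : ℕ => f ((i : ℤ) + 1) := by
    funext i; rw [he]
  refine ⟨Summable.of_nat_of_neg_add_one h2 (by rw [h3]; exact h1), ?_⟩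
  rw [tsum_of_nat_of_neg_add_one h2 (by rw [h3]; exact h1), h3, h2.tsum_eq_zero_add]
  push_cast
  linarith

/-- Comparison with the arctangent integral. The constant π/2 is the sharp one, as the cancellation
in the lower bound requires. -/
theorem sum_range_inv_sq_add_sq_le {n : ℝ} (hn : 0 < n) (M : ℕ) :
    ∑ i ∈ Finset.range M, (((i : ℝ) + 1) ^ 2 + n ^ 2)⁻¹ ≤ Real.pi / (2 * n) := by
  have hanti : AntitoneOn (fun x : ℝ => (x ^ 2 + n ^ 2)⁻¹) (Set.Icc 0 (0 + (M : ℝ))) := by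
    intro x hx y hy hxy
    have := hx.1
    simp only
    gcongr
  have h := hanti.sum_le_integral
  have e : ∫ x in (0 : ℝ)..(0 + M), (x ^ 2 + n ^ 2)⁻¹ = n⁻¹ * Real.arctan (M / n) := by
    have e1 : (fun x : ℝ => (x ^ 2 + n ^ 2)⁻¹) = fun x => (n ^ 2)⁻¹ * (1 + (x / n) ^ 2)⁻¹ := by
      funext x
      rw [← mul_inv]
      congr 1
      field_simp
      ring
    rw [e1, intervalIntegral.integral_const_mul,
      intervalIntegral.integral_comp_div (fun u => (1 + u ^ 2)⁻¹) hn.ne', integral_inv_one_add_sq]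
    simp
    field_simp
  rw [e] at h
  have h2 := (Real.arctan_lt_pi_div_two (M / n)).le
  calc _ ≤ n⁻¹ * Real.arctan (M / n) := by
        refine le_trans (le_of_eq ?_) h
        refine Finset.sum_congr rfl fun i _ => ?_
        push_cast
        rw [zero_add]
    _ ≤ n⁻¹ * (Real.pi / 2) := by gcongr
    _ = _ := by field_simp

theorem sum_range_inv_sq_le (M : ℕ) :
    ∑ i ∈ Finset.range M, (((i : ℝ) + 1) ^ 2)⁻¹ ≤ 2 := by
  have h := sum_Ioo_inv_sq_le (α := ℝ) 0 (M + 1)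
  have e : ∑ i ∈ Finset.Ioo 0 (M + 1), ((i : ℝ) ^ 2)⁻¹
      = ∑ i ∈ Finset.range M, (((i : ℝ) + 1) ^ 2)⁻¹ := by
    have : Finset.Ioo 0 (M + 1) = Finset.Ico (0 + 1) (M + 1) := rfl
    rw [this, ← Finset.sum_Ico_add' (fun i : ℕ => ((i : ℝ) ^ 2)⁻¹) 0 M 1, Finset.range_eq_Ico]
    refine Finset.sum_congr rfl fun i _ => ?_
    push_cast; rfl
  rw [e] at h
  simpa using h

/-- The cutoff function `min(1, R²/n²)`. -/
def cutoff (R : ℝ) (n : ℤ) : ℝ := if |(n : ℝ)| ≤ R then 1 else R ^ 2 / (n : ℝ) ^ 2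

theorem cutoff_nonneg (R : ℝ) (n : ℤ) : 0 ≤ cutoff R n := by
  unfold cutoff; split_ifs <;> positivity

theorem cutoff_le_one {R : ℝ} (hR : 0 ≤ R) (n : ℤ) : cutoff R n ≤ 1 := by
  unfold cutoff
  split_ifs with h
  · exact le_rfl
  · rw [← sq_abs (n : ℝ)]
    refine div_le_one_of_le₀ ?_ (by positivity)
    push Not at h
    gcongr

/-- The harmonic sum up to R gives 1 + log R; beyond R the terms are at most R/n², whose sum is at
most 2. -/
theorem sum_range_cutoff_div_le {R : ℝ} (hR : 1 ≤ R) (M : ℕ) :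
    ∑ i ∈ Finset.range M, cutoff R ((i : ℤ) + 1) / ((i : ℝ) + 1) ≤ 3 + Real.log R := by
  set K := ⌊R⌋₊ with hK
  have hKR : (K : ℝ) ≤ R := Nat.floor_le (by linarith)
  have hRK : R < K + 1 := Nat.lt_floor_add_one R
  have hK1 : 1 ≤ K := Nat.le_floor (by simpa using hR)
  have hle : ∀ i : ℕ, cutoff R ((i : ℤ) + 1) / ((i : ℝ) + 1) ≤
      (if i < K then ((i : ℝ) + 1)⁻¹ else 0) +
        (if K ≤ i then R * (((i : ℝ) + 1) ^ 2)⁻¹ else 0) := by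
    intro i
    have hi : (0 : ℝ) < (i : ℝ) + 1 := by positivity
    rcases lt_or_ge i K with h | h
    · rw [if_pos h, if_neg (by omega), add_zero, div_eq_mul_inv]
      have := cutoff_le_one (R := R) (by linarith) ((i : ℤ) + 1)
      have hi' : 0 ≤ ((i : ℝ) + 1)⁻¹ := by positivity
      nlinarith
    · rw [if_neg (by omega), if_pos h, zero_add]
      have h1 : R < (i : ℝ) + 1 := by
        have : (K : ℝ) ≤ i := by exact_mod_cast h
        linarith
      unfold cutoff
      push_cast
      rw [if_neg (by rw [abs_of_pos hi]; linarith)]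
      rw [div_div, ← div_eq_mul_inv, div_le_div_iff₀ (by positivity) (by positivity)]
      have : R ^ 2 ≤ R * ((i : ℝ) + 1) := by nlinarith
      have h2 : 0 ≤ ((i : ℝ) + 1) ^ 2 := by positivity
      nlinarith
  refine (Finset.sum_le_sum fun i _ => hle i).trans ?_
  rw [Finset.sum_add_distrib, ← Finset.sum_filter, ← Finset.sum_filter]
  have hA : ∑ i ∈ Finset.range M with i < K, ((i : ℝ) + 1)⁻¹ ≤ 1 + Real.log R := by
    calc _ ≤ ∑ i ∈ Finset.range K, ((i : ℝ) + 1)⁻¹ := by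
          refine Finset.sum_le_sum_of_subset_of_nonneg (fun i hi => ?_)
            (fun _ _ _ => by positivity)
          exact Finset.mem_range.mpr (Finset.mem_filter.mp hi).2
      _ = (harmonic K : ℝ) := by
          rw [harmonic]; push_cast; rfl
      _ ≤ 1 + Real.log K := harmonic_le_one_add_log K
      _ ≤ 1 + Real.log R := by
          have : (0 : ℝ) < K := by exact_mod_cast hK1
          gcongr
  have hB : ∑ i ∈ Finset.range M with K ≤ i, R * (((i : ℝ) + 1) ^ 2)⁻¹ ≤ 2 := by
    rw [← Finset.mul_sum]
    have h := sum_Ioo_inv_sq_le (α := ℝ) K (M + 1)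
    have e : ∑ i ∈ Finset.Ioo K (M + 1), ((i : ℝ) ^ 2)⁻¹
        = ∑ i ∈ Finset.range M with K ≤ i, (((i : ℝ) + 1) ^ 2)⁻¹ := by
      have e1 : Finset.Ioo K (M + 1) = Finset.Ico (K + 1) (M + 1) := rfl
      rw [e1, ← Finset.sum_Ico_add' (fun i : ℕ => ((i : ℝ) ^ 2)⁻¹) K M 1]
      have e2 : (Finset.range M).filter (K ≤ ·) = Finset.Ico K M := by
        ext i; simp [and_comm]
      rw [e2]
      refine Finset.sum_congr rfl fun i _ => ?_
      push_cast; rfl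
    rw [← e]
    have hp : (0 : ℝ) < K + 1 := by positivity
    calc R * ∑ i ∈ Finset.Ioo K (M + 1), ((i : ℝ) ^ 2)⁻¹ ≤ (K + 1) * (2 / (K + 1)) := by
          gcongr
      _ = 2 := by field_simp
  linarith

/-- Each row n ≠ 0 sums to at most π/|n| + 1/n². The cut-off sum of π/|n| over both signs gives 2π
log R, with sharp leading constant; all else goes into the 30. -/
theorem lattice_sum_le {R : ℝ} (hR : 1 ≤ R) :
    Summable (fun y : ℤ × ℤ => cutoff R y.1 * ((y.2 : ℝ) ^ 2 + (y.1 : ℝ) ^ 2)⁻¹) ∧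
      ∑' y : ℤ × ℤ, cutoff R y.1 * ((y.2 : ℝ) ^ 2 + (y.1 : ℝ) ^ 2)⁻¹ ≤
        2 * Real.pi * Real.log R + 30 := by
  set a : ℤ × ℤ → ℝ := fun y => cutoff R y.1 * ((y.2 : ℝ) ^ 2 + (y.1 : ℝ) ^ 2)⁻¹ with ha
  set S : ℤ → ℝ := fun n => ∑' m : ℤ, ((m : ℝ) ^ 2 + (n : ℝ) ^ 2)⁻¹ with hS
  -- The convention 0⁻¹ = 0 removes the origin from this row.
  have hrow0 : Summable (fun m : ℤ => ((m : ℝ) ^ 2 + ((0 : ℤ) : ℝ) ^ 2)⁻¹) ∧ S 0 ≤ 4 := by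
    have := summable_and_tsum_int_le_of_even (B := 2)
      (f := fun m : ℤ => ((m : ℝ) ^ 2 + ((0 : ℤ) : ℝ) ^ 2)⁻¹) (fun _ => by positivity)
      (fun n => by simp) (fun M => by simpa using sum_range_inv_sq_le M)
    refine ⟨this.1, this.2.trans ?_⟩
    norm_num
  have hrow1 : ∀ n : ℤ, 0 < n → Summable (fun m : ℤ => ((m : ℝ) ^ 2 + (n : ℝ) ^ 2)⁻¹) ∧
      S n ≤ Real.pi / n + ((n : ℝ) ^ 2)⁻¹ := by
    intro n hn
    have hn' : (0 : ℝ) < n := by exact_mod_cast hn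
    have := summable_and_tsum_int_le_of_even (B := Real.pi / (2 * n))
      (f := fun m : ℤ => ((m : ℝ) ^ 2 + (n : ℝ) ^ 2)⁻¹) (fun _ => by positivity)
      (fun n => by simp) (fun M => by simpa using sum_range_inv_sq_add_sq_le hn' M)
    refine ⟨this.1, this.2.trans (le_of_eq ?_)⟩
    simp
    field_simp
    ring
  have hSeven : ∀ n, S (-n) = S n := by
    intro n; simp [hS]
  have hS0 : ∀ n, 0 ≤ S n := fun n => tsum_nonneg fun m => by positivity
  have hrow : ∀ n : ℤ, Summable (fun m : ℤ => ((m : ℝ) ^ 2 + (n : ℝ) ^ 2)⁻¹) := by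
    intro n
    rcases lt_trichotomy n 0 with h | h | h
    · simpa using (hrow1 (-n) (by omega)).1
    · subst h; exact hrow0.1
    · exact (hrow1 n h).1
  have hcol := summable_and_tsum_int_le_of_even (f := fun n => cutoff R n * S n)
    (B := Real.pi * (3 + Real.log R) + 2) (fun n => mul_nonneg (cutoff_nonneg R n) (hS0 n))
    (fun n => by simp only [hSeven]; simp [cutoff]) (fun M => by
      calc ∑ i ∈ Finset.range M, cutoff R ((i : ℤ) + 1) * S ((i : ℤ) + 1)
          ≤ ∑ i ∈ Finset.range M, (Real.pi * (cutoff R ((i : ℤ) + 1) / ((i : ℝ) + 1)) +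
              (((i : ℝ) + 1) ^ 2)⁻¹) := by
            refine Finset.sum_le_sum fun i _ => ?_
            have h1 := (hrow1 ((i : ℤ) + 1) (by positivity)).2
            have h2 := cutoff_le_one (R := R) (by linarith) ((i : ℤ) + 1)
            have h3 := cutoff_nonneg R ((i : ℤ) + 1)
            push_cast at h1
            calc _ ≤ cutoff R ((i : ℤ) + 1) * (Real.pi / ((i : ℝ) + 1) + (((i : ℝ) + 1) ^ 2)⁻¹) := by
                  gcongr
              _ ≤ Real.pi * (cutoff R ((i : ℤ) + 1) / ((i : ℝ) + 1)) + 1 * (((i : ℝ) + 1) ^ 2)⁻¹ := by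
                  rw [mul_add]
                  refine add_le_add (le_of_eq (by ring)) ?_
                  gcongr
              _ = _ := by rw [one_mul]
        _ ≤ _ := by
            rw [Finset.sum_add_distrib, ← Finset.mul_sum]
            exact add_le_add (mul_le_mul_of_nonneg_left (sum_range_cutoff_div_le hR M)
              Real.pi_pos.le) (sum_range_inv_sq_le M))
  have has : Summable a := by
    rw [summable_prod_of_nonneg fun y => mul_nonneg (cutoff_nonneg R _) (by positivity)]
    refine ⟨fun n => Summable.mul_left (cutoff R n) (hrow n), ?_⟩
    simp only [tsum_mul_left]
    exact hcol.1
  refine ⟨has, ?_⟩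
  rw [has.tsum_prod]
  simp only [ha, tsum_mul_left]
  refine hcol.2.trans ?_
  have h1 : cutoff R 0 = 1 := by
    unfold cutoff
    rw [if_pos]
    simp
    linarith
  rw [h1, one_mul]
  have := hrow0.2
  have := Real.pi_lt_d2
  linarith

/-- Here 1/4 = π²/(4π²): π is the maximum of the disk transform and 4π² comes from p = 2πk. The
estimate beyond the cutoff may be crude, since that region contributes only to the additive
constant. -/
theorem diskHat_sum {R : ℝ} (hR : 1 ≤ R) :
    Summable (fun p : Mode => diskHat (R⁻¹ • mom p.1) ^ 2 / ‖mom p.1‖ ^ 2) ∧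
      ∑' p : Mode, diskHat (R⁻¹ • mom p.1) ^ 2 / ‖mom p.1‖ ^ 2 ≤
        1 / 4 * (2 * Real.pi * Real.log R + 30) := by
  obtain ⟨hs, hle⟩ := lattice_sum_le hR
  have hinj : Function.Injective fun t : Mode => ((t.1 1, t.1 0) : ℤ × ℤ) := by
    intro s t hst
    simp only [Prod.mk.injEq] at hst
    refine Subtype.ext (funext fun i => ?_)
    fin_cases i
    · exact hst.2
    · exact hst.1
  have hs' := (hs.comp_injective hinj).mul_left (1 / 4)
  have hR0 : 0 < R := by linarith
  have hterm : ∀ p : Mode, diskHat (R⁻¹ • mom p.1) ^ 2 / ‖mom p.1‖ ^ 2 ≤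
      1 / 4 * (cutoff R (p.1 1) * ((p.1 0 : ℝ) ^ 2 + (p.1 1 : ℝ) ^ 2)⁻¹) := by
    intro p
    have hpi := Real.pi_pos
    have h1 : diskHat (R⁻¹ • mom p.1) ^ 2 ≤ Real.pi ^ 2 * cutoff R (p.1 1) := by
      rw [← sq_abs]
      unfold cutoff
      split_ifs with h
      · rw [mul_one]
        gcongr
        exact abs_diskHat_le_pi _
      · push Not at h
        have hn : (p.1 1 : ℝ) ≠ 0 := by
          intro h0
          rw [h0, abs_zero] at h
          linarith
        have hk : (R⁻¹ • mom p.1) 1 = R⁻¹ * (2 * Real.pi * p.1 1) := by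
          rw [PiLp.smul_apply, mom_apply, smul_eq_mul]
        have h2 := abs_diskHat_le_div (k := R⁻¹ • mom p.1) (by rw [hk]; positivity)
        calc |diskHat (R⁻¹ • mom p.1)| ^ 2 ≤ (4 / |(R⁻¹ • mom p.1) 1|) ^ 2 := by gcongr
          _ = (4 / Real.pi ^ 2) * (R ^ 2 / (p.1 1 : ℝ) ^ 2) := by
              rw [hk, div_pow, sq_abs]
              field_simp
              norm_num
          _ ≤ Real.pi ^ 2 * (R ^ 2 / (p.1 1 : ℝ) ^ 2) := by
              gcongr
              rw [div_le_iff₀ (by positivity)]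
              have := Real.pi_gt_three
              have h9 : 9 ≤ Real.pi ^ 2 := by nlinarith
              nlinarith
    rw [norm_mom_sq]
    have h3 : 0 < (p.1 0 : ℝ) ^ 2 + (p.1 1 : ℝ) ^ 2 := by
      have h4 := norm_mom_pos p
      have h5 := norm_mom_sq p.1
      have h6 : 0 < ‖mom p.1‖ ^ 2 := by positivity
      rw [h5] at h6
      exact pos_of_mul_pos_right h6 (by positivity)
    rw [div_le_iff₀ (by positivity)]
    refine h1.trans (le_of_eq ?_)
    field_simp
  have hsum := Summable.of_nonneg_of_le (fun p : Mode => by positivity) hterm hs'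
  refine ⟨hsum, (hsum.tsum_le_tsum hterm hs').trans ?_⟩
  rw [tsum_mul_left]
  gcongr
  refine (tsum_comp_le_tsum_of_inj hs (fun y => ?_) hinj).trans hle
  exact mul_nonneg (cutoff_nonneg R _) (by positivity)

/-! ### A one-dimensional Hardy type inequality -/

/-- The supersolution `B + log r - r²/(2R²)`. -/
def superSol (B R r : ℝ) : ℝ := B + Real.log r - r ^ 2 / (2 * R ^ 2)

/-- Integrate the derivative of -l r² h² and complete the square in h' + l r h; the remainder l(1 -
l r²)h² is non-negative for r ≤ s. No supersolution is needed near the origin. -/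
theorem inner_ray_le {h h' : ℝ → ℝ} (hh : ∀ r, HasDerivAt h (h' r) r) (hc : Continuous h')
    {l s : ℝ} (hs : 0 < s) (hl : 0 ≤ l) (hls : l * s ^ 2 ≤ 1) :
    l * ∫ r in (0 : ℝ)..s, r * h r ^ 2 ≤
      (∫ r in (0 : ℝ)..s, r * h' r ^ 2) + l * s ^ 2 * h s ^ 2 := by
  have hcont : Continuous h := continuous_iff_continuousAt.mpr fun r => (hh r).continuousAt
  have hd : ∀ r ∈ Set.uIcc 0 s, HasDerivAt (fun r => h r ^ 2 * (-l * r ^ 2))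
      (2 * h r * h' r * (-l * r ^ 2) + h r ^ 2 * (-l * (2 * r))) r := by
    intro r _
    have h1 := (hh r).pow 2
    have h2 := ((hasDerivAt_pow 2 r).const_mul (-l))
    refine (h1.mul h2).congr_deriv ?_
    simp
  have hi := intervalIntegral.integral_eq_sub_of_hasDerivAt hd
    (by apply Continuous.intervalIntegrable; fun_prop)
  have hmono : ∫ r in (0 : ℝ)..s, (2 * h r * h' r * (-l * r ^ 2) + h r ^ 2 * (-l * (2 * r))
      + l * (r * h r ^ 2)) ≤ ∫ r in (0 : ℝ)..s, r * h' r ^ 2 := by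
    refine intervalIntegral.integral_mono_on hs.le (by apply Continuous.intervalIntegrable; fun_prop)
      (by apply Continuous.intervalIntegrable; fun_prop) fun r hr => ?_
    have hr0 := hr.1
    have hlr : l * r ^ 2 ≤ 1 := by
      refine le_trans ?_ hls
      gcongr
      exact hr.2
    have h1 : 0 ≤ r * ((h' r + l * r * h r) ^ 2 + l * (1 - l * r ^ 2) * h r ^ 2) := by
      have : 0 ≤ l * (1 - l * r ^ 2) := mul_nonneg hl (by linarith)
      positivity
    nlinarith
  rw [intervalIntegral.integral_add (by apply Continuous.intervalIntegrable; fun_prop)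
    (by apply Continuous.intervalIntegrable; fun_prop), hi,
    intervalIntegral.integral_const_mul] at hmono
  simp only [ne_eq, OfNat.ofNat_ne_zero, not_false_eq_true, zero_pow, mul_zero, sub_zero] at hmono
  linarith

/-- The function f = B + log r - r²/(2R²) satisfies -Δf = 2/R² ≥ l f, because f ≤ B + log R.
Completing the square with its logarithmic derivative leaves a boundary term only at s, since f'
vanishes at R. -/
theorem outer_ray_le {h h' : ℝ → ℝ} (hh : ∀ r, HasDerivAt h (h' r) r) (hc : Continuous h')
    {B s R : ℝ} (hs : 0 < s) (hsR : s ≤ R) (hB : 1 / 2 < B + Real.log s) :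
    2 / (R ^ 2 * (B + Real.log R)) * ∫ r in s..R, r * h r ^ 2 ≤
      (∫ r in s..R, r * h' r ^ 2) + (B + Real.log s - 1 / 2)⁻¹ * h s ^ 2 := by
  have hcont : Continuous h := continuous_iff_continuousAt.mpr fun r => (hh r).continuousAt
  have hR : 0 < R := hs.trans_le hsR
  set f := superSol B R with hf
  -- This is r f'/f, so the equation for f becomes the Riccati equation G' = -2r/(R² f) - G²/r.
  set G : ℝ → ℝ := fun r => (1 - r ^ 2 / R ^ 2) / f r with hG
  set l := 2 / (R ^ 2 * (B + Real.log R)) with hl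
  have hfs : ∀ r ∈ Set.Icc s R, B + Real.log s - 1 / 2 ≤ f r := by
    intro r hr
    have h1 : Real.log s ≤ Real.log r := Real.log_le_log hs hr.1
    have h2 : r ^ 2 / (2 * R ^ 2) ≤ 1 / 2 := by
      rw [div_le_iff₀ (by positivity)]
      have : r ^ 2 ≤ R ^ 2 := by
        have := hr.2
        have : 0 ≤ r := hs.le.trans hr.1
        gcongr
      linarith
    simp only [hf, superSol]
    linarith
  have hfpos : ∀ r ∈ Set.Icc s R, 0 < f r := fun r hr => lt_of_lt_of_le (by linarith) (hfs r hr)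
  have hfd : ∀ r ∈ Set.Icc s R, HasDerivAt f ((1 - r ^ 2 / R ^ 2) / r) r := by
    intro r hr
    have hr0 : r ≠ 0 := (hs.trans_le hr.1).ne'
    have h1 := ((Real.hasDerivAt_log hr0).const_add B).sub
      ((hasDerivAt_pow 2 r).div_const (2 * R ^ 2))
    refine h1.congr_deriv ?_
    simp
    field_simp
  have hGd : ∀ r ∈ Set.Icc s R, HasDerivAt G (-(2 * r / (R ^ 2 * f r)) - G r ^ 2 / r) r := by
    intro r hr
    have hr0 : r ≠ 0 := (hs.trans_le hr.1).ne'
    have hf0 := (hfpos r hr).ne'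
    have h1 := (((hasDerivAt_pow 2 r).div_const (R ^ 2)).const_sub 1).div (hfd r hr) hf0
    refine h1.congr_deriv ?_
    simp only [hG]
    simp
    field_simp
  have hfc : ContinuousOn f (Set.Icc s R) := fun r hr => (hfd r hr).continuousAt.continuousWithinAt
  have hGc : ContinuousOn G (Set.Icc s R) := fun r hr => (hGd r hr).continuousAt.continuousWithinAt
  have hd : ∀ r ∈ Set.uIcc s R, HasDerivAt (fun r => h r ^ 2 * G r)
      (2 * h r * h' r * G r + h r ^ 2 * (-(2 * r / (R ^ 2 * f r)) - G r ^ 2 / r)) r := by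
    intro r hr
    rw [Set.uIcc_of_le hsR] at hr
    have h1 := (hh r).pow 2
    refine (h1.mul (hGd r hr)).congr_deriv ?_
    simp
  have hci : IntervalIntegrable (fun r =>
      2 * h r * h' r * G r + h r ^ 2 * (-(2 * r / (R ^ 2 * f r)) - G r ^ 2 / r)) volume s R := by
    apply ContinuousOn.intervalIntegrable
    rw [Set.uIcc_of_le hsR]
    have e1 : ∀ r ∈ Set.Icc s R, R ^ 2 * f r ≠ 0 := fun r hr =>
      mul_ne_zero (by positivity) (hfpos r hr).ne'
    have e2 : ∀ r ∈ Set.Icc s R, r ≠ 0 := fun r hr => (hs.trans_le hr.1).ne'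
    have e3 : ContinuousOn (fun r => 2 * r / (R ^ 2 * f r)) (Set.Icc s R) :=
      ContinuousOn.div (by fun_prop) (by fun_prop) e1
    have e4 : ContinuousOn (fun r => G r ^ 2 / r) (Set.Icc s R) :=
      ContinuousOn.div (by fun_prop) (by fun_prop) e2
    fun_prop
  have hi := intervalIntegral.integral_eq_sub_of_hasDerivAt hd hci
  have hmono : ∫ r in s..R, (2 * h r * h' r * G r + h r ^ 2 * (-(2 * r / (R ^ 2 * f r))
      - G r ^ 2 / r) + l * (r * h r ^ 2)) ≤ ∫ r in s..R, r * h' r ^ 2 := by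
    refine intervalIntegral.integral_mono_on hsR
      (hci.add (by apply Continuous.intervalIntegrable; fun_prop))
      (by apply Continuous.intervalIntegrable; fun_prop) fun r hr => ?_
    have hr0 : 0 < r := hs.trans_le hr.1
    have hf0 := hfpos r hr
    have hfle : f r ≤ B + Real.log R := by
      have h1 : Real.log r ≤ Real.log R := Real.log_le_log hr0 hr.2
      have h2 : 0 ≤ r ^ 2 / (2 * R ^ 2) := by positivity
      simp only [hf, superSol]
      linarith
    have hl2 : l ≤ 2 / (R ^ 2 * f r) := by
      simp only [hl]
      gcongr
    have h1 : 0 ≤ (r * h' r - h r * G r) ^ 2 / r := by positivity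
    have h2 : (r * h' r - h r * G r) ^ 2 / r =
        r * h' r ^ 2 - 2 * h r * h' r * G r + h r ^ 2 * (G r ^ 2 / r) := by
      field_simp
      ring
    have h3 : l * (r * h r ^ 2) ≤ h r ^ 2 * (2 * r / (R ^ 2 * f r)) := by
      calc l * (r * h r ^ 2) ≤ 2 / (R ^ 2 * f r) * (r * h r ^ 2) := by gcongr
        _ = _ := by ring
    linarith
  rw [intervalIntegral.integral_add hci (by apply Continuous.intervalIntegrable; fun_prop), hi,
    intervalIntegral.integral_const_mul] at hmono
  -- The supersolution satisfies the Neumann condition at R, so no boundary condition on h is used.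
  have hGR : G R = 0 := by
    simp only [hG]
    rw [div_self (by positivity), sub_self, zero_div]
  have hGs : G s ≤ (B + Real.log s - 1 / 2)⁻¹ := by
    simp only [hG]
    have h1 := hfs s ⟨le_rfl, hsR⟩
    have h2 : 0 < B + Real.log s - 1 / 2 := by linarith
    rw [div_eq_mul_inv]
    have h3 : (f s)⁻¹ ≤ (B + Real.log s - 1 / 2)⁻¹ := inv_anti₀ h2 h1
    have h4 : 1 - s ^ 2 / R ^ 2 ≤ 1 := by
      have : 0 ≤ s ^ 2 / R ^ 2 := by positivity
      linarith
    have h5 : 0 ≤ (f s)⁻¹ := inv_nonneg.mpr (hfpos s ⟨le_rfl, hsR⟩).le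
    nlinarith
  rw [hGR, mul_zero, zero_sub] at hmono
  have : h s ^ 2 * G s ≤ (B + Real.log s - 1 / 2)⁻¹ * h s ^ 2 := by
    rw [mul_comm]
    gcongr
  linarith

theorem ray_le {h h' : ℝ → ℝ} (hh : ∀ r, HasDerivAt h (h' r) r) (hc : Continuous h')
    {B s R κ : ℝ} (hs : 0 < s) (hsR : s ≤ R) (hB : 1 / 2 < B + Real.log s)
    (hl : 2 / (R ^ 2 * (B + Real.log R)) * s ^ 2 ≤ 1)
    (hκ : 2 / (R ^ 2 * (B + Real.log R)) * s ^ 2 + (B + Real.log s - 1 / 2)⁻¹ ≤ κ) :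
    2 / (R ^ 2 * (B + Real.log R)) * ∫ r in (0 : ℝ)..R, r * h r ^ 2 ≤
      (∫ r in (0 : ℝ)..R, r * h' r ^ 2) + κ * h s ^ 2 := by
  have hcont : Continuous h := continuous_iff_continuousAt.mpr fun r => (hh r).continuousAt
  have hlog : Real.log s ≤ Real.log R := Real.log_le_log hs hsR
  have hl0 : 0 ≤ 2 / (R ^ 2 * (B + Real.log R)) := by
    have : 0 ≤ B + Real.log R := by linarith
    positivity
  have h1 := inner_ray_le hh hc hs hl0 hl
  have h2 := outer_ray_le hh hc hs hsR hB
  rw [← intervalIntegral.integral_add_adjacent_intervals (a := 0) (b := s) (c := R)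
    (f := fun r => r * h r ^ 2) (by apply Continuous.intervalIntegrable; fun_prop)
    (by apply Continuous.intervalIntegrable; fun_prop),
    ← intervalIntegral.integral_add_adjacent_intervals (a := 0) (b := s) (c := R)
    (f := fun r => r * h' r ^ 2) (by apply Continuous.intervalIntegrable; fun_prop)
    (by apply Continuous.intervalIntegrable; fun_prop)]
  nlinarith [sq_nonneg (h s)]

/-! ### Polar coordinates and rotations -/

/-- The unit vector in the direction `θ`. -/
def dirVec (θ : ℝ) : Plane := !₂[Real.cos θ, Real.sin θ]

theorem norm_dirVec (θ : ℝ) : ‖dirVec θ‖ = 1 := by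
  rw [← sq_eq_sq₀ (norm_nonneg _) zero_le_one, dirVec, norm_sq_plane, Real.cos_sq_add_sin_sq,
    one_pow]

theorem smul_dirVec (r θ : ℝ) : r • dirVec θ = !₂[r * Real.cos θ, r * Real.sin θ] := by
  ext i
  fin_cases i <;> simp [dirVec]

theorem continuous_dirVec : Continuous dirVec := by
  have h : Continuous fun θ : ℝ => (![Real.cos θ, Real.sin θ] : Fin 2 → ℝ) := by fun_prop
  exact (PiLp.continuous_toLp 2 _).comp h

theorem integral_ball_polar {F : Plane → ℝ} (hF : Continuous F) {R : ℝ} (hR : 0 < R) :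
    ∫ x in Metric.ball (0 : Plane) R, F x =
      ∫ θ in (-Real.pi)..Real.pi, ∫ r in (0 : ℝ)..R, r * F (r • dirVec θ) := by
  have hpi : -Real.pi ≤ Real.pi := by linarith [Real.pi_pos]
  rw [← integral_indicator measurableSet_ball, integral_plane, ← integral_comp_polarCoord_symm,
    polarCoord_target]
  have hc : Continuous fun p : ℝ × ℝ => p.1 * F (p.1 • dirVec p.2) := by
    have := continuous_dirVec
    fun_prop
  have e1 : ∫ p in Set.Ioi (0 : ℝ) ×ˢ Set.Ioo (-Real.pi) Real.pi,
      p.1 • (Metric.ball (0 : Plane) R).indicator F (!₂[(polarCoord.symm p).1, (polarCoord.symm p).2])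
      = ∫ p in Set.Ioo (0 : ℝ) R ×ˢ Set.Ioo (-Real.pi) Real.pi, p.1 * F (p.1 • dirVec p.2) := by
    rw [← integral_indicator (measurableSet_Ioi.prod measurableSet_Ioo),
      ← integral_indicator (measurableSet_Ioo.prod measurableSet_Ioo)]
    congr 1
    funext p
    by_cases hp : p ∈ Set.Ioi (0 : ℝ) ×ˢ Set.Ioo (-Real.pi) Real.pi
    · rw [Set.indicator_of_mem hp]
      have hp0 : 0 < p.1 := hp.1
      have hv : (!₂[(polarCoord.symm p).1, (polarCoord.symm p).2] : Plane) = p.1 • dirVec p.2 := by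
        rw [smul_dirVec, polarCoord_symm_apply]
      rw [hv]
      have hn : p.1 • dirVec p.2 ∈ Metric.ball (0 : Plane) R ↔ p.1 < R := by
        rw [mem_ball_zero_iff, norm_smul, norm_dirVec, mul_one, Real.norm_eq_abs, abs_of_pos hp0]
      by_cases hlt : p.1 < R
      · rw [Set.indicator_of_mem (hn.mpr hlt), Set.indicator_of_mem
          (show p ∈ Set.Ioo (0 : ℝ) R ×ˢ Set.Ioo (-Real.pi) Real.pi from ⟨⟨hp0, hlt⟩, hp.2⟩),
          smul_eq_mul]
      · rw [Set.indicator_of_notMem (fun h => hlt (hn.mp h)),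
          Set.indicator_of_notMem (fun h => hlt h.1.2), smul_zero]
    · rw [Set.indicator_of_notMem hp, Set.indicator_of_notMem]
      exact fun h => hp ⟨h.1.1, h.2⟩
  rw [e1]
  have hi : IntegrableOn (fun p : ℝ × ℝ => p.1 * F (p.1 • dirVec p.2))
      (Set.Ioo (0 : ℝ) R ×ˢ Set.Ioo (-Real.pi) Real.pi) :=
    (hc.continuousOn.integrableOn_compact (isCompact_Icc.prod isCompact_Icc)).mono_set
      (Set.prod_mono Set.Ioo_subset_Icc_self Set.Ioo_subset_Icc_self)
  rw [Measure.volume_eq_prod] at hi ⊢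
  rw [IntegrableOn, ← Measure.prod_restrict] at hi
  rw [← Measure.prod_restrict, integral_prod_symm _ hi, ← integral_Ioc_eq_integral_Ioo,
    ← intervalIntegral.integral_of_le hpi]
  congr 1
  funext θ
  rw [← integral_Ioc_eq_integral_Ioo, ← intervalIntegral.integral_of_le hR.le]

/-- The rotation by the angle `θ`. -/
def rot (θ : ℝ) : Plane ≃ₗᵢ[ℝ] Plane :=
  LinearIsometry.toLinearIsometryEquiv
    { toFun := fun x => !₂[Real.cos θ * x 0 - Real.sin θ * x 1, Real.sin θ * x 0 + Real.cos θ * x 1]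
      map_add' := by
        intro x y
        ext i
        fin_cases i <;> simp <;> ring
      map_smul' := by
        intro c x
        ext i
        fin_cases i <;> simp <;> ring
      norm_map' := by
        intro x
        rw [← sq_eq_sq₀ (norm_nonneg _) (norm_nonneg _)]
        change ‖(!₂[Real.cos θ * x 0 - Real.sin θ * x 1,
          Real.sin θ * x 0 + Real.cos θ * x 1] : Plane)‖ ^ 2 = ‖x‖ ^ 2
        rw [norm_sq_plane, EuclideanSpace.norm_sq_eq, Fin.sum_univ_two, Real.norm_eq_abs,
          Real.norm_eq_abs, sq_abs, sq_abs]
        linear_combination (x 0 ^ 2 + x 1 ^ 2) * Real.sin_sq_add_cos_sq θ }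
    rfl

theorem rot_apply (θ : ℝ) (x : Plane) :
    rot θ x = !₂[Real.cos θ * x 0 - Real.sin θ * x 1, Real.sin θ * x 0 + Real.cos θ * x 1] := rfl

theorem continuous_rot : Continuous fun p : Plane × ℝ => rot p.2 p.1 := by
  have h : Continuous fun p : Plane × ℝ => (![Real.cos p.2 * p.1 0 - Real.sin p.2 * p.1 1,
    Real.sin p.2 * p.1 0 + Real.cos p.2 * p.1 1] : Fin 2 → ℝ) := by fun_prop
  exact (PiLp.continuous_toLp 2 _).comp h

theorem exists_eq_norm_smul_dirVec (x : Plane) : ∃ θ, x = ‖x‖ • dirVec θ := by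
  set z : ℂ := ⟨x 0, x 1⟩ with hz
  have hn : ‖x‖ = ‖z‖ := by
    rw [← sq_eq_sq₀ (norm_nonneg _) (norm_nonneg _), EuclideanSpace.norm_sq_eq, Fin.sum_univ_two,
      ← Complex.normSq_eq_norm_sq, Complex.normSq_apply, Real.norm_eq_abs, Real.norm_eq_abs,
      sq_abs, sq_abs]
    ring
  refine ⟨Complex.arg z, ?_⟩
  rw [smul_dirVec, hn, Complex.norm_mul_cos_arg, Complex.norm_mul_sin_arg]
  ext i
  fin_cases i <;> simp [hz]

theorem rot_smul_dirVec (θ r θ₀ : ℝ) : rot θ (r • dirVec θ₀) = r • dirVec (θ + θ₀) := by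
  rw [rot_apply, smul_dirVec, smul_dirVec, Real.cos_add, Real.sin_add]
  ext i
  fin_cases i <;> simp <;> ring

theorem integral_rot_eq (F : Plane → ℝ) (x : Plane) :
    ∫ θ in (-Real.pi)..Real.pi, F (rot θ x) =
      ∫ θ in (-Real.pi)..Real.pi, F (‖x‖ • dirVec θ) := by
  obtain ⟨θ₀, h⟩ := exists_eq_norm_smul_dirVec x
  have e : (fun θ => F (rot θ x)) = fun θ => F (‖x‖ • dirVec (θ + θ₀)) := by
    funext θ
    conv_lhs => rw [h]
    rw [rot_smul_dirVec]
  rw [e, intervalIntegral.integral_comp_add_right (fun θ => F (‖x‖ • dirVec θ))]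
  have hper : Function.Periodic (fun θ => F (‖x‖ • dirVec θ)) (2 * Real.pi) := by
    intro θ
    simp only [dirVec, Real.cos_add_two_pi, Real.sin_add_two_pi]
  have h2 := hper.intervalIntegral_add_eq (-Real.pi + θ₀) (-Real.pi)
  rw [show -Real.pi + θ₀ + 2 * Real.pi = Real.pi + θ₀ by ring,
    show -Real.pi + 2 * Real.pi = Real.pi by ring] at h2
  exact h2

theorem exists_bound_on_ball {F : Plane → ℝ} (hF : Continuous F) (R : ℝ) :
    ∃ C, ∀ x ∈ Metric.ball (0 : Plane) R, ‖F x‖ ≤ C := by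
  obtain ⟨C, hC⟩ := (isCompact_closedBall (0 : Plane) R).exists_bound_of_continuousOn
    hF.continuousOn
  exact ⟨C, fun x hx => hC x (Metric.ball_subset_closedBall hx)⟩

theorem integrableOn_ball_mul {V F : Plane → ℝ} (hV : Integrable V) (hF : Continuous F) (R : ℝ) :
    IntegrableOn (fun x => V x * F x) (Metric.ball 0 R) := by
  obtain ⟨C, hC⟩ := exists_bound_on_ball hF R
  exact hV.integrableOn.mul_bdd (c := C) hF.aestronglyMeasurable
    (ae_restrict_of_forall_mem measurableSet_ball hC)

theorem integrableOn_ball {F : Plane → ℝ} (hF : Continuous F) (R : ℝ) :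
    IntegrableOn F (Metric.ball 0 R) :=
  (hF.continuousOn.integrableOn_compact (isCompact_closedBall 0 R)).mono_set
    Metric.ball_subset_closedBall

/-- Averaging over rotations against a radial weight. -/
theorem two_pi_mul_integral_radial {V F : Plane → ℝ} (hV : Integrable V)
    (hrad : ∃ v : ℝ → ℝ, ∀ᵐ x, V x = v ‖x‖) (hF : Continuous F) (R : ℝ) :
    2 * Real.pi * ∫ x in Metric.ball (0 : Plane) R, V x * F x =
      ∫ x in Metric.ball (0 : Plane) R,
        V x * ∫ θ in (-Real.pi)..Real.pi, F (‖x‖ • dirVec θ) := by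
  have hpi : -Real.pi ≤ Real.pi := by linarith [Real.pi_pos]
  obtain ⟨v, hv⟩ := hrad
  have hrot : ∀ θ, ∫ x in Metric.ball (0 : Plane) R, V x * F (rot θ x) =
      ∫ x in Metric.ball (0 : Plane) R, V x * F x := by
    intro θ
    have hmp := (rot θ).measurePreserving
    rw [← integral_indicator measurableSet_ball, ← integral_indicator measurableSet_ball,
      ← hmp.integral_comp (rot θ).toHomeomorph.measurableEmbedding
        ((Metric.ball (0 : Plane) R).indicator fun x => V x * F x)]
    refine integral_congr_ae ?_
    filter_upwards [hv, hmp.quasiMeasurePreserving.ae hv] with x h1 h2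
    have hmem : rot θ x ∈ Metric.ball (0 : Plane) R ↔ x ∈ Metric.ball (0 : Plane) R := by
      rw [mem_ball_zero_iff, mem_ball_zero_iff, LinearIsometryEquiv.norm_map]
    have hVV : V (rot θ x) = V x := by rw [h1, h2, LinearIsometryEquiv.norm_map]
    by_cases hx : x ∈ Metric.ball (0 : Plane) R
    · rw [Set.indicator_of_mem hx, Set.indicator_of_mem (hmem.mpr hx), hVV]
    · rw [Set.indicator_of_notMem hx, Set.indicator_of_notMem (fun h => hx (hmem.mp h))]
  have h1 : ∫ θ in (-Real.pi)..Real.pi, ∫ x in Metric.ball (0 : Plane) R, V x * F (rot θ x) =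
      2 * Real.pi * ∫ x in Metric.ball (0 : Plane) R, V x * F x := by
    simp only [hrot]
    rw [intervalIntegral.integral_const, smul_eq_mul]
    ring
  have hint : Integrable (fun p : Plane × ℝ => V p.1 * F (rot p.2 p.1))
      ((volume.restrict (Metric.ball 0 R)).prod
        (volume.restrict (Set.Ioc (-Real.pi) Real.pi))) := by
    obtain ⟨C, hC⟩ := exists_bound_on_ball hF R
    have hb : Integrable (fun p : Plane × ℝ => V p.1)
        ((volume.restrict (Metric.ball 0 R)).prod
          (volume.restrict (Set.Ioc (-Real.pi) Real.pi))) := by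
      have h2 := (hV.integrableOn (s := Metric.ball 0 R)).mul_prod (f := V)
        (integrableOn_const (C := (1 : ℝ)) (s := Set.Ioc (-Real.pi) Real.pi) (μ := volume)
          (by simp))
      simpa using h2
    refine hb.mul_bdd (c := C) (hF.comp continuous_rot).aestronglyMeasurable ?_
    rw [Measure.prod_restrict]
    refine ae_restrict_of_forall_mem (measurableSet_ball.prod measurableSet_Ioc) fun p hp => ?_
    refine hC _ ?_
    rw [mem_ball_zero_iff, LinearIsometryEquiv.norm_map, ← mem_ball_zero_iff]
    exact hp.1
  rw [← h1, intervalIntegral.integral_of_le hpi, ← integral_integral_swap hint]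
  congr 1
  funext x
  rw [integral_const_mul, ← intervalIntegral.integral_of_le hpi, integral_rot_eq]

/-! ### The lower bound for the Neumann eigenvalue -/

/-- The ray inequality integrated over angles, with the radial derivative bounded by the full
gradient. The error is the mass of φ² on a single circle, which V can control. -/
theorem ball_le {φ : Plane → ℝ} (hφ : ContDiff ℝ 1 φ) {B s R κ : ℝ} (hs : 0 < s) (hsR : s ≤ R)
    (hB : 1 / 2 < B + Real.log s) (hl : 2 / (R ^ 2 * (B + Real.log R)) * s ^ 2 ≤ 1)
    (hκ : 2 / (R ^ 2 * (B + Real.log R)) * s ^ 2 + (B + Real.log s - 1 / 2)⁻¹ ≤ κ) :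
    2 / (R ^ 2 * (B + Real.log R)) * ∫ x in Metric.ball (0 : Plane) R, φ x ^ 2 ≤
      (∫ x in Metric.ball (0 : Plane) R, ‖fderiv ℝ φ x‖ ^ 2) +
        κ * ∫ θ in (-Real.pi)..Real.pi, φ (s • dirVec θ) ^ 2 := by
  have hpi : -Real.pi ≤ Real.pi := by linarith [Real.pi_pos]
  have hR : 0 < R := hs.trans_le hsR
  have hc : Continuous φ := hφ.continuous
  have hc' : Continuous (fderiv ℝ φ) := hφ.continuous_fderiv (by norm_num)
  have hdir := continuous_dirVec
  rw [integral_ball_polar (by fun_prop : Continuous fun x => φ x ^ 2) hR,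
    integral_ball_polar (by fun_prop : Continuous fun x => ‖fderiv ℝ φ x‖ ^ 2) hR,
    ← intervalIntegral.integral_const_mul, ← intervalIntegral.integral_const_mul]
  have hcont : ∀ F : Plane → ℝ, Continuous F →
      Continuous fun θ => ∫ r in (0 : ℝ)..R, r * F (r • dirVec θ) := by
    intro F hF
    apply intervalIntegral.continuous_parametric_intervalIntegral_of_continuous'
    fun_prop
  have c1 := hcont (fun x => φ x ^ 2) (by fun_prop)
  have c2 := hcont (fun x => ‖fderiv ℝ φ x‖ ^ 2) (by fun_prop)
  rw [← intervalIntegral.integral_add (c2.intervalIntegrable _ _)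
    (by apply Continuous.intervalIntegrable; fun_prop)]
  refine intervalIntegral.integral_mono_on hpi ((continuous_const.mul c1).intervalIntegrable _ _)
    ((c2.add (by fun_prop)).intervalIntegrable _ _) fun θ _ => ?_
  have hd : ∀ r : ℝ, HasDerivAt (fun r : ℝ => φ (r • dirVec θ))
      (fderiv ℝ φ (r • dirVec θ) (dirVec θ)) r := by
    intro r
    have h1 : HasDerivAt (fun r : ℝ => r • dirVec θ) (dirVec θ) r := by
      simpa using (hasDerivAt_id r).smul_const (dirVec θ)
    exact ((hφ.differentiable (by norm_num) _).hasFDerivAt).comp_hasDerivAt r h1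
  have h := ray_le hd (by fun_prop) hs hsR hB hl hκ
  refine h.trans (add_le_add ?_ le_rfl)
  refine intervalIntegral.integral_mono_on hR.le
    (by apply Continuous.intervalIntegrable; fun_prop)
    (by apply Continuous.intervalIntegrable; fun_prop) fun r hr => ?_
  refine mul_le_mul_of_nonneg_left ?_ hr.1
  rw [← sq_abs, ← Real.norm_eq_abs]
  have := (fderiv ℝ φ (r • dirVec θ)).le_opNorm (dirVec θ)
  rw [norm_dirVec, mul_one] at this
  gcongr

/-- The closed annuli 1/(n+1) ≤ |x| ≤ n+1 exhaust the punctured plane. A positive inner radius is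
needed to keep log s bounded below on the annulus. -/
theorem exists_annulus_integral_pos {V : Plane → ℝ} (hV : Integrable V) (h0 : ∀ᵐ x, 0 ≤ V x)
    (hne : ¬ ∀ᵐ x, V x = 0) :
    ∃ a b : ℝ, 0 < a ∧ a ≤ b ∧ 0 < ∫ x in {x : Plane | a ≤ ‖x‖ ∧ ‖x‖ ≤ b}, V x := by
  by_contra hcon
  push Not at hcon
  apply hne
  have hmeas : ∀ a b : ℝ, MeasurableSet {x : Plane | a ≤ ‖x‖ ∧ ‖x‖ ≤ b} := fun a b =>
    (measurableSet_le measurable_const measurable_norm).inter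
      (measurableSet_le measurable_norm measurable_const)
  have h1 : ∀ n : ℕ, ∀ᵐ x : Plane, ((n : ℝ) + 1)⁻¹ ≤ ‖x‖ ∧ ‖x‖ ≤ (n : ℝ) + 1 → V x = 0 := by
    intro n
    have hle : ((n : ℝ) + 1)⁻¹ ≤ (n : ℝ) + 1 := by
      have : (1 : ℝ) ≤ (n : ℝ) + 1 := by
        have : (0 : ℝ) ≤ n := Nat.cast_nonneg n
        linarith
      exact (inv_le_one_of_one_le₀ this).trans this
    have h2 := hcon _ _ (by positivity) hle
    have h3 : 0 ≤ᵐ[volume.restrict {x : Plane | ((n : ℝ) + 1)⁻¹ ≤ ‖x‖ ∧ ‖x‖ ≤ (n : ℝ) + 1}] V :=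
      ae_restrict_of_ae h0
    have h4 := (integral_eq_zero_iff_of_nonneg_ae h3 hV.integrableOn).mp
      (le_antisymm h2 (integral_nonneg_of_ae h3))
    exact (ae_restrict_iff' (hmeas _ _)).mp h4
  have h2 : ∀ᵐ x : Plane, x ≠ 0 := by
    rw [ae_iff]
    simp
  filter_upwards [ae_all_iff.mpr h1, h2] with x hx hx0
  have hn : 0 < ‖x‖ := norm_pos_iff.mpr hx0
  obtain ⟨n, hn1⟩ := exists_nat_gt (max ‖x‖ ‖x‖⁻¹)
  refine hx n ⟨?_, ?_⟩
  · refine inv_le_of_inv_le₀ hn ?_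
    linarith [le_max_right ‖x‖ ‖x‖⁻¹]
  · linarith [le_max_left ‖x‖ ‖x‖⁻¹]

/-- The ray estimate holds for every circle of radius s in an annulus charged by V. Averaging it
over s with weight V replaces the circle term by ½∫Vφ², at the price of choosing B large. -/
theorem exists_neumannEnergy_ge {V : Plane → ℝ} (hV : Integrable V) (h0 : ∀ᵐ x, 0 ≤ V x)
    (hrad : ∃ v : ℝ → ℝ, ∀ᵐ x, V x = v ‖x‖) (hne : ¬ ∀ᵐ x, V x = 0) :
    ∃ B R₁ : ℝ, ∀ R, R₁ ≤ R → 0 < B + Real.log R ∧ ∀ φ : Plane → ℝ, ContDiff ℝ 1 φ →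
      ∫ x in Metric.ball (0 : Plane) R, φ x ^ 2 = 1 →
      2 / (R ^ 2 * (B + Real.log R)) ≤ neumannEnergy V R φ := by
  obtain ⟨a, b, ha, hab, hm⟩ := exists_annulus_integral_pos hV h0 hne
  set A : Set Plane := {x | a ≤ ‖x‖ ∧ ‖x‖ ≤ b} with hA
  have hAm : MeasurableSet A := (measurableSet_le measurable_const measurable_norm).inter
      (measurableSet_le measurable_norm measurable_const)
  set m := ∫ x in A, V x with hmdef
  have hpi := Real.pi_pos
  -- With m/κ = 4π, averaging against V and dividing by the 2π of the angular mean yields exactly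
  -- the coefficient ½ of V in the energy.
  set κ := m / (4 * Real.pi) with hκ
  have hκ0 : 0 < κ := by positivity
  -- Makes the outer boundary coefficient (B + log s - ½)⁻¹ at most κ/2 for all s ≥ a; the other κ/2
  -- is reserved for the inner term l s² ≤ δ.
  set B := 1 / 2 + 2 / κ - Real.log a with hB
  have hb : 0 < b := ha.trans_le hab
  set δ := min 1 (κ / 2) with hδ
  have hδ0 : 0 < δ := by positivity
  refine ⟨B, max (b + 1) (b ^ 2 * κ / δ + 1), fun R hR => ?_⟩
  have hRb : b + 1 ≤ R := (le_max_left _ _).trans hR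
  have hR2 : b ^ 2 * κ / δ + 1 ≤ R := (le_max_right _ _).trans hR
  have hR0 : 0 < R := by linarith
  have hlogs : ∀ s, a ≤ s → 2 / κ + 1 / 2 ≤ B + Real.log s := by
    intro s hs
    have := Real.log_le_log ha hs
    simp only [hB]
    linarith
  have hBR := hlogs R (by linarith)
  have h2κ : 0 < 2 / κ := by positivity
  refine ⟨by linarith, fun φ hφ hnorm => ?_⟩
  set l := 2 / (R ^ 2 * (B + Real.log R)) with hl
  have hl0 : 0 < l := by
    have : 0 < B + Real.log R := by linarith
    positivity
  have hlb : l * b ^ 2 ≤ δ := by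
    have h1 : l ≤ κ / R := by
      rw [hl, div_le_div_iff₀ (by have : 0 < B + Real.log R := by linarith
                                  positivity) hR0]
      have h3 : κ * (2 / κ) = 2 := by field_simp
      have h4 : 2 ≤ κ * (B + Real.log R) := by nlinarith
      have h5 : 1 ≤ R := by linarith
      nlinarith [mul_nonneg hR0.le (sub_nonneg.mpr h5)]
    have h2 : b ^ 2 * κ ≤ δ * R := by
      have : b ^ 2 * κ / δ ≤ R := by linarith
      rwa [div_le_iff₀ hδ0, mul_comm R] at this
    calc l * b ^ 2 ≤ κ / R * b ^ 2 := by gcongr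
      _ = b ^ 2 * κ / R := by ring
      _ ≤ δ := by rw [div_le_iff₀ hR0]; exact h2
  set D := ∫ x in Metric.ball (0 : Plane) R, ‖fderiv ℝ φ x‖ ^ 2 with hD
  have hc : Continuous φ := hφ.continuous
  have hc' : Continuous (fderiv ℝ φ) := hφ.continuous_fderiv (by norm_num)
  set Φ : ℝ → ℝ := fun s => ∫ θ in (-Real.pi)..Real.pi, φ (s • dirVec θ) ^ 2 with hΦ
  have hΦ0 : ∀ s, 0 ≤ Φ s := fun s =>
    intervalIntegral.integral_nonneg (by linarith) fun θ _ => sq_nonneg _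
  have hsph : ∀ s, a ≤ s → s ≤ b → l ≤ D + κ * Φ s := by
    intro s hs1 hs2
    have hs0 : 0 < s := ha.trans_le hs1
    have hls : l * s ^ 2 ≤ δ := le_trans (by gcongr) hlb
    have h1 := ball_le hφ (κ := κ) hs0 (by linarith : s ≤ R) (B := B)
      (by linarith [hlogs s hs1]) (hls.trans (min_le_left _ _)) (by
        have h2 : (B + Real.log s - 1 / 2)⁻¹ ≤ κ / 2 := by
          have e : κ / 2 = (2 / κ)⁻¹ := (inv_div _ _).symm
          rw [e]
          exact inv_anti₀ h2κ (by linarith [hlogs s hs1])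
        have h3 := hls.trans (min_le_right _ _)
        linarith)
    rwa [hnorm, mul_one] at h1
  have hE : neumannEnergy V R φ = D + 1 / 2 * ∫ x in Metric.ball (0 : Plane) R, V x * φ x ^ 2 := by
    rw [neumannEnergy, integral_add]
    · rw [← hD, ← integral_const_mul]
      congr 2
      funext x
      ring
    · exact integrableOn_ball (by fun_prop) R
    · have := (integrableOn_ball_mul hV (by fun_prop : Continuous fun x => φ x ^ 2) R).const_mul
        (1 / 2)
      refine this.congr (Filter.Eventually.of_forall fun x => ?_)
      ring
  have hrot := two_pi_mul_integral_radial hV hrad (by fun_prop : Continuous fun x => φ x ^ 2) R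
  have hD0 : 0 ≤ D := integral_nonneg fun x => sq_nonneg _
  have hVφ : 0 ≤ ∫ x in Metric.ball (0 : Plane) R, V x * φ x ^ 2 := by
    refine integral_nonneg_of_ae ?_
    filter_upwards [ae_restrict_of_ae h0] with x hx
    exact mul_nonneg hx (sq_nonneg _)
  have hΦc : Continuous Φ := by
    have := continuous_dirVec
    apply intervalIntegral.continuous_parametric_intervalIntegral_of_continuous'
    fun_prop
  have hVΦ : m * ((l - D) / κ) ≤ ∫ x in Metric.ball (0 : Plane) R, V x * Φ ‖x‖ := by
    have hi := integrableOn_ball_mul hV (hΦc.comp continuous_norm) R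
    have hAB : A ⊆ Metric.ball (0 : Plane) R := by
      intro x hx
      rw [mem_ball_zero_iff]
      linarith [hx.2]
    calc m * ((l - D) / κ) = ∫ x in A, V x * ((l - D) / κ) := by rw [integral_mul_const]
      _ ≤ ∫ x in A, V x * Φ ‖x‖ := by
          refine setIntegral_mono_on_ae (hV.integrableOn.mul_const _) (hi.mono_set hAB) hAm ?_
          filter_upwards [h0] with x hx hxA
          refine mul_le_mul_of_nonneg_left ?_ hx
          rw [div_le_iff₀ hκ0]
          linarith [hsph ‖x‖ hxA.1 hxA.2]
      _ ≤ _ := by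
          refine setIntegral_mono_set hi ?_ (Filter.Eventually.of_forall hAB)
          filter_upwards [ae_restrict_of_ae h0] with x hx
          exact mul_nonneg hx (hΦ0 _)
  have e1 : m * ((l - D) / κ) = 4 * Real.pi * (l - D) := by
    rw [hκ]
    field_simp
  rw [hE]
  rw [e1, ← hrot] at hVΦ
  have h5 : 2 * (l - D) ≤ ∫ x in Metric.ball (0 : Plane) R, V x * φ x ^ 2 := by
    have : 2 * Real.pi * (2 * (l - D)) ≤
      2 * Real.pi * ∫ x in Metric.ball (0 : Plane) R, V x * φ x ^ 2 := by linarith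
    exact le_of_mul_le_mul_left this (by positivity)
  linarith

/-! ### The upper bound for the Neumann eigenvalue -/

/-- The trial function `log (1 + |x|²)`. -/
def logTrial (x : Plane) : ℝ := Real.log (1 + ‖x‖ ^ 2)

theorem contDiff_logTrial : ContDiff ℝ 1 logTrial := by
  unfold logTrial
  refine ContDiff.log (contDiff_const.add (contDiff_norm_sq ℝ)) fun x => ?_
  positivity

theorem norm_fderiv_logTrial_sq_le (x : Plane) :
    ‖fderiv ℝ logTrial x‖ ^ 2 ≤ 4 / (1 + ‖x‖ ^ 2) := by
  have hpos : 0 < 1 + ‖x‖ ^ 2 := by positivity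
  have h1 : HasFDerivAt (fun x : Plane => 1 + ‖x‖ ^ 2) (2 • innerSL ℝ x) x :=
    ((hasStrictFDerivAt_norm_sq x).hasFDerivAt).const_add 1
  have h2 := (h1.log hpos.ne').fderiv
  have h3 : fderiv ℝ logTrial x = (1 + ‖x‖ ^ 2)⁻¹ • (2 • innerSL ℝ x) := h2
  have h4 : ‖fderiv ℝ logTrial x‖ ≤ 2 * ‖x‖ / (1 + ‖x‖ ^ 2) := by
    rw [h3, norm_smul, norm_inv, Real.norm_eq_abs, abs_of_pos hpos, inv_mul_eq_div]
    gcongr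
    refine (norm_nsmul_le (n := 2) (a := innerSL ℝ x)).trans ?_
    rw [innerSL_apply_norm]
    norm_num
  calc ‖fderiv ℝ logTrial x‖ ^ 2 ≤ (2 * ‖x‖ / (1 + ‖x‖ ^ 2)) ^ 2 := by gcongr
    _ ≤ 4 / (1 + ‖x‖ ^ 2) := by
      rw [div_pow, div_le_div_iff₀ (by positivity) hpos]
      nlinarith [sq_nonneg ‖x‖]

theorem integral_ball_inv_le {R : ℝ} (hR : 0 < R) :
    ∫ x in Metric.ball (0 : Plane) R, 4 / (1 + ‖x‖ ^ 2) =
      4 * Real.pi * Real.log (1 + R ^ 2) := by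
  have hc : Continuous fun x : Plane => 4 / (1 + ‖x‖ ^ 2) :=
    continuous_const.div (by fun_prop) fun x => by positivity
  rw [integral_ball_polar hc hR]
  have e : ∀ θ, ∫ r in (0 : ℝ)..R, r * (4 / (1 + ‖r • dirVec θ‖ ^ 2)) =
      2 * Real.log (1 + R ^ 2) := by
    intro θ
    have e1 : (fun r : ℝ => r * (4 / (1 + ‖r • dirVec θ‖ ^ 2))) =
        fun r : ℝ => 4 * r / (1 + r ^ 2) := by
      funext r
      rw [norm_smul, norm_dirVec, mul_one, Real.norm_eq_abs, sq_abs]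
      ring
    rw [e1, intervalIntegral.integral_eq_sub_of_hasDerivAt (f := fun r => 2 * Real.log (1 + r ^ 2))]
    · simp
    · intro r _
      have h := (((hasDerivAt_pow 2 r).const_add 1).log (by positivity)).const_mul 2
      refine h.congr_deriv ?_
      simp
      ring
    · apply Continuous.intervalIntegrable
      exact Continuous.div (by fun_prop) (by fun_prop) fun r => by positivity
  simp only [e]
  rw [intervalIntegral.integral_const, smul_eq_mul]
  ring

theorem measureReal_ball {R : ℝ} (hR : 0 ≤ R) :
    (volume : Measure Plane).real (Metric.ball 0 R) = Real.pi * R ^ 2 := by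
  rw [Measure.real, InnerProductSpace.volume_ball_of_dim_even (k := 1) (by simp)]
  simp [Real.pi_pos.le, hR]
  ring

/-- Only the shell R/2 ≤ |x| < R is used: it has 3/4 of the area, and there log(R²/4) ≥ (3/2) log R
since R ≥ 16. Thus 27/16 = (3/4)(3/2)². -/
theorem integral_logTrial_sq_ge {R : ℝ} (hR : 16 ≤ R) :
    27 / 16 * (Real.pi * R ^ 2) * Real.log R ^ 2 ≤
      ∫ x in Metric.ball (0 : Plane) R, logTrial x ^ 2 := by
  have hc : Continuous fun x : Plane => logTrial x ^ 2 := contDiff_logTrial.continuous.pow 2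
  have hi := integrableOn_ball hc R
  have hsub : Metric.ball (0 : Plane) R \ Metric.ball 0 (R / 2) ⊆ Metric.ball 0 R :=
    Set.sdiff_subset
  have hm : MeasurableSet (Metric.ball (0 : Plane) R \ Metric.ball 0 (R / 2)) :=
    measurableSet_ball.diff measurableSet_ball
  have hvol : (volume : Measure Plane).real (Metric.ball (0 : Plane) R \ Metric.ball 0 (R / 2)) =
      3 / 4 * (Real.pi * R ^ 2) := by
    rw [measureReal_sdiff (Metric.ball_subset_ball (by linarith)) measurableSet_ball
      measure_ball_lt_top.ne,
      measureReal_ball (by linarith), measureReal_ball (by linarith)]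
    ring
  have hlog : 0 ≤ Real.log R := Real.log_nonneg (by linarith)
  calc 27 / 16 * (Real.pi * R ^ 2) * Real.log R ^ 2
      = ∫ x in Metric.ball (0 : Plane) R \ Metric.ball 0 (R / 2), (3 / 2 * Real.log R) ^ 2 := by
        rw [setIntegral_const, hvol, smul_eq_mul]
        ring
    _ ≤ ∫ x in Metric.ball (0 : Plane) R \ Metric.ball 0 (R / 2), logTrial x ^ 2 := by
        refine setIntegral_mono_on ?_ (hi.mono_set hsub) hm fun x hx => ?_
        · exact integrableOn_const (measure_ne_top_of_subset hsub measure_ball_lt_top.ne)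
        · have h1 : R / 2 ≤ ‖x‖ := by
            have := hx.2
            rwa [mem_ball_zero_iff, not_lt] at this
          have h2 : R ^ 2 / 4 ≤ 1 + ‖x‖ ^ 2 := by nlinarith
          have h3 : 3 / 2 * Real.log R ≤ logTrial x := by
            refine le_trans ?_ (Real.log_le_log (by positivity) h2)
            have h4 : Real.log 16 ≤ Real.log R := Real.log_le_log (by norm_num) hR
            have h5 : Real.log 16 = 2 * Real.log 4 := by
              rw [show (16 : ℝ) = 4 ^ 2 by norm_num, Real.log_pow]
              norm_num
            rw [Real.log_div (by positivity) (by norm_num), Real.log_pow]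
            push_cast
            linarith
          gcongr
    _ ≤ _ := by
        refine setIntegral_mono_set hi (Filter.Eventually.of_forall fun x => sq_nonneg _)
          (Filter.Eventually.of_forall hsub)

theorem neumannEnergy_nonneg {V : Plane → ℝ} (h0 : ∀ᵐ x, 0 ≤ V x) (R : ℝ) (φ : Plane → ℝ) :
    0 ≤ neumannEnergy V R φ := by
  refine integral_nonneg_of_ae ?_
  filter_upwards [ae_restrict_of_ae h0] with x hx
  have : 0 ≤ V x / 2 * φ x ^ 2 := by positivity
  exact add_nonneg (sq_nonneg _) this

theorem neumannEnergy_const_mul (V : Plane → ℝ) (R : ℝ) {φ : Plane → ℝ} (hφ : ContDiff ℝ 1 φ)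
    (c : ℝ) : neumannEnergy V R (fun x => c * φ x) = c ^ 2 * neumannEnergy V R φ := by
  rw [neumannEnergy, neumannEnergy, ← integral_const_mul]
  congr 1
  funext x
  rw [fderiv_const_mul (hφ.differentiable (by norm_num) x), norm_smul, mul_pow, Real.norm_eq_abs,
    sq_abs]
  ring

theorem neumannEnergy_logTrial_le {V : Plane → ℝ} (hV : Integrable V) (h0 : ∀ᵐ x, 0 ≤ V x)
    {R₀ : ℝ} (hsupp : ∀ᵐ x, R₀ < ‖x‖ → V x = 0) {R : ℝ} (hR : 0 < R) :
    neumannEnergy V R logTrial ≤ 4 * Real.pi * Real.log (1 + R ^ 2) +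
      Real.log (1 + R₀ ^ 2) ^ 2 * ∫ x, V x := by
  have hc := contDiff_logTrial.continuous
  have hc' : Continuous (fderiv ℝ logTrial) := contDiff_logTrial.continuous_fderiv (by norm_num)
  have hi1 : IntegrableOn (fun x => ‖fderiv ℝ logTrial x‖ ^ 2) (Metric.ball (0 : Plane) R) :=
    integrableOn_ball (by fun_prop) R
  have hi2 : IntegrableOn (fun x => V x / 2 * logTrial x ^ 2) (Metric.ball (0 : Plane) R) := by
    have := (integrableOn_ball_mul hV (by fun_prop : Continuous fun x => logTrial x ^ 2) R).const_mul
        (1 / 2)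
    refine this.congr (Filter.Eventually.of_forall fun x => ?_)
    ring
  rw [neumannEnergy, integral_add hi1 hi2]
  refine add_le_add ?_ ?_
  · rw [← integral_ball_inv_le hR]
    refine setIntegral_mono hi1 (integrableOn_ball ?_ R) norm_fderiv_logTrial_sq_le
    exact continuous_const.div (by fun_prop) fun x => by positivity
  · rw [← integral_const_mul]
    have hi3 : Integrable fun x => Real.log (1 + R₀ ^ 2) ^ 2 * V x := hV.const_mul _
    refine le_trans (integral_mono_ae hi2 hi3.integrableOn ?_)
      (setIntegral_le_integral hi3 ?_)
    · filter_upwards [ae_restrict_of_ae hsupp, ae_restrict_of_ae h0] with x h1 h2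
      rcases lt_or_ge R₀ ‖x‖ with h | h
      · simp [h1 h]
      · have h3 : logTrial x ≤ Real.log (1 + R₀ ^ 2) := by
          refine Real.log_le_log (by positivity) ?_
          gcongr
        have h4 : 0 ≤ logTrial x := Real.log_nonneg (by nlinarith [sq_nonneg ‖x‖])
        have h5 : logTrial x ^ 2 ≤ Real.log (1 + R₀ ^ 2) ^ 2 := by gcongr
        nlinarith [mul_le_mul_of_nonneg_left h5 h2, mul_nonneg h2 (sq_nonneg (logTrial x))]
    · filter_upwards [h0] with x hx
      exact mul_nonneg (sq_nonneg _) hx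

/-- Only the lower bound must have a sharp constant. The upper bound, from the trial function log(1
+ |x|²), serves to keep g_N at most 20. -/
theorem exists_neumannEigenvalue_bounds {V : Plane → ℝ} (hV : Integrable V) (h0 : ∀ᵐ x, 0 ≤ V x)
    (hrad : ∃ v : ℝ → ℝ, ∀ᵐ x, V x = v ‖x‖) (hne : ¬ ∀ᵐ x, V x = 0)
    {R₀ : ℝ} (hsupp : ∀ᵐ x, R₀ < ‖x‖ → V x = 0) :
    ∃ B R₁ : ℝ, ∀ R, R₁ ≤ R → 0 < B + Real.log R ∧
      2 / (R ^ 2 * (B + Real.log R)) ≤ neumannEigenvalue V R ∧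
      neumannEigenvalue V R ≤ 8 / (R ^ 2 * Real.log R) := by
  obtain ⟨B, R₁, hB⟩ := exists_neumannEnergy_ge hV h0 hrad hne
  set K := Real.log (1 + R₀ ^ 2) ^ 2 * ∫ x, V x with hK
  have hK0 : 0 ≤ K := mul_nonneg (sq_nonneg _) (integral_nonneg_of_ae h0)
  refine ⟨B, max (max R₁ 16) (Real.exp K), fun R hR => ?_⟩
  have hR1 : R₁ ≤ R := (le_max_left _ _).trans ((le_max_left _ _).trans hR)
  have hR4 : 16 ≤ R := (le_max_right _ _).trans ((le_max_left _ _).trans hR)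
  have hRK : Real.exp K ≤ R := (le_max_right _ _).trans hR
  have hpi := Real.pi_pos
  obtain ⟨hBpos, hlow⟩ := hB R hR1
  refine ⟨hBpos, ?_⟩
  have hlog : 1 ≤ Real.log R := by
    rw [Real.le_log_iff_exp_le (by linarith)]
    have := Real.exp_one_lt_d9
    linarith
  set M := ∫ x in Metric.ball (0 : Plane) R, logTrial x ^ 2 with hM
  have hMge := integral_logTrial_sq_ge hR4
  have hM0 : 0 < M := lt_of_lt_of_le (by positivity) hMge
  set φ : Plane → ℝ := fun x => (Real.sqrt M)⁻¹ * logTrial x with hφ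
  have hsq : (Real.sqrt M)⁻¹ ^ 2 = M⁻¹ := by rw [inv_pow, Real.sq_sqrt hM0.le]
  have hφnorm : ∫ x in Metric.ball (0 : Plane) R, φ x ^ 2 = 1 := by
    simp only [hφ, mul_pow, hsq]
    rw [integral_const_mul, ← hM, inv_mul_cancel₀ hM0.ne']
  have hφE : neumannEnergy V R φ = M⁻¹ * neumannEnergy V R logTrial := by
    rw [hφ, neumannEnergy_const_mul V R contDiff_logTrial, hsq]
  have hφc : ContDiff ℝ 1 φ := contDiff_const.mul contDiff_logTrial
  constructor
  · refine le_csInf ⟨_, φ, hφc, hφnorm, rfl⟩ ?_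
    rintro E ⟨ψ, h1, h2, rfl⟩
    exact hlow ψ h1 h2
  · rw [neumannEigenvalue]
    refine le_trans (csInf_le (a := neumannEnergy V R φ) ?_ ⟨φ, hφc, hφnorm, rfl⟩) ?_
    · refine ⟨0, ?_⟩
      rintro E ⟨ψ, _, _, rfl⟩
      exact neumannEnergy_nonneg h0 R ψ
    · have hE := neumannEnergy_logTrial_le hV h0 hsupp (R := R) (by linarith)
      have h3 : Real.log (1 + R ^ 2) ≤ 3 * Real.log R := by
        have h4 : 1 + R ^ 2 ≤ R ^ 3 := by nlinarith [sq_nonneg R]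
        calc Real.log (1 + R ^ 2) ≤ Real.log (R ^ 3) := Real.log_le_log (by positivity) h4
          _ = 3 * Real.log R := by rw [Real.log_pow]; norm_num
      have hKlog : K ≤ Real.log R := (Real.le_log_iff_exp_le (by linarith)).mpr hRK
      -- 12π log R from the gradient and K ≤ log R from the potential; the quotient 13 · 16/27 is
      -- below 8.
      have h5 : neumannEnergy V R logTrial ≤ 13 * Real.pi * Real.log R := by
        rw [← hK] at hE
        have := Real.pi_gt_three
        nlinarith
      rw [hφE, inv_mul_eq_div, div_le_div_iff₀ hM0 (by positivity)]
      calc neumannEnergy V R logTrial * (R ^ 2 * Real.log R)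
          ≤ 13 * Real.pi * Real.log R * (R ^ 2 * Real.log R) := by gcongr
        _ = 13 * (Real.pi * R ^ 2 * Real.log R ^ 2) := by ring
        _ ≤ 27 / 2 * (Real.pi * R ^ 2 * Real.log R ^ 2) := by gcongr; norm_num
        _ = 8 * (27 / 16 * (Real.pi * R ^ 2) * Real.log R ^ 2) := by ring
        _ ≤ _ := by gcongr

/-! ### Asymptotics of the coupling constant -/

theorem eventually_log_sq_le (K : ℝ) :
    ∀ᶠ N : ℕ in Filter.atTop, K ≤ Real.log N ∧ K * Real.log N ^ 2 ≤ N := by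
  have h1 : Filter.Tendsto (fun N : ℕ => Real.log N) Filter.atTop Filter.atTop :=
    Real.tendsto_log_atTop.comp tendsto_natCast_atTop_atTop
  have h2 := ((Real.isLittleO_pow_log_id_atTop (n := 2)).comp_tendsto
    tendsto_natCast_atTop_atTop (k := fun N : ℕ => (N : ℝ))).def (c := (|K| + 1)⁻¹) (by positivity)
  filter_upwards [h1.eventually_ge_atTop K, h2] with N hK hN
  refine ⟨hK, ?_⟩
  simp only [Function.comp_apply, id_eq, norm_pow, Real.norm_eq_abs, sq_abs, Nat.abs_cast] at hN
  rw [inv_mul_eq_div, le_div_iff₀ (by positivity)] at hN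
  have := le_abs_self K
  nlinarith [sq_nonneg (Real.log N)]

/-- With R = e^N N^(-α) one has g_N = 2N R²λ and log R = N - α log N, so both bounds are those of
the eigenvalue. B depends on V only, not on α. -/
theorem exists_gN_bounds {V : Plane → ℝ} (hV : Integrable V) (h0 : ∀ᵐ x, 0 ≤ V x)
    (hrad : ∃ v : ℝ → ℝ, ∀ᵐ x, V x = v ‖x‖) (hne : ¬ ∀ᵐ x, V x = 0)
    {R₀ : ℝ} (hsupp : ∀ᵐ x, R₀ < ‖x‖ → V x = 0) :
    ∃ B : ℝ, ∀ α : ℝ, 0 < α → ∀ᶠ N : ℕ in Filter.atTop,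
      0 < N - (α * Real.log N - B) ∧ 4 * N / (N - (α * Real.log N - B)) ≤ gN V α N ∧
        gN V α N ≤ 20 := by
  obtain ⟨B, R₁, hB⟩ := exists_neumannEigenvalue_bounds hV h0 hrad hne hsupp
  refine ⟨B, fun α hα => ?_⟩
  filter_upwards [eventually_log_sq_le (max (max 1 (5 * α)) (2 * |R₁|))] with N hN
  obtain ⟨hK1, hK2⟩ := hN
  set L := Real.log N with hL
  have hL1 : 1 ≤ L := (le_max_left _ _).trans ((le_max_left _ _).trans hK1)
  have hN0 : (0 : ℝ) < N := by
    rcases Nat.eq_zero_or_pos N with h | h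
    · simp [hL, h] at hL1
      linarith
    · exact_mod_cast h
  have hLL : L ≤ L ^ 2 := by nlinarith
  have hαL : 5 * (α * L) ≤ N := by
    have h1 : 5 * α ≤ max (max 1 (5 * α)) (2 * |R₁|) := (le_max_right _ _).trans (le_max_left _ _)
    nlinarith
  have hRN : 2 * |R₁| ≤ N := by
    have h1 : 2 * |R₁| ≤ max (max 1 (5 * α)) (2 * |R₁|) := le_max_right _ _
    have h2 : 0 ≤ |R₁| := abs_nonneg _
    nlinarith
  set R := Real.exp N * (N : ℝ) ^ (-α) with hR
  have hRexp : R = Real.exp (N - α * L) := by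
    rw [hR, Real.rpow_def_of_pos hN0, ← Real.exp_add]
    congr 1
    ring
  have hR1 : R₁ ≤ R := by
    rw [hRexp]
    have := Real.add_one_le_exp (N - α * L)
    have := le_abs_self R₁
    linarith
  have hlogR : Real.log R = N - α * L := by rw [hRexp, Real.log_exp]
  obtain ⟨b0, b1, b2⟩ := hB R hR1
  have hR0 : 0 < R := by rw [hRexp]; exact Real.exp_pos _
  have hg : gN V α N = 2 * N * (R ^ 2 * neumannEigenvalue V R) := by
    rw [gN, ← hR]
    have h1 : R ^ 2 = Real.exp (2 * N) * (N : ℝ) ^ (-(2 * α)) := by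
      rw [hR, mul_pow, ← Real.exp_nat_mul, ← Real.rpow_natCast ((N : ℝ) ^ (-α)),
        ← Real.rpow_mul hN0.le]
      push_cast
      congr 2
      ring
    have h2 : (N : ℝ) ^ (1 - 2 * α) = N * (N : ℝ) ^ (-(2 * α)) := by
      rw [sub_eq_add_neg, Real.rpow_add hN0, Real.rpow_one]
    rw [h1, h2]
    ring
  rw [hlogR] at b0 b1 b2
  have e : (N : ℝ) - (α * L - B) = B + (N - α * L) := by ring
  have hpos : 0 < (N : ℝ) - α * L := by linarith
  rw [e]
  refine ⟨b0, ?_, ?_⟩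
  · rw [hg]
    calc 4 * (N : ℝ) / (B + (N - α * L))
        = 2 * N * (R ^ 2 * (2 / (R ^ 2 * (B + (N - α * L))))) := by
          field_simp
          ring
      _ ≤ _ := by gcongr
  · rw [hg]
    calc 2 * (N : ℝ) * (R ^ 2 * neumannEigenvalue V R)
        ≤ 2 * N * (R ^ 2 * (8 / (R ^ 2 * (N - α * L)))) := by gcongr
      _ = 16 * N / (N - α * L) := by
          field_simp
          ring
      _ ≤ 20 := by
          rw [div_le_iff₀ hpos]
          linarith

/-- The leading order energy beats the second order correction up to a constant. -/
theorem leading_energy_ge {N g y T : ℝ} (hN : 0 < N) (hy : 0 ≤ y) (hyN : 2 * y ≤ N)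
    (hT : 0 ≤ T) (hTN : 5 * T ≤ N) (hyT : 6 * (y * T) ≤ N) (hg : 4 * N / (N - y) ≤ g)
    (hg20 : g ≤ 20) :
    2 * Real.pi * N + 2 * Real.pi * y - T - 1 ≤
      1 / 2 * N * (Real.pi * g) - g ^ 2 / 16 * T := by
  have hNy : 0 < N - y := by linarith
  set q := N / (N - y) with hq
  have hq0 : 4 * N / (N - y) = 4 * q := by rw [hq]; ring
  rw [hq0] at hg
  have hqN : q * (N - y) = N := by rw [hq]; field_simp
  have hq1 : 1 ≤ q := by rw [hq, le_div_iff₀ hNy]; linarith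
  have hqle : q * N ≤ N + 2 * y := by
    rw [hq, div_mul_eq_mul_div, div_le_iff₀ hNy]
    nlinarith
  have hqsq : q ^ 2 * T ≤ T + 1 := by
    have h1 : q ^ 2 * N ≤ N + 6 * y := by
      have h2 : q ^ 2 * N ≤ q * (N + 2 * y) := by nlinarith
      have h3 : q ≤ 2 := by
        rw [hq, div_le_iff₀ hNy]; linarith
      nlinarith
    have h4 : q ^ 2 * T * N ≤ (T + 1) * N := by nlinarith
    exact le_of_mul_le_mul_right h4 hN
  have hpi := Real.pi_gt_three
  have hqy : N + y ≤ q * N := by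
    have : q * N = N + q * y := by linarith
    nlinarith
  -- This is the difference of the expression ½πNg - g²T/16 at g and at 4q: it increases with g
  -- because g + 4q ≤ 40 and T ≤ N/5. Hence g may be replaced by its lower bound 4q.
  have h5 : 0 ≤ (g - 4 * q) * (1 / 2 * N * Real.pi - (g + 4 * q) / 16 * T) := by
    refine mul_nonneg (by linarith) ?_
    have h6 : (g + 4 * q) / 16 * T ≤ 5 / 2 * T := by
      refine mul_le_mul_of_nonneg_right ?_ hT
      linarith
    nlinarith
  have h7 : 1 / 2 * N * (Real.pi * g) - g ^ 2 / 16 * T =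
      (g - 4 * q) * (1 / 2 * N * Real.pi - (g + 4 * q) / 16 * T) +
        (2 * Real.pi * (q * N) - q ^ 2 * T) := by ring
  rw [h7]
  have h8 : 2 * Real.pi * (N + y) ≤ 2 * Real.pi * (q * N) := by gcongr
  linarith

/-! ### Convergence and rewriting of the effective form -/

theorem omegaHat_zero (V : Plane → ℝ) (α : ℝ) (N : ℕ) :
    omegaHat V α N 0 = Real.pi * gN V α N := by
  have h : mom 0 = 0 := by
    ext i
    simp [mom]
  rw [omegaHat_eq, h, smul_zero, diskHat_zero, mul_comm]

theorem omegaHat_sum (V : Plane → ℝ) {α : ℝ} (hα : 0 < α) {N : ℕ} (hN : 1 ≤ N) :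
    Summable (fun p : Mode => omegaHat V α N p.1 ^ 2 / ‖mom p.1‖ ^ 2) ∧
      ∑' p : Mode, omegaHat V α N p.1 ^ 2 / ‖mom p.1‖ ^ 2 ≤
        gN V α N ^ 2 / 4 * (2 * Real.pi * (α * Real.log N) + 30) := by
  have hN' : (1 : ℝ) ≤ N := by exact_mod_cast hN
  obtain ⟨h1, h2⟩ := diskHat_sum (Real.one_le_rpow hN' hα.le)
  have e : (fun p : Mode => omegaHat V α N p.1 ^ 2 / ‖mom p.1‖ ^ 2) = fun p =>
      gN V α N ^ 2 * (diskHat (((N : ℝ) ^ α)⁻¹ • mom p.1) ^ 2 / ‖mom p.1‖ ^ 2) := by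
    funext p
    rw [omegaHat_eq]
    ring
  rw [e]
  refine ⟨h1.mul_left _, ?_⟩
  rw [tsum_mul_left]
  rw [Real.log_rpow (by linarith)] at h2
  calc _ ≤ gN V α N ^ 2 * (1 / 4 * (2 * Real.pi * (α * Real.log N) + 30)) := by gcongr
    _ = _ := by ring

theorem omegaHat_sq_le (V : Plane → ℝ) (α : ℝ) (N : ℕ) (k : Lat) :
    omegaHat V α N k ^ 2 ≤ (Real.pi * gN V α N) ^ 2 := by
  rw [omegaHat_eq, mul_pow, mul_pow, mul_comm (Real.pi ^ 2)]
  refine mul_le_mul_of_nonneg_left ?_ (sq_nonneg _)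
  exact sq_le_sq' (abs_le.mp (abs_diskHat_le_pi _)).1 (abs_le.mp (abs_diskHat_le_pi _)).2

theorem memLp_of_ae_bounded_support {V : Plane → ℝ} (hV : MemLp V 3) {R₀ : ℝ}
    (hsupp : ∀ᵐ x, R₀ < ‖x‖ → V x = 0) {q : ENNReal} (hq : q ≤ 3) : MemLp V q := by
  have h1 : MemLp V q (volume.restrict (Metric.closedBall 0 R₀)) := by
    have : IsFiniteMeasure ((volume : Measure Plane).restrict (Metric.closedBall 0 R₀)) :=
      ⟨by rw [Measure.restrict_apply_univ]; exact measure_closedBall_lt_top⟩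
    exact (hV.restrict _).mono_exponent hq
  refine ((memLp_indicator_iff_restrict measurableSet_closedBall).mpr h1).ae_eq ?_
  filter_upwards [hsupp] with x hx
  by_cases hm : x ∈ Metric.closedBall (0 : Plane) R₀
  · rw [Set.indicator_of_mem hm]
  · rw [Set.indicator_of_notMem hm]
    rw [mem_closedBall_zero_iff, not_le] at hm
    exact (hx hm).symm

theorem formConverges {V : Plane → ℝ} (hV : MemLp V 3) {R₀ : ℝ}
    (hsupp : ∀ᵐ x, R₀ < ‖x‖ → V x = 0) {α : ℝ} (hα : 0 < α) {N : ℕ} (hN : 1 ≤ N) {ξ : Fock}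
    (hξ : ξ ∈ formDomain N) : FormConverges V α N ξ := by
  obtain ⟨hu, -⟩ := omegaHat_sum V hα hN
  refine ⟨hξ.2, ?_, (hasSum_diagTerm N ξ).summable, ?_, ?_⟩
  · refine summable_potTerm ?_ hξ
    refine summable_fourier_sq (memLp_of_ae_bounded_support hV hsupp ?_) hsupp (Real.exp_pos _)
    exact_mod_cast (by norm_num : (2 : ℕ) ≤ 3)
  · have := (pair_bound hu le_rfl (abs_pairCoeff_le N) hξ.2).1.mul_left 2
    exact this.congr fun p => (pairTerm_eq V α N ξ p).symm
  · have := (cubic_bound hu le_rfl (abs_cubicCoeff_le N) hξ.2).1.mul_left 2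
    exact this.congr fun x => (cubicTerm_eq V α N ξ x).symm

theorem effForm_eq (V : Plane → ℝ) (α : ℝ) (N : ℕ) (ξ : Fock) :
    effForm V α N ξ =
      1 / 2 * ((N : ℝ) - 1) * omegaHat V α N 0 * expect (numFn fun n => 1 - (n : ℝ) / N) ξ
        + 3 / 2 * omegaHat V α N 0 * expect (numFn fun n => (n : ℝ) * (1 - n / N)) ξ
        + ∑' p : Mode, omegaHat V α N p.1 * pairFn (pairCoeff N) ξ p
        + 2 / Real.sqrt N * ∑' x : CubicIdx, omegaHat V α N x.1.1.1 * cubicFn (cubicCoeff N) ξ x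
        + energyForm V N ξ := by
  rw [effForm, (hasSum_diagTerm N ξ).tsum_eq, expect_numOp_depletion]
  simp only [pairTerm_eq, cubicTerm_eq, tsum_mul_left, depletion]
  ring

/-! ### Localisation -/

theorem expect_numFn_numFn (φ f : ℕ → ℝ) (ξ : Fock) :
    expect (numFn φ) (numFn f ξ) = expect (numFn fun n => φ n * f n ^ 2) ξ := by
  rw [expect, ← inner_numFn, numFn_numFn, numFn_numFn, expect]
  congr 4
  funext n
  ring

theorem expect_numFn_partition (φ : ℕ → ℝ) {f g : ℕ → ℝ} (h : ∀ n, f n ^ 2 + g n ^ 2 = 1)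
    (ξ : Fock) :
    expect (numFn φ) (numFn f ξ) + expect (numFn φ) (numFn g ξ) = expect (numFn φ) ξ := by
  rw [expect_numFn_numFn, expect_numFn_numFn, ← expect_numFn_add]
  congr 2
  funext n
  rw [← mul_add, h, mul_one]

theorem kinTerm_partition {f g : ℕ → ℝ} (h : ∀ n, f n ^ 2 + g n ^ 2 = 1) (ξ : Fock) (p : Mode) :
    kinTerm (numFn f ξ) p + kinTerm (numFn g ξ) p = kinTerm ξ p := by
  simp only [kinTerm_eq, annih_numFn, norm_numFn_sq]
  rw [← mul_add, ← expect_numFn_add]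
  simp only [h, expect_numFn_one]

theorem re_inner_partition {f g : ℕ → ℝ} (h : ∀ n, f n ^ 2 + g n ^ 2 = 1) (ξ ζ : Fock) :
    (inner ℂ (numFn f ξ) (numFn f ζ)).re + (inner ℂ (numFn g ξ) (numFn g ζ)).re =
      (inner ℂ ξ ζ).re := by
  rw [← inner_numFn, ← inner_numFn, numFn_numFn, numFn_numFn, ← Complex.add_re, ← inner_numFn_add]
  have : (fun n => f n * f n + g n * g n) = fun _ : ℕ => (1 : ℝ) := by
    funext n
    rw [← h n]
    ring
  rw [this, numFn_one]

theorem potTerm_partition (V : Plane → ℝ) (N : ℕ) {f g : ℕ → ℝ} (h : ∀ n, f n ^ 2 + g n ^ 2 = 1)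
    (ξ : Fock) (x : QuarticIdx) :
    potTerm V N (numFn f ξ) x + potTerm V N (numFn g ξ) x = potTerm V N ξ x := by
  simp only [potTerm_eq, annih_numFn]
  rw [← mul_add, re_inner_partition (f := fun n => f (n + 1 + 1)) (g := fun n => g (n + 1 + 1))
    fun n => h (n + 1 + 1)]

theorem numFn_mem_formDomain {N : ℕ} {f g : ℕ → ℝ} (h : ∀ n, f n ^ 2 + g n ^ 2 = 1) {ξ : Fock}
    (hξ : ξ ∈ formDomain N) : numFn f ξ ∈ formDomain N := by
  refine ⟨numFn_mem_truncFock f hξ.1, ?_⟩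
  refine Summable.of_nonneg_of_le (kinTerm_nonneg _) (fun p => ?_) hξ.2
  rw [← kinTerm_partition h ξ p]
  linarith [kinTerm_nonneg (numFn g ξ) p]

/-- The localisation error. -/
theorem effForm_localization {V : Plane → ℝ} (hV : MemLp V 3) {R₀ : ℝ}
    (hsupp : ∀ᵐ x, R₀ < ‖x‖ → V x = 0) {α : ℝ} (hα : 0 < α) {N : ℕ} (hN : 1 ≤ N)
    {f g : ℕ → ℝ} (h : ∀ n, f n ^ 2 + g n ^ 2 = 1) {ξ : Fock} (hξ : ξ ∈ formDomain N) :
    effForm V α N ξ - effForm V α N (numFn f ξ) - effForm V α N (numFn g ξ) =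
      ∑' p : Mode, omegaHat V α N p.1 *
          pairFn (fun n => pairCoeff N n * (1 - f n * f (n + 2) - g n * g (n + 2))) ξ p
        + 2 / Real.sqrt N * ∑' x : CubicIdx, omegaHat V α N x.1.1.1 *
          cubicFn (fun n => cubicCoeff N n *
            (1 - f (n + 1) * f (n + 2) - g (n + 1) * g (n + 2))) ξ x := by
  have hg : ∀ n, g n ^ 2 + f n ^ 2 = 1 := fun n => by rw [add_comm, h]
  have hf1 := numFn_mem_formDomain h hξ
  have hg1 := numFn_mem_formDomain hg hξ
  obtain ⟨hu, -⟩ := omegaHat_sum V hα hN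
  -- Number-conserving terms evaluate f and g at the same point on both sides, so f² + g² = 1 splits
  -- them without error.
  have hk : kinForm (numFn f ξ) + kinForm (numFn g ξ) = kinForm ξ := by
    rw [kinForm, kinForm, kinForm, ← hf1.2.tsum_add hg1.2]
    simp only [kinTerm_partition h]
  have hp : potForm V N (numFn f ξ) + potForm V N (numFn g ξ) = potForm V N ξ := by
    rw [potForm, potForm, potForm, ← mul_add, ← (formConverges hV hsupp hα hN hf1).2.1.tsum_add
      (formConverges hV hsupp hα hN hg1).2.1]
    simp only [potTerm_partition V N h]
  have hpair : ∑' p : Mode, omegaHat V α N p.1 *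
          pairFn (fun n => pairCoeff N n * (1 - f n * f (n + 2) - g n * g (n + 2))) ξ p =
      ∑' p : Mode, omegaHat V α N p.1 * pairFn (pairCoeff N) ξ p -
        ∑' p : Mode, omegaHat V α N p.1 * pairFn (pairCoeff N) (numFn f ξ) p -
        ∑' p : Mode, omegaHat V α N p.1 * pairFn (pairCoeff N) (numFn g ξ) p := by
    have s0 := (pair_bound hu le_rfl (abs_pairCoeff_le N) hξ.2).1
    have s1 := (pair_bound hu le_rfl (abs_pairCoeff_le N) hf1.2).1
    have s2 := (pair_bound hu le_rfl (abs_pairCoeff_le N) hg1.2).1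
    rw [← s0.tsum_sub s1, ← (s0.sub s1).tsum_sub s2]
    congr 1
    funext p
    have e : pairFn (pairCoeff N) ξ p =
        pairFn (fun n => pairCoeff N n * (1 - f n * f (n + 2) - g n * g (n + 2))) ξ p +
          (pairFn (fun n => pairCoeff N n * (f n * f (n + 2))) ξ p +
            pairFn (fun n => pairCoeff N n * (g n * g (n + 2))) ξ p) := by
      rw [← pairFn_add, ← pairFn_add]
      congr 1
      funext n
      ring
    rw [pairFn_numFn, pairFn_numFn, e]
    ring
  have hcub : ∑' x : CubicIdx, omegaHat V α N x.1.1.1 * cubicFn (fun n => cubicCoeff N n *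
            (1 - f (n + 1) * f (n + 2) - g (n + 1) * g (n + 2))) ξ x =
      ∑' x : CubicIdx, omegaHat V α N x.1.1.1 * cubicFn (cubicCoeff N) ξ x -
        ∑' x : CubicIdx, omegaHat V α N x.1.1.1 * cubicFn (cubicCoeff N) (numFn f ξ) x -
        ∑' x : CubicIdx, omegaHat V α N x.1.1.1 * cubicFn (cubicCoeff N) (numFn g ξ) x := by
    have s0 := (cubic_bound hu le_rfl (abs_cubicCoeff_le N) hξ.2).1
    have s1 := (cubic_bound hu le_rfl (abs_cubicCoeff_le N) hf1.2).1
    have s2 := (cubic_bound hu le_rfl (abs_cubicCoeff_le N) hg1.2).1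
    rw [← s0.tsum_sub s1, ← (s0.sub s1).tsum_sub s2]
    congr 1
    funext x
    have e : cubicFn (cubicCoeff N) ξ x =
        cubicFn (fun n => cubicCoeff N n *
            (1 - f (n + 1) * f (n + 2) - g (n + 1) * g (n + 2))) ξ x +
          (cubicFn (fun n => cubicCoeff N n * (f (n + 1) * f (n + 2))) ξ x +
            cubicFn (fun n => cubicCoeff N n * (g (n + 1) * g (n + 2))) ξ x) := by
      rw [← cubicFn_add, ← cubicFn_add]
      congr 1
      funext n
      ring
    rw [cubicFn_numFn, cubicFn_numFn, e]
    ring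
  rw [hpair, hcub]
  simp only [effForm_eq, energyForm]
  rw [← hk, ← hp, ← expect_numFn_partition (fun n => 1 - (n : ℝ) / N) h ξ,
    ← expect_numFn_partition (fun n => (n : ℝ) * (1 - n / N)) h ξ]
  ring

theorem expect_numOp_sq_le {N : ℕ} {ξ : Fock} (hξ : ξ ∈ truncFock N) :
    expect (numOp ^ 2) ξ ≤ N * expect numOp ξ := by
  rw [expect_numOp_sq, numOp, ← expect_numFn_const_mul]
  refine expect_numFn_le hξ fun n hn => ?_
  have h1 : (n : ℝ) ≤ N := by exact_mod_cast hn
  have h2 : (0 : ℝ) ≤ n := Nat.cast_nonneg n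
  nlinarith

theorem expect_numOp_sq_nonneg (ξ : Fock) : 0 ≤ expect (numOp ^ 2) ξ := by
  rw [expect_numOp_sq]
  exact expect_numFn_nonneg ξ fun n => sq_nonneg _

theorem expect_numOp_le_kinForm {ξ : Fock} (hξ : Summable (kinTerm ξ)) :
    expect numOp ξ ≤ kinForm ξ := by
  have h1 := four_pi_sq_mul_expect_numOp_le hξ
  have h2 := expect_numOp_nonneg ξ
  have h3 : 1 ≤ 4 * Real.pi ^ 2 := by nlinarith [Real.pi_gt_three]
  nlinarith

/-- In the cubic term ⟨𝒩₊²⟩ ≤ N⟨𝒩₊⟩ ≤ N𝒦 compensates the prefactor 1/√N, so both terms are of order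
B S (𝒦 + 1). -/
theorem localization_bound (V : Plane → ℝ) {α : ℝ} (hα : 0 < α) {N : ℕ} (hN : 1 ≤ N)
    {S B : ℝ} (hS : 0 ≤ S) (hB : 0 ≤ B)
    (hU : ∑' p : Mode, omegaHat V α N p.1 ^ 2 / ‖mom p.1‖ ^ 2 ≤ S ^ 2)
    {φ ψ : ℕ → ℝ} (hφ : ∀ n, |φ n| ≤ B) (hψ : ∀ n, |ψ n| ≤ B) {ξ : Fock}
    (hξ : ξ ∈ formDomain N) :
    |∑' p : Mode, omegaHat V α N p.1 * pairFn φ ξ p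
        + 2 / Real.sqrt N * ∑' x : CubicIdx, omegaHat V α N x.1.1.1 * cubicFn ψ ξ x| ≤
      3 * B * S * (kinForm ξ + ‖ξ‖ ^ 2) := by
  obtain ⟨hu, -⟩ := omegaHat_sum V hα hN
  have h1 := (pair_bound hu hU hφ hξ.2).2
  have h2 := (cubic_bound hu hU hψ hξ.2).2
  have hN0 : (0 : ℝ) < N := by exact_mod_cast hN
  have hk := kinForm_nonneg ξ
  have hn := expect_numOp_nonneg ξ
  have hnk := expect_numOp_le_kinForm hξ.2
  have hx : 0 ≤ ‖ξ‖ ^ 2 := sq_nonneg _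
  have h3 : Real.sqrt ((B ^ 2 * (expect numOp ξ + ‖ξ‖ ^ 2) * S ^ 2) * kinForm ξ) ≤
      B * S * (kinForm ξ + ‖ξ‖ ^ 2) := by
    refine Real.sqrt_le_iff.mpr ⟨by positivity, ?_⟩
    calc B ^ 2 * (expect numOp ξ + ‖ξ‖ ^ 2) * S ^ 2 * kinForm ξ
        ≤ B ^ 2 * (kinForm ξ + ‖ξ‖ ^ 2) * S ^ 2 * (kinForm ξ + ‖ξ‖ ^ 2) := by
          gcongr
          linarith
      _ = _ := by ring
  have h4 : Real.sqrt ((B ^ 2 * kinForm ξ) * (S ^ 2 * expect (numOp ^ 2) ξ)) ≤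
      Real.sqrt N * (B * S * kinForm ξ) := by
    refine Real.sqrt_le_iff.mpr ⟨by positivity, ?_⟩
    rw [mul_pow, Real.sq_sqrt hN0.le]
    have h5 : expect (numOp ^ 2) ξ ≤ N * kinForm ξ :=
      (expect_numOp_sq_le hξ.1).trans (by gcongr)
    calc (B ^ 2 * kinForm ξ) * (S ^ 2 * expect (numOp ^ 2) ξ)
        ≤ (B ^ 2 * kinForm ξ) * (S ^ 2 * (N * kinForm ξ)) := by gcongr
      _ = _ := by ring
  have hsN : 0 < Real.sqrt N := Real.sqrt_pos.mpr hN0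
  have h6 : |2 / Real.sqrt N * ∑' x : CubicIdx, omegaHat V α N x.1.1.1 * cubicFn ψ ξ x| ≤
      2 * (B * S * kinForm ξ) := by
    rw [abs_mul, abs_of_pos (by positivity)]
    calc _ ≤ 2 / Real.sqrt N * (Real.sqrt N * (B * S * kinForm ξ)) := by
          gcongr
          exact h2.trans h4
      _ = _ := by field_simp
  refine (abs_add_le _ _).trans ?_
  have h7 : 0 ≤ B * S * ‖ξ‖ ^ 2 := by positivity
  linarith [h1.trans h3]

theorem abs_sub_le_of_deriv_le {f : ℝ → ℝ} (hf : ContDiff ℝ ∞ f)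
    (hb : BddAbove (Set.range fun x => |deriv f x|)) (x y : ℝ) :
    |f x - f y| ≤ (⨆ x, |deriv f x|) * |x - y| := by
  have h := Convex.norm_image_sub_le_of_norm_deriv_le (f := f) (s := Set.univ)
    (C := ⨆ x, |deriv f x|) (x := y) (y := x)
    (fun z _ => (hf.differentiable (by simp)) z) (fun z _ => le_ciSup hb z) convex_univ
    (Set.mem_univ _) (Set.mem_univ _)
  simpa using h

/-- By f² + g² = 1 at both points the expression is half the sum of the squared increments, hence
quadratic in the distance. -/
theorem abs_one_sub_partition_le {f g : ℝ → ℝ} (hf : ContDiff ℝ ∞ f) (hg : ContDiff ℝ ∞ g)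
    (h : ∀ x, f x ^ 2 + g x ^ 2 = 1) (hbf : BddAbove (Set.range fun x => |deriv f x|))
    (hbg : BddAbove (Set.range fun x => |deriv g x|)) {x y d : ℝ} (hxy : |x - y| ≤ d) :
    |1 - f x * f y - g x * g y| ≤
      d ^ 2 / 2 * ((⨆ x, |deriv f x|) ^ 2 + (⨆ x, |deriv g x|) ^ 2) := by
  have hd : 0 ≤ d := (abs_nonneg _).trans hxy
  set F := ⨆ x, |deriv f x|
  set G := ⨆ x, |deriv g x|
  have hF : 0 ≤ F := Real.iSup_nonneg fun _ => abs_nonneg _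
  have hG : 0 ≤ G := Real.iSup_nonneg fun _ => abs_nonneg _
  have e : 1 - f x * f y - g x * g y = ((f x - f y) ^ 2 + (g x - g y) ^ 2) / 2 := by
    nlinarith [h x, h y]
  rw [e, abs_of_nonneg (by positivity)]
  have h1 : (f x - f y) ^ 2 ≤ (F * d) ^ 2 := by
    rw [← sq_abs]
    have := abs_sub_le_of_deriv_le hf hbf x y
    gcongr
    exact this.trans (by gcongr)
  have h2 : (g x - g y) ^ 2 ≤ (G * d) ^ 2 := by
    rw [← sq_abs]
    have := abs_sub_le_of_deriv_le hg hbg x y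
    gcongr
    exact this.trans (by gcongr)
  nlinarith

/-! ### The lower bound -/

/-- Mode by mode completion of the square with A = (1-ε)p². In the part multiplying ‖a₋ₚ ξ‖² the
bound p² ≥ 4π² is used; in the part multiplying ‖ξ‖² the factor 1/p² is kept for the logarithmic
sum. -/
theorem pair_lower_bound {u : Mode → ℝ} {U W ε : ℝ}
    (hu : Summable fun p => u p ^ 2 / ‖mom p.1‖ ^ 2)
    (hU : ∑' p, u p ^ 2 / ‖mom p.1‖ ^ 2 ≤ U) (hW : ∀ p, u p ^ 2 ≤ W ^ 2) (hε : ε < 1)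
    {φ : ℕ → ℝ} (hφ : ∀ n, |φ n| ≤ 1) {ξ : Fock} (hξ : Summable (kinTerm ξ)) :
    -((1 - ε) * kinForm ξ) - W ^ 2 / (16 * Real.pi ^ 2 * (1 - ε)) * expect numOp ξ
        - U / (4 * (1 - ε)) * ‖ξ‖ ^ 2 ≤ ∑' p, u p * pairFn φ ξ p := by
  have hε' : 0 < 1 - ε := by linarith
  have hs := (pair_bound hu hU hφ hξ).1
  have hn := hasSum_norm_annih ξ
  have hn' : HasSum (fun p : Mode => ‖annih p.neg ξ‖ ^ 2) (expect numOp ξ) :=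
    (Mode.negEquiv.hasSum_iff (f := fun p => ‖annih p ξ‖ ^ 2)).mpr hn
  have hL := ((hξ.hasSum.mul_left (-(1 - ε))).sub
    (hn'.mul_left (W ^ 2 / (16 * Real.pi ^ 2 * (1 - ε))))).sub
    (hu.hasSum.mul_left (1 / (4 * (1 - ε)) * ‖ξ‖ ^ 2))
  have h := hasSum_le (fun p => ?_) hL hs.hasSum
  · refine le_trans ?_ h
    have h1 : 1 / (4 * (1 - ε)) * ‖ξ‖ ^ 2 * ∑' p, u p ^ 2 / ‖mom p.1‖ ^ 2 ≤
        1 / (4 * (1 - ε)) * ‖ξ‖ ^ 2 * U := by gcongr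
    have h2 : 1 / (4 * (1 - ε)) * ‖ξ‖ ^ 2 * U = U / (4 * (1 - ε)) * ‖ξ‖ ^ 2 := by ring
    have h3 : ∑' p, kinTerm ξ p = kinForm ξ := rfl
    rw [h3]
    linarith
  · have hm := norm_mom_pos p
    have hb := bogoliubov_mode (A := (1 - ε) * ‖mom p.1‖ ^ 2) (u := u p) (by positivity) hφ ξ p
    have h1 : u p ^ 2 / (4 * ((1 - ε) * ‖mom p.1‖ ^ 2)) ≤
        W ^ 2 / (16 * Real.pi ^ 2 * (1 - ε)) := by
      have h2 := four_pi_sq_le_norm_mom_sq p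
      have hpi := Real.pi_pos
      refine div_le_div₀ (sq_nonneg _) (hW p) (by positivity) ?_
      nlinarith
    have h3 : u p ^ 2 / (4 * ((1 - ε) * ‖mom p.1‖ ^ 2)) * ‖annih p.neg ξ‖ ^ 2 ≤
        W ^ 2 / (16 * Real.pi ^ 2 * (1 - ε)) * ‖annih p.neg ξ‖ ^ 2 := by gcongr
    have h4 : u p ^ 2 / (4 * ((1 - ε) * ‖mom p.1‖ ^ 2)) * ‖ξ‖ ^ 2 =
        1 / (4 * (1 - ε)) * ‖ξ‖ ^ 2 * (u p ^ 2 / ‖mom p.1‖ ^ 2) := by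
      field_simp
    rw [kinTerm_eq]
    nlinarith

theorem cubic_lower_bound {u : Mode → ℝ} {U L : ℝ} {N : ℕ} (hN : 1 ≤ N) (hL : 0 < L)
    (hu : Summable fun p => u p ^ 2 / ‖mom p.1‖ ^ 2)
    (hU : ∑' p, u p ^ 2 / ‖mom p.1‖ ^ 2 ≤ U)
    {φ : ℕ → ℝ} (hφ : ∀ n, |φ n| ≤ 1) {ξ : Fock} (hξ : Summable (kinTerm ξ)) :
    -(kinForm ξ / L) - U * L * (expect (numOp ^ 2) ξ / N) ≤
      2 / Real.sqrt N * ∑' x : CubicIdx, u x.1.1 * cubicFn φ ξ x := by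
  have h := (cubic_bound hu hU hφ hξ).2
  have hN0 : (0 : ℝ) < N := by exact_mod_cast hN
  have hsN : 0 < Real.sqrt N := Real.sqrt_pos.mpr hN0
  have hk := kinForm_nonneg ξ
  have hn := expect_numOp_sq_nonneg ξ
  have hU0 : 0 ≤ U := (tsum_nonneg fun p => by positivity).trans hU
  rw [one_pow, one_mul] at h
  set n₂ := expect (numOp ^ 2) ξ
  have h1 : Real.sqrt (kinForm ξ * (U * n₂)) ≤
      Real.sqrt N / 2 * (kinForm ξ / L + U * L * (n₂ / N)) := by
    refine Real.sqrt_le_iff.mpr ⟨by positivity, ?_⟩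
    rw [mul_pow, div_pow, Real.sq_sqrt hN0.le]
    have e : kinForm ξ * (U * n₂) = N / 2 ^ 2 * (4 * (kinForm ξ / L) * (U * L * (n₂ / N))) := by
      field_simp
      ring
    rw [e]
    have : 4 * (kinForm ξ / L) * (U * L * (n₂ / N)) ≤ (kinForm ξ / L + U * L * (n₂ / N)) ^ 2 := by
      nlinarith [sq_nonneg (kinForm ξ / L - U * L * (n₂ / N))]
    gcongr
  have h2 : -(kinForm ξ / L + U * L * (n₂ / N)) ≤
      2 / Real.sqrt N * ∑' x : CubicIdx, u x.1.1 * cubicFn φ ξ x := by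
    have h3 := (abs_le.mp (h.trans h1)).1
    calc -(kinForm ξ / L + U * L * (n₂ / N))
        = 2 / Real.sqrt N * (-(Real.sqrt N / 2 * (kinForm ξ / L + U * L * (n₂ / N)))) := by
          field_simp
      _ ≤ _ := by gcongr
  linarith

theorem inv_one_sub_le {ε : ℝ} (h0 : 0 ≤ ε) (h1 : ε ≤ 1 / 2) : 1 / (1 - ε) ≤ 1 + 2 * ε := by
  rw [div_le_iff₀ (by linarith)]
  nlinarith

/-- Bookkeeping with ε = (c+1)/L: n₁, n₂, K, P, X stand for ⟨𝒩₊⟩, ⟨𝒩₊²⟩, kinetic energy, potential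
energy and ‖ξ‖². The coefficient of n₁ is πg(-½ + 3/2 - ½) = πg/2. -/
theorem effForm_scalar_bound {N g L α c B ε n₁ n₂ K P X Sp Sc : ℝ} (hN : 0 < N) (hα : 0 < α)
    (hc : 0 < c) (hL : 10 * (c + 1) ≤ L) (hg : 0 < g) (hg2 : g ≤ 20) (hεL : ε * L = c + 1)
    (hε0 : 0 ≤ ε) (hε1 : ε ≤ 1 / 10) (hn1 : 0 ≤ n₁) (hn2 : 0 ≤ n₂) (hX : 0 ≤ X) (hP : 0 ≤ P)
    (hpair : -((1 - ε) * K) - (Real.pi * g) ^ 2 / (16 * Real.pi ^ 2 * (1 - ε)) * n₁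
        - g ^ 2 / 4 * (2 * Real.pi * (α * L) + 30) / (4 * (1 - ε)) * X ≤ Sp)
    (hcub : -(K / L) - g ^ 2 / 4 * (2 * Real.pi * (α * L) + 30) * L * (n₂ / N) ≤ Sc)
    (hlead : 2 * Real.pi * N - 2 * Real.pi * B - (4 * Real.pi * α * (c + 1) + 60) - 1 ≤
      1 / 2 * N * (Real.pi * g) -
        g ^ 2 / 16 * (2 * Real.pi * (α * L) + (4 * Real.pi * α * (c + 1) + 60))) :
    2 * Real.pi * N * X + Real.pi * g / 2 * n₁ + c / L * (K + P)
          - (30 * Real.pi + 100 * (2 * Real.pi * α + 30)) * L ^ 2 * (n₂ / N)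
          - (2 * Real.pi * |B| + (4 * Real.pi * α * (c + 1) + 60) + 1 + 10 * Real.pi) * X
        ≤ 1 / 2 * (N - 1) * (Real.pi * g) * (X - n₁ / N) + 3 / 2 * (Real.pi * g) * (n₁ - n₂ / N)
          + Sp + Sc + (K + P) := by
  have hpi := Real.pi_pos
  have hpi3 := Real.pi_gt_d2
  have hL0 : 0 < L := by linarith only [hL, hc]
  have hL1 : 1 ≤ L := by linarith only [hL, hc]
  have hε' : 9 / 10 ≤ 1 - ε := by linarith only [hε1]
  have hε'' : 0 < 1 - ε := by linarith only [hε']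
  -- Equivalent to g ≤ 8π(1-ε), which holds since g ≤ 20 and ε ≤ 1/10.
  have a1 : (Real.pi * g) ^ 2 / (16 * Real.pi ^ 2 * (1 - ε)) * n₁ ≤ Real.pi * g / 2 * n₁ := by
    refine mul_le_mul_of_nonneg_right ?_ hn1
    rw [div_le_iff₀ (by positivity)]
    have h0 : 8 * Real.pi * (9 / 10) ≤ 8 * Real.pi * (1 - ε) := by gcongr
    have h1 : g ≤ 8 * Real.pi * (1 - ε) := by linarith only [h0, hpi3, hg2]
    calc (Real.pi * g) ^ 2 = Real.pi ^ 2 * g * g := by ring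
      _ ≤ Real.pi ^ 2 * g * (8 * Real.pi * (1 - ε)) := by gcongr
      _ = _ := by ring
  -- Giving up the fraction ε of 𝒦 multiplies the logarithmic term by at most 1 + 2ε; as εL = c + 1,
  -- this costs a constant.
  have a2 : g ^ 2 / 4 * (2 * Real.pi * (α * L) + 30) / (4 * (1 - ε)) * X ≤
      g ^ 2 / 16 * (2 * Real.pi * (α * L) + (4 * Real.pi * α * (c + 1) + 60)) * X := by
    refine mul_le_mul_of_nonneg_right ?_ hX
    have h1 := inv_one_sub_le hε0 (by linarith only [hε1])
    have h2 : g ^ 2 / 4 * (2 * Real.pi * (α * L) + 30) / (4 * (1 - ε)) =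
        g ^ 2 / 16 * ((2 * Real.pi * (α * L) + 30) * (1 / (1 - ε))) := by
      field_simp
      ring
    rw [h2]
    have h3 : (2 * Real.pi * (α * L) + 30) * (1 / (1 - ε)) ≤
        2 * Real.pi * (α * L) + (4 * Real.pi * α * (c + 1) + 60) := by
      calc _ ≤ (2 * Real.pi * (α * L) + 30) * (1 + 2 * ε) := by gcongr
        _ = 2 * Real.pi * (α * L) + 4 * Real.pi * α * (ε * L) + (30 + 60 * ε) := by ring
        _ ≤ _ := by rw [hεL]; linarith only [hε1]
    gcongr
  have a3 : g ^ 2 / 4 * (2 * Real.pi * (α * L) + 30) * L * (n₂ / N) ≤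
      100 * (2 * Real.pi * α + 30) * L ^ 2 * (n₂ / N) := by
    refine mul_le_mul_of_nonneg_right ?_ (by positivity)
    have h2 : g ^ 2 / 4 ≤ 100 := by nlinarith only [hg, hg2]
    have h3 : 2 * Real.pi * (α * L) + 30 ≤ (2 * Real.pi * α + 30) * L := by
      linarith only [hL1]
    calc _ ≤ 100 * ((2 * Real.pi * α + 30) * L) * L := by gcongr
      _ = _ := by ring
  have a4 : 3 / 2 * (Real.pi * g) * (n₂ / N) ≤ 30 * Real.pi * L ^ 2 * (n₂ / N) := by
    refine mul_le_mul_of_nonneg_right ?_ (by positivity)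
    calc 3 / 2 * (Real.pi * g) ≤ 3 / 2 * (Real.pi * 20) := by gcongr
      _ = 30 * Real.pi * 1 ^ 2 := by ring
      _ ≤ _ := by gcongr
  have a5 : c / L * P ≤ P := by
    refine mul_le_of_le_one_left hP ?_
    rw [div_le_one hL0]
    linarith only [hL, hc]
  have a6 : c / L * K = ε * K - K / L := by
    rw [eq_div_of_mul_eq hL0.ne' hεL]
    ring
  have a7 : 1 / 2 * (Real.pi * g) * X ≤ 10 * Real.pi * X := by
    refine mul_le_mul_of_nonneg_right ?_ hX
    calc 1 / 2 * (Real.pi * g) ≤ 1 / 2 * (Real.pi * 20) := by gcongr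
      _ = _ := by ring
  have a8 : (2 * Real.pi * N - 2 * Real.pi * |B| - (4 * Real.pi * α * (c + 1) + 60) - 1) * X ≤
      (1 / 2 * N * (Real.pi * g) -
        g ^ 2 / 16 * (2 * Real.pi * (α * L) + (4 * Real.pi * α * (c + 1) + 60))) * X := by
    refine mul_le_mul_of_nonneg_right (le_trans ?_ hlead) hX
    have h1 : Real.pi * B ≤ Real.pi * |B| := by gcongr; exact le_abs_self B
    linarith only [h1]
  have a9 : 0 ≤ 1 / 2 * (Real.pi * g) * (n₁ / N) := by positivity
  have a10 : 1 / 2 * (N - 1) * (Real.pi * g) * (X - n₁ / N) =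
      1 / 2 * N * (Real.pi * g) * X - 1 / 2 * (Real.pi * g) * X - 1 / 2 * (Real.pi * g) * n₁ +
        1 / 2 * (Real.pi * g) * (n₁ / N) := by
    field_simp
    ring
  rw [a10]
  linarith only [hpair, hcub, a1, a2, a3, a4, a5, a6, a7, a8, a9]

theorem effForm_lower_bound {V : Plane → ℝ} {α c B : ℝ} (hα : 0 < α) (hc : 0 < c) {N : ℕ}
    (hN : 1 ≤ N)
    (hg0 : 0 < N - (α * Real.log N - B))
    (hg1 : 4 * N / (N - (α * Real.log N - B)) ≤ gN V α N) (hg2 : gN V α N ≤ 20)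
    (hL : 10 * (c + 1) ≤ Real.log N) (hy : 0 ≤ α * Real.log N - B)
    (hyN : 2 * (α * Real.log N - B) ≤ N)
    (hTN : 5 * (2 * Real.pi * (α * Real.log N) + (4 * Real.pi * α * (c + 1) + 60)) ≤ N)
    (hyT : 6 * ((α * Real.log N - B) *
      (2 * Real.pi * (α * Real.log N) + (4 * Real.pi * α * (c + 1) + 60))) ≤ N)
    {ξ : Fock} (hξ : ξ ∈ formDomain N) (hpot : 0 ≤ potForm V N ξ) :
    2 * Real.pi * N * ‖ξ‖ ^ 2 + omegaHat V α N 0 / 2 * expect numOp ξ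
          + c / Real.log N * energyForm V N ξ
          - (30 * Real.pi + 100 * (2 * Real.pi * α + 30)) * Real.log N ^ 2 *
            (expect (numOp ^ 2) ξ / N)
          - (2 * Real.pi * |B| + (4 * Real.pi * α * (c + 1) + 60) + 1 + 10 * Real.pi) * ‖ξ‖ ^ 2
        ≤ effForm V α N ξ := by
  have hL0 : 0 < Real.log N := by linarith only [hL, hc]
  have hpi := Real.pi_pos
  have hN0 : (0 : ℝ) < N := by exact_mod_cast hN
  have hT0 : 0 ≤ 2 * Real.pi * (α * Real.log N) + (4 * Real.pi * α * (c + 1) + 60) := by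
    positivity
  have hgpos : 0 < gN V α N := lt_of_lt_of_le (by positivity) hg1
  obtain ⟨hu, hU⟩ := omegaHat_sum V hα hN
  have hε0 : 0 ≤ (c + 1) / Real.log N := by positivity
  have hε1 : (c + 1) / Real.log N ≤ 1 / 10 := by
    rw [div_le_iff₀ hL0]
    linarith only [hL]
  have hpair := pair_lower_bound hu hU (W := Real.pi * gN V α N) (ε := (c + 1) / Real.log N)
    (fun p => omegaHat_sq_le V α N p.1) (by linarith only [hε1]) (abs_pairCoeff_le N) hξ.2
  have hcub := cubic_lower_bound hN hL0 hu hU (abs_cubicCoeff_le N) hξ.2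
  have hlead := leading_energy_ge hN0 hy hyN hT0 hTN hyT hg1 hg2
  have e1 : expect (numFn fun n => 1 - (n : ℝ) / N) ξ = ‖ξ‖ ^ 2 - expect numOp ξ / N := by
    have h1 := expect_numFn_add (fun _ => 1) (fun n => -(1 / (N : ℝ)) * n) ξ
    rw [expect_numFn_one, expect_numFn_const_mul] at h1
    have h2 : (fun n : ℕ => 1 - (n : ℝ) / N) = fun n : ℕ => 1 + -(1 / (N : ℝ)) * n := by
      funext n
      ring
    rw [h2, h1]
    change ‖ξ‖ ^ 2 + -(1 / (N : ℝ)) * expect numOp ξ = _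
    ring
  have e2 : expect (numFn fun n => (n : ℝ) * (1 - n / N)) ξ =
      expect numOp ξ - expect (numOp ^ 2) ξ / N := by
    have h1 := expect_numFn_add (fun n => (n : ℝ)) (fun n => -(1 / (N : ℝ)) * (n : ℝ) ^ 2) ξ
    rw [expect_numFn_const_mul, ← expect_numOp_sq] at h1
    have h2 : (fun n : ℕ => (n : ℝ) * (1 - (n : ℝ) / N)) =
        fun n : ℕ => (n : ℝ) + -(1 / (N : ℝ)) * (n : ℝ) ^ 2 := by
      funext n
      ring
    rw [h2, h1]
    change expect numOp ξ + -(1 / (N : ℝ)) * expect (numOp ^ 2) ξ = _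
    ring
  rw [effForm_eq, e1, e2, omegaHat_zero, energyForm]
  exact effForm_scalar_bound hN0 hα hc hL hgpos hg2 (div_mul_cancel₀ _ hL0.ne') hε0 hε1
    (expect_numOp_nonneg ξ) (expect_numOp_sq_nonneg ξ) (sq_nonneg _) hpot hpair hcub
    (by linarith only [hlead])

theorem eventually_effForm_lower_bound {V : Plane → ℝ} (hV : MemLp V 3)
    (h0 : ∀ᵐ x, 0 ≤ V x) (hrad : ∃ v : ℝ → ℝ, ∀ᵐ x, V x = v ‖x‖) (hne : ¬ ∀ᵐ x, V x = 0)
    {R₀ : ℝ} (hsupp : ∀ᵐ x, R₀ < ‖x‖ → V x = 0) {α c : ℝ} (hα : 0 < α) (hc : 0 < c) :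
    ∃ C : ℝ, 0 < C ∧ ∀ᶠ N : ℕ in Filter.atTop, ∀ ξ ∈ formDomain N,
      2 * Real.pi * N * ‖ξ‖ ^ 2 + omegaHat V α N 0 / 2 * expect numOp ξ
          + c / Real.log N * energyForm V N ξ
          - C * Real.log N ^ 2 * (expect (numOp ^ 2) ξ / N) - C * ‖ξ‖ ^ 2
        ≤ effForm V α N ξ := by
  have hVi : Integrable V :=
    memLp_one_iff_integrable.mp (memLp_of_ae_bounded_support hV hsupp (by norm_num))
  obtain ⟨B, hB⟩ := exists_gN_bounds hVi h0 hrad hne hsupp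
  have hpi := Real.pi_pos
  set C₁ := 30 * Real.pi + 100 * (2 * Real.pi * α + 30) with hC₁
  set C₂ := 2 * Real.pi * |B| + (4 * Real.pi * α * (c + 1) + 60) + 1 + 10 * Real.pi with hC₂
  have hC₁0 : 0 < C₁ := by positivity
  have hC₂0 : 0 < C₂ := by positivity
  refine ⟨C₁ + C₂, by positivity, ?_⟩
  set D := 2 * Real.pi * α + (4 * Real.pi * α * (c + 1) + 60) with hD
  have hD0 : 0 < D := by positivity
  -- A sum of non-negative terms, one for each smallness condition on log N or (log N)²/N, so a
  -- single threshold meets them all.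
  set E := 10 * (c + 1) + |B| / α + 6 * ((α + |B|) * D) + 5 * D + 2 * (α + |B|) with hE
  have hB0 := abs_nonneg B
  have t1 : 0 ≤ |B| / α := by positivity
  have t2 : 0 ≤ 6 * ((α + |B|) * D) := by positivity
  filter_upwards [hB α hα, eventually_log_sq_le E] with N hg hN ξ hξ
  obtain ⟨g0, g1, g2⟩ := hg
  obtain ⟨k1, k2⟩ := hN
  set L := Real.log N with hL
  have hL1 : 1 ≤ L := by linarith
  have hLL : L ≤ L ^ 2 := by nlinarith
  have hN1 : 1 ≤ N := by
    rcases Nat.eq_zero_or_pos N with h | h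
    · simp [hL, h] at hL1
      linarith
    · exact h
  have hN0 : (0 : ℝ) < N := by exact_mod_cast hN1
  have hyle : α * L - B ≤ (α + |B|) * L := by nlinarith [neg_abs_le B]
  have hTle : 2 * Real.pi * (α * L) + (4 * Real.pi * α * (c + 1) + 60) ≤ D * L := by
    have : 0 ≤ 4 * Real.pi * α * (c + 1) + 60 := by positivity
    rw [hD]
    nlinarith
  have hy0 : 0 ≤ α * L - B := by
    have h1 : |B| / α ≤ L := by linarith
    rw [div_le_iff₀ hα] at h1
    linarith [le_abs_self B]
  have hmul : ∀ F : ℝ, F ≤ E → F * L ^ 2 ≤ N := fun F hF =>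
    (mul_le_mul_of_nonneg_right hF (sq_nonneg _)).trans k2
  have s1 := hmul (2 * (α + |B|)) (by linarith)
  have s2 := hmul (5 * D) (by linarith)
  have s3 := hmul (6 * ((α + |B|) * D)) (by linarith)
  have hpot : 0 ≤ potForm V N ξ :=
    potForm_nonneg hVi h0 N (formConverges hV hsupp hα hN1 hξ).2.1
  have h := effForm_lower_bound hα hc hN1 g0 g1 g2 (by linarith) hy0
    (by
      have : (α + |B|) * L ≤ (α + |B|) * L ^ 2 := by gcongr
      linarith)
    (by
      have : D * L ≤ D * L ^ 2 := by gcongr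
      linarith)
    (by
      have h1 : (α * L - B) * (2 * Real.pi * (α * L) + (4 * Real.pi * α * (c + 1) + 60)) ≤
          ((α + |B|) * L) * (D * L) := by gcongr
      have h2 : ((α + |B|) * L) * (D * L) = (α + |B|) * D * L ^ 2 := by ring
      linarith) hξ hpot
  refine le_trans ?_ h
  have hn2 := expect_numOp_sq_nonneg ξ
  have r1 : 0 ≤ C₂ * L ^ 2 * (expect (numOp ^ 2) ξ / N) := by positivity
  have r2 : 0 ≤ C₁ * ‖ξ‖ ^ 2 := by positivity
  linarith

/-! ### Uniform bound on the localisation error -/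

/-- The sum is O(α log N), and for N large depending on α one factor log N absorbs α. This makes the
localisation constant independent of α. -/
theorem eventually_omegaHat_sum_le {V : Plane → ℝ} (hV : Integrable V)
    (h0 : ∀ᵐ x, 0 ≤ V x) (hrad : ∃ v : ℝ → ℝ, ∀ᵐ x, V x = v ‖x‖) (hne : ¬ ∀ᵐ x, V x = 0)
    {R₀ : ℝ} (hsupp : ∀ᵐ x, R₀ < ‖x‖ → V x = 0) {α : ℝ} (hα : 0 < α) :
    ∀ᶠ N : ℕ in Filter.atTop, 1 ≤ N ∧ 0 ≤ Real.log N ∧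
      ∑' p : Mode, omegaHat V α N p.1 ^ 2 / ‖mom p.1‖ ^ 2 ≤ Real.log N ^ 2 := by
  obtain ⟨B, hB⟩ := exists_gN_bounds hV h0 hrad hne hsupp
  have hpi := Real.pi_pos
  filter_upwards [hB α hα, eventually_log_sq_le (100 * (2 * Real.pi * α + 30)),
    Filter.eventually_ge_atTop 1] with N hg hN hN1
  obtain ⟨g0, g1, g2⟩ := hg
  set L := Real.log N with hL
  have t : 0 ≤ 2 * Real.pi * α := by positivity
  have hL1 : 1 ≤ L := by linarith [hN.1]
  refine ⟨hN1, by linarith, (omegaHat_sum V hα hN1).2.trans ?_⟩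
  rw [← hL]
  have hN0 : (0 : ℝ) < N := by exact_mod_cast hN1
  have hgpos : 0 < gN V α N := lt_of_lt_of_le (by positivity) g1
  have h2 : gN V α N ^ 2 / 4 ≤ 100 := by nlinarith
  calc gN V α N ^ 2 / 4 * (2 * Real.pi * (α * L) + 30)
      ≤ 100 * (2 * Real.pi * (α * L) + 30) := by gcongr
    _ ≤ 100 * (2 * Real.pi * α + 30) * L := by nlinarith
    _ ≤ L * L := by
        have := hN.1
        gcongr
    _ = L ^ 2 := by ring

theorem effForm_localization_error_le {V : Plane → ℝ} (hV : MemLp V 3) (h0 : ∀ᵐ x, 0 ≤ V x)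
    {R₀ : ℝ} (hsupp : ∀ᵐ x, R₀ < ‖x‖ → V x = 0) {α : ℝ} (hα : 0 < α) {N : ℕ} (hN : 1 ≤ N)
    (hL : 0 ≤ Real.log N)
    (hU : ∑' p : Mode, omegaHat V α N p.1 ^ 2 / ‖mom p.1‖ ^ 2 ≤ Real.log N ^ 2)
    {M : ℕ} (hM : 1 ≤ M) {f g : ℝ → ℝ} (hf : ContDiff ℝ ∞ f) (hg : ContDiff ℝ ∞ g)
    (hfg : ∀ x, f x ^ 2 + g x ^ 2 = 1)
    (hbf : BddAbove (Set.range fun x => |deriv f x|))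
    (hbg : BddAbove (Set.range fun x => |deriv g x|)) {ξ : Fock} (hξ : ξ ∈ formDomain N) :
    |effForm V α N ξ - effForm V α N (localize f M ξ) - effForm V α N (localize g M ξ)| ≤
      6 * Real.log N / (M : ℝ) ^ 2 * ((⨆ x, |deriv f x|) ^ 2 + (⨆ x, |deriv g x|) ^ 2)
        * (energyForm V N ξ + ‖ξ‖ ^ 2) := by
  have hVi : Integrable V :=
    memLp_one_iff_integrable.mp (memLp_of_ae_bounded_support hV hsupp (by norm_num))
  have hpot : 0 ≤ potForm V N ξ :=
    potForm_nonneg hVi h0 N (formConverges hV hsupp hα hN hξ).2.1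
  have hM0 : (0 : ℝ) < M := by exact_mod_cast hM
  set Q := (⨆ x, |deriv f x|) ^ 2 + (⨆ x, |deriv g x|) ^ 2 with hQ
  have hQ0 : 0 ≤ Q := by positivity
  -- The largest shift is two particles, so arguments differ by at most 2/M and D = 2Q/M²; the
  -- factor 3 of `localization_bound` then gives the constant 6.
  set D := (2 / (M : ℝ)) ^ 2 / 2 * Q with hD
  have hD0 : 0 ≤ D := by positivity
  have hloc := effForm_localization (f := fun n => f ((n : ℝ) / M)) (g := fun n => g ((n : ℝ) / M))
    hV hsupp hα hN (fun n => hfg _) hξ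
  rw [localize, localize, hloc]
  have hcoef : ∀ (a x y : ℝ), |a| ≤ 1 → |x - y| ≤ 2 / M →
      |a * (1 - f x * f y - g x * g y)| ≤ D := by
    intro a x y ha hxy
    rw [abs_mul]
    have h1 := abs_one_sub_partition_le hf hg hfg hbf hbg hxy
    calc |a| * |1 - f x * f y - g x * g y| ≤ 1 * D := by gcongr
      _ = D := one_mul _
  have h := localization_bound V hα hN (S := Real.log N) (B := D) hL hD0 hU
    (φ := fun n => pairCoeff N n * (1 - f ((n : ℝ) / M) * f (((n + 2 : ℕ) : ℝ) / M) -
      g ((n : ℝ) / M) * g (((n + 2 : ℕ) : ℝ) / M)))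
    (ψ := fun n => cubicCoeff N n * (1 - f (((n + 1 : ℕ) : ℝ) / M) * f (((n + 2 : ℕ) : ℝ) / M) -
      g (((n + 1 : ℕ) : ℝ) / M) * g (((n + 2 : ℕ) : ℝ) / M)))
    (fun n => hcoef _ _ _ (abs_pairCoeff_le N n) (by
      rw [abs_sub_comm, ← sub_div]
      push_cast
      rw [add_sub_cancel_left, abs_of_pos (by positivity)]))
    (fun n => hcoef _ _ _ (abs_cubicCoeff_le N n) (by
      rw [abs_sub_comm, ← sub_div]
      push_cast
      rw [add_sub_add_left_eq_sub, abs_of_nonneg (by norm_num)]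
      gcongr
      norm_num)) hξ
  refine h.trans ?_
  have hk : kinForm ξ + ‖ξ‖ ^ 2 ≤ energyForm V N ξ + ‖ξ‖ ^ 2 := by
    rw [energyForm]
    linarith
  calc 3 * D * Real.log N * (kinForm ξ + ‖ξ‖ ^ 2)
      ≤ 3 * D * Real.log N * (energyForm V N ξ + ‖ξ‖ ^ 2) := by gcongr
    _ = _ := by
        rw [hD]
        field_simp
        ring

end BoseGas

end

theorem mainTheorem5 (V : BoseGas.Plane → ℝ)
    (hV : MeasureTheory.MemLp V 3 MeasureTheory.volume)
    (hsupp : ∃ R₀ : ℝ, ∀ᵐ x ∂MeasureTheory.volume, R₀ < ‖x‖ → V x = 0)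
    (hnonneg : ∀ᵐ x ∂MeasureTheory.volume, 0 ≤ V x)
    (hradial : ∃ v : ℝ → ℝ, ∀ᵐ x ∂MeasureTheory.volume, V x = v ‖x‖)
    (hne : ¬ ∀ᵐ x ∂MeasureTheory.volume, V x = 0) :
    -- the quadratic form is well defined on the form domain
    (∀ α : ℝ, 2 < α → ∀ N : ℕ, 1 ≤ N → ∀ ξ ∈ BoseGas.formDomain N,
      BoseGas.FormConverges V α N ξ) ∧
    -- the lower bound
    (∀ α : ℝ, 2 < α → ∀ c : ℝ, 0 < c → ∃ C : ℝ, 0 < C ∧ ∃ N₀ : ℕ, ∀ N : ℕ, N₀ ≤ N →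
      ∀ ξ ∈ BoseGas.formDomain N,
        2 * Real.pi * N * ‖ξ‖ ^ 2
          + BoseGas.omegaHat V α N 0 / 2 * BoseGas.expect BoseGas.numOp ξ
          + c / Real.log N * BoseGas.energyForm V N ξ
          - C * Real.log N ^ 2 * (BoseGas.expect (BoseGas.numOp ^ 2) ξ / N)
          - C * ‖ξ‖ ^ 2
        ≤ BoseGas.effForm V α N ξ) ∧
    -- localization in the number of particles
    (∃ C : ℝ, 0 < C ∧ ∀ α : ℝ, 2 < α → ∃ N₀ : ℕ, ∀ N : ℕ, N₀ ≤ N → ∀ M : ℕ, 1 ≤ M →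
      ∀ f g : ℝ → ℝ, ContDiff ℝ ∞ f → ContDiff ℝ ∞ g →
        (∀ x, f x ∈ Set.Icc (0 : ℝ) 1) → (∀ x, g x ∈ Set.Icc (0 : ℝ) 1) →
        (∀ x, f x ^ 2 + g x ^ 2 = 1) →
        ∃ Θ : BoseGas.Fock → ℝ,
          (∀ ξ ∈ BoseGas.formDomain N,
            BoseGas.effForm V α N ξ
              = BoseGas.effForm V α N (BoseGas.localize f M ξ)
                + BoseGas.effForm V α N (BoseGas.localize g M ξ) + Θ ξ) ∧
          (BddAbove (Set.range fun x => |deriv f x|) →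
            BddAbove (Set.range fun x => |deriv g x|) →
            ∀ ξ ∈ BoseGas.formDomain N,
              |Θ ξ| ≤ C * Real.log N / (M : ℝ) ^ 2
                * ((⨆ x, |deriv f x|) ^ 2 + (⨆ x, |deriv g x|) ^ 2)
                * (BoseGas.energyForm V N ξ + ‖ξ‖ ^ 2))) := by
  obtain ⟨R₀, hR₀⟩ := hsupp
  have hVi : MeasureTheory.Integrable V := MeasureTheory.memLp_one_iff_integrable.mp
    (BoseGas.memLp_of_ae_bounded_support hV hR₀ (by norm_num))
  refine ⟨fun α hα N hN ξ hξ => BoseGas.formConverges hV hR₀ (by linarith) hN hξ,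
    fun α hα c hc => ?_, 6, by norm_num, fun α hα => ?_⟩
  · obtain ⟨C, hC, h⟩ := BoseGas.eventually_effForm_lower_bound hV hnonneg hradial hne hR₀
      (by linarith : (0 : ℝ) < α) hc
    exact ⟨C, hC, Filter.eventually_atTop.mp h⟩
  · obtain ⟨N₀, hN₀⟩ := Filter.eventually_atTop.mp
      (BoseGas.eventually_omegaHat_sum_le hVi hnonneg hradial hne hR₀ (by linarith : (0 : ℝ) < α))
    refine ⟨N₀, fun N hN M hM f g hf hg _ _ hfg => ?_⟩
    obtain ⟨h1, h2, h3⟩ := hN₀ N hN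
    refine ⟨fun ξ => BoseGas.effForm V α N ξ - BoseGas.effForm V α N (BoseGas.localize f M ξ) -
      BoseGas.effForm V α N (BoseGas.localize g M ξ), fun ξ _ => by ring, fun hbf hbg ξ hξ => ?_⟩
    exact BoseGas.effForm_localization_error_le hV hnonneg hR₀ (by linarith) h1 h2 h3 hM hf hg hfg
      hbf hbg hξ
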